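/- **Conventions.** The input of *Bichromatic Radius* is a connected undirected graph $G=(V,E)$ with $n$ vertices, $m$ edges and nonnegative integer edge weights, together with a set $S\subseteq V$ such that $S$ and $T=V\setminus S$ are both nonempty. With $d$ the weighted shortest-path distance, the $ST$-radius is $R_{ST}=\min_{s\in S}\max_{t\in T}d(s,t)$. For $\alpha\in\mathbb R$, an *$\alpha$-approximation* is an integer $R'$ with $R_{ST}\le R'\le\alpha R_{ST}$. Algorithms are randomized programs for the word-RAM with unit-cost operations, where a word has $O(\log N)$ bits, $N$ being the size of the input (the number of input words plus the largest input number): for some constant $c$ depending on the program, the program has to work for every word length $w\ge c\log N$. Time bounds hold for all random choices. The graph is given by $n$, $m$, the indicator vector of $S$, and a list of the edges with their weights, in arbitrary order. *Hitting Set* is the following problem: given two sets $U,W\subseteq\{0,1\}^d$ with $|U|=|W|=n$, decide whether there is $u\in U$ such that $u\cdot v\ne 0$ for all $v\in W$. The *Hitting Set Hypothesis* states that for some dimension $d=d(n)$ with $d=\omega(\log n)$ and $d=n^{o(1)}$ the problem requires $n^{2-o(1)}$ time, that is, for no $\delta>0$ is there an algorithm that runs in $O(n^{2-\delta})$ time and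 answers correctly with probability at least $2/3$ on every instance with $n\geq 1$ vectors in each set and dimension $d(n)$. **Theorem.** 1. For every constant $k\in\mathbb N$ there is an algorithm for Bichromatic Radius that runs in $\tilde O(m^{3/2})$ time (that is, in time $O(m^{3/2}\log^{q}(m+2))$ for some constant $q$) and on every input outputs, with probability at least $1-1/n^k$, an integer $R'$ with $$R_{ST}\le R'\le \tfrac53 R_{ST}.$$ 2. If the Hitting Set Hypothesis holds, then for all $\varepsilon,\delta>0$ there is no algorithm that runs in $O(m^{2-\delta})$ time and outputs a $(5/3-\varepsilon)$-approximation with probability at least $2/3$ on every input of Bichromatic Radius in which all edge weights are $1$. -/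

import Mathlib

/-! ## A randomized word-RAM with structured control flow -/

namespace WordRAM

/-- Unit-cost operations on machine words. -/
inductive Op
  | add | sub | mul | div | mod | and | or | xor | shl | shr | lt | eq

/-- Semantics of the operations on words of `w` bits: arithmetic is unsigned and modulo `2 ^ w`,
comparisons return `1` or `0`. -/
def Op.eval {w : ℕ} : Op → BitVec w → BitVec w → BitVec w
  | .add, a, b => a + b
  | .sub, a, b => a - b
  | .mul, a, b => a * b
  | .div, a, b => a / b
  | .mod, a, b => a % b
  | .and, a, b => a &&& b
  | .or, a, b => a ||| b
  | .xor, a, b => a ^^^ b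
  | .shl, a, b => a <<< b.toNat
  | .shr, a, b => a >>> b.toNat
  | .lt, a, b => if a.toNat < b.toNat then BitVec.ofNat w 1 else BitVec.ofNat w 0
  | .eq, a, b => if a = b then BitVec.ofNat w 1 else BitVec.ofNat w 0

/-- Programs. Registers are numbered by natural numbers; a program, being a finite syntax tree,
mentions only finitely many of them. A program is independent of the input and of the word length.
Structured control flow replaces jumps. -/
inductive Prog
  /-- write a constant into register `dst` -/
  | const (dst k : ℕ)
  /-- apply an operation to the registers `a` and `b`, and write the result into `dst` -/
  | op (o : Op) (dst a b : ℕ)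
  /-- read the memory cell whose address is in register `addr` -/
  | load (dst addr : ℕ)
  /-- write register `src` into the memory cell whose address is in register `addr` -/
  | store (addr src : ℕ)
  /-- write a fresh uniformly random word into register `dst` -/
  | rand (dst : ℕ)
  /-- sequential composition -/
  | seq (p q : Prog)
  /-- run `p` if register `r` is nonzero, and `q` otherwise -/
  | branch (r : ℕ) (p q : Prog)
  /-- run `p` as long as register `r` is nonzero -/
  | loop (r : ℕ) (p : Prog)

/-- A machine state for word length `w`: registers, a memory addressed by words, and the number of
random words consumed so far. -/
@[ext] structure State (w : ℕ) where
  reg : ℕ → BitVec w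
  mem : BitVec w → BitVec w
  used : ℕ

/-- `s.setReg r x` is the state `s` with `x` written into register `r`. -/
def State.setReg {w : ℕ} (s : State w) (r : ℕ) (x : BitVec w) : State w :=
  { s with reg := Function.update s.reg r x }

/-- `s.setMem a x` is the state `s` with `x` written into the memory cell `a`. -/
def State.setMem {w : ℕ} (s : State w) (a x : BitVec w) : State w :=
  { s with mem := Function.update s.mem a x }

/-- A tape of random words of `w` bits. -/
abbrev Tape (w : ℕ) : Type := ℕ → Fin (2 ^ w)

/-- `Exec ω P s t s'`: with random tape `ω`, the program `P` started in state `s` halts in state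
`s'` after exactly `t` steps. Every instruction and every test costs one step. -/
inductive Exec {w : ℕ} (ω : Tape w) : Prog → State w → ℕ → State w → Prop
  | const (dst k : ℕ) (s : State w) :
      Exec ω (.const dst k) s 1 (s.setReg dst (BitVec.ofNat w k))
  | op (o : Op) (dst a b : ℕ) (s : State w) :
      Exec ω (.op o dst a b) s 1 (s.setReg dst (o.eval (s.reg a) (s.reg b)))
  | load (dst addr : ℕ) (s : State w) :
      Exec ω (.load dst addr) s 1 (s.setReg dst (s.mem (s.reg addr)))
  | store (addr src : ℕ) (s : State w) :
      Exec ω (.store addr src) s 1 (s.setMem (s.reg addr) (s.reg src))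
  | rand (dst : ℕ) (s : State w) :
      Exec ω (.rand dst) s 1
        { s.setReg dst (BitVec.ofFin (ω s.used)) with used := s.used + 1 }
  | seq (p q : Prog) (s s' s'' : State w) (t t' : ℕ) :
      Exec ω p s t s' → Exec ω q s' t' s'' → Exec ω (.seq p q) s (t + t') s''
  | branch_true (r : ℕ) (p q : Prog) (s s' : State w) (t : ℕ) :
      s.reg r ≠ 0 → Exec ω p s t s' → Exec ω (.branch r p q) s (t + 1) s'
  | branch_false (r : ℕ) (p q : Prog) (s s' : State w) (t : ℕ) :
      s.reg r = 0 → Exec ω q s t s' → Exec ω (.branch r p q) s (t + 1) s'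
  | loop_false (r : ℕ) (p : Prog) (s : State w) :
      s.reg r = 0 → Exec ω (.loop r p) s 1 s
  | loop_true (r : ℕ) (p : Prog) (s s' s'' : State w) (t t' : ℕ) :
      s.reg r ≠ 0 → Exec ω p s t s' → Exec ω (.loop r p) s' t' s'' →
      Exec ω (.loop r p) s (t + t' + 1) s''

/-- The initial state: the input is stored in the memory from address `0` on, all other memory
cells and all registers contain `0`. -/
def State.init (w : ℕ) (x : List ℕ) : State w where
  reg := fun _ => 0
  mem := fun a => BitVec.ofNat w (x.getD a.toNat 0)
  used := 0

/-- The probability measure on random tapes: independent, uniformly random words. -/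
noncomputable def tapeMeasure (w : ℕ) : MeasureTheory.Measure (Tape w) :=
  MeasureTheory.Measure.infinitePi fun _ : ℕ =>
    (PMF.uniformOfFintype (Fin (2 ^ w))).toMeasure

/-- The logarithm (to base two, rounded up) of the size of an input, which accounts for the number
of input words and for the largest number among them. -/
def inputBits (x : List ℕ) : ℕ := Nat.clog 2 (x.length + x.foldr max 0 + 2)

/-- On input `x` and with word length `w`, the program `P` halts within `T` steps, whatever the
random tape is, and with probability at least `p` its output, the final content of register `0`,
satisfies `good`. -/
def Computes (P : Prog) (w : ℕ) (x : List ℕ) (T p : ℝ) (good : ℕ → Prop) : Prop :=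
  (∀ ω : Tape w, ∃ (t : ℕ) (s : State w), Exec ω P (State.init w x) t s ∧ (t : ℝ) ≤ T) ∧
  p ≤ (tapeMeasure w).real
    {ω : Tape w | ∃ (t : ℕ) (s : State w),
      Exec ω P (State.init w x) t s ∧ good (s.reg 0).toNat}

end WordRAM

/-! ## The Hitting Set problem -/

/-- An instance of Hitting Set: two sets of `n` vectors each from `{0,1}^d`, each of them listed
without repetition. -/
structure HSInstance (n d : ℕ) where
  U : Fin n → Fin d → Bool
  V : Fin n → Fin d → Bool
  U_injective : Function.Injective U
  V_injective : Function.Injective V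

/-- Some vector of `U` is non-orthogonal to every vector of `V`. -/
def HSInstance.HasHittingSet {n d : ℕ} (I : HSInstance n d) : Prop :=
  ∃ i, ∀ j, ∃ c, I.U i c = true ∧ I.V j c = true

/-- The input words: `n`, `d`, and the coordinates of the vectors of `U` and of `V`. -/
def HSInstance.encode {n d : ℕ} (I : HSInstance n d) : List ℕ :=
  n :: d ::
    ((List.ofFn fun i => List.ofFn fun c => (I.U i c).toNat).flatten ++
     (List.ofFn fun j => List.ofFn fun c => (I.V j c).toNat).flatten)

/-- Hitting Set in dimension `d = d(n)` is decided, with probability of success at least `2/3`, in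
time `O(n ^ a)` by a randomized word-RAM program with words of `O(log N)` bits, where `N` is the
size of the input. (The program has to work for every word length from a constant multiple of
`log N` on.) -/
def HSSolvableInTime (d : ℕ → ℕ) (a : ℝ) : Prop :=
  ∃ (P : WordRAM.Prog) (c C : ℕ), ∀ n : ℕ, 1 ≤ n → ∀ (I : HSInstance n (d n)) (w : ℕ),
    c * WordRAM.inputBits I.encode ≤ w →
    WordRAM.Computes P w I.encode (C * (n : ℝ) ^ a) (2 / 3)
      (fun out => out ≠ 0 ↔ I.HasHittingSet)

/-- The Hitting Set Hypothesis: for some dimension `d = d(n)` with `d = ω(log n)` and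
`d = n ^ o(1)`, the problem requires time `n ^ (2 - o(1))`. -/
def HittingSetHypothesis : Prop :=
  ∃ d : ℕ → ℕ,
    (fun n : ℕ => Real.log n) =o[Filter.atTop] (fun n : ℕ => (d n : ℝ)) ∧
    (∀ η : ℝ, 0 < η →
      (fun n : ℕ => (d n : ℝ)) =O[Filter.atTop] (fun n : ℕ => (n : ℝ) ^ η)) ∧
    ∀ δ : ℝ, 0 < δ → ¬ HSSolvableInTime d (2 - δ)

/-! ## Bichromatic Radius -/

/-- The distance from `u` to `v` in the graph `G` with edge weights `wt`: the least total weight of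
a walk from `u` to `v` (there is one when `G` is connected). -/
noncomputable def weightedDist {V : Type*} (G : SimpleGraph V) (wt : Sym2 V → ℕ) (u v : V) : ℕ :=
  ⨅ p : G.Walk u v, (p.edges.map wt).sum

/-- An input of Bichromatic Radius: a connected undirected graph on `n` vertices with nonnegative
integer edge weights, a set `S` of vertices such that both `S` and its complement `T` are nonempty,
and a list of the edges, each of them listed exactly once, in any order and orientation. -/
structure BichromaticInstance where
  n : ℕ
  G : SimpleGraph (Fin n)
  wt : Sym2 (Fin n) → ℕ
  S : Finset (Fin n)
  edges : List (Fin n × Fin n)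
  connected : G.Connected
  S_nonempty : S.Nonempty
  T_nonempty : Sᶜ.Nonempty
  edges_nodup : (edges.map fun e => s(e.1, e.2)).Nodup
  mem_edges : ∀ e : Sym2 (Fin n), e ∈ edges.map (fun e => s(e.1, e.2)) ↔ e ∈ G.edgeSet

namespace BichromaticInstance

/-- The number of edges. -/
def m (I : BichromaticInstance) : ℕ := I.edges.length

/-- All edges have weight `1`. -/
def Unweighted (I : BichromaticInstance) : Prop := ∀ e ∈ I.G.edgeSet, I.wt e = 1

/-- The `ST`-eccentricity of `s`, where `T` is the complement of `S`. -/
noncomputable def ecc (I : BichromaticInstance) (s : Fin I.n) : ℕ :=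
  I.Sᶜ.sup' I.T_nonempty fun t => weightedDist I.G I.wt s t

/-- The `ST`-radius, where `T` is the complement of `S`. -/
noncomputable def radius (I : BichromaticInstance) : ℕ :=
  I.S.inf' I.S_nonempty I.ecc

/-- The input words: `n`, `m`, the indicator vector of `S`, and for every edge its two endpoints
and its weight. -/
def encode (I : BichromaticInstance) : List ℕ :=
  I.n :: I.m ::
    ((List.ofFn fun v : Fin I.n => if v ∈ I.S then 1 else 0) ++
     I.edges.flatMap fun e => [(e.1 : ℕ), (e.2 : ℕ), I.wt s(e.1, e.2)])

/-- `r` lies between the radius and `α` times the radius. -/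
def IsApprox (I : BichromaticInstance) (α : ℝ) (r : ℕ) : Prop :=
  I.radius ≤ r ∧ (r : ℝ) ≤ α * I.radius

end BichromaticInstance

/-! Upper bound. Let R be the radius, attained at c₀ ∈ S, and let every edge give two arcs. Draw K ≈
√m · log n random arcs (times a constant), and let Y consist of a closest T-vertex to each of their
tails. Let t ∈ T be farthest from Y, at distance r.

If r ≤ 2R/3, take c ∈ S whose greatest distance to Y is least. All of Y is within R of c, because it
is within R of c₀, and every T-vertex is within r of Y. So the eccentricity of c is at most R + r ≤
5R/3.

If r > 2R/3, give a vertex v the cost d(t,v), doubled when v ∈ S. A sampled tail z of cost less than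
r would put a member of Y at distance less than r from t: the T-vertex chosen for z is at distance 0
from z if z ∈ T, and no farther from z than t is if z ∈ S. So no sample has cost less than r, and
with high probability this means that at most K arcs have tails of cost less than r. There is time
to try, for each of them, the S-vertex closest to its head. Some arc of this kind on a shortest path
from t to c₀ has a head that lies in S within 2R/3 of c₀, or that is within R/3 of c₀
(`Net.Walk.exists_arc`). In both cases the S-vertex closest to that head is within 2R/3 of c₀, so
its eccentricity is at most 5R/3.

`Net.Outcome.approx` is this argument and `Net.hit_probability` is the estimate for the samples.
Everything costs O(K) runs of Dijkstra's algorithm, hence m^(3/2) up to logarithms.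
`Net.exec_radius` shows that the program behaves in this way on the machine, and `computes_radius`
puts the three together.

Lower bound. From an instance of Hitting Set one builds an unweighted graph with O(nd) edges and S =
U. If some u ∈ U hits every v, the radius is at most 3; otherwise each u has an orthogonal v, a
pendant copy of which is at distance at least 5 (`radius_hsGraph_le`, `le_radius_hsGraph`). A factor
below 5/3 tells 3 from 5. Since d = n^o(1), time m^(2-δ) becomes n^(2-δ/2). The reduction program
ends exactly in the initial machine state for the graph (`exec_reduce`), so the guarantee for the
assumed algorithm applies to the rest of the run as it stands.

Programs are written in a small language over natural numbers and compiled; `wp` is a logic for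
total correctness with time bounds, in which absence of overflow is a proof obligation. -/

namespace WordRAM

/-! ## Expressions and statements over natural numbers, and their compilation -/

/-- Expressions over variables and arrays; `rd k i` reads the cell `i` of the array `k`. -/
inductive Expr
  | num (k : ℕ)
  | var (x : ℕ)
  | bin (o : Op) (a b : Expr)
  | rd (k : ℕ) (i : Expr)

/-- The idealized contents of a machine: variables and arrays of natural numbers. -/
structure Store where
  var : ℕ → ℕ
  arr : ℕ → ℕ → ℕ
  used : ℕ

/-- Write a variable. -/
def Store.setVar (s : Store) (x v : ℕ) : Store := { s with var := Function.update s.var x v }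

/-- Write an array cell. -/
def Store.setArr (s : Store) (k i v : ℕ) : Store :=
  { s with arr := Function.update s.arr k (Function.update (s.arr k) i v) }

@[simp] theorem Store.setVar_var (s : Store) (x v y : ℕ) :
    (s.setVar x v).var y = if y = x then v else s.var y := by
  simp [setVar, Function.update_apply]

@[simp] theorem Store.setVar_arr (s : Store) (x v : ℕ) : (s.setVar x v).arr = s.arr := rfl
@[simp] theorem Store.setVar_used (s : Store) (x v : ℕ) : (s.setVar x v).used = s.used := rfl
@[simp] theorem Store.setArr_var (s : Store) (k i v : ℕ) : (s.setArr k i v).var = s.var := rfl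
@[simp] theorem Store.setArr_used (s : Store) (k i v : ℕ) : (s.setArr k i v).used = s.used := rfl

@[simp] theorem Store.setArr_arr (s : Store) (k i v k' : ℕ) :
    (s.setArr k i v).arr k' = if k' = k then Function.update (s.arr k) i v else s.arr k' := by
  unfold setArr
  by_cases h : k' = k
  · subst h; simp
  · simp [h]

/-- The operations on natural numbers. -/
def Op.nat : Op → ℕ → ℕ → ℕ
  | .add, a, b => a + b
  | .sub, a, b => a - b
  | .mul, a, b => a * b
  | .div, a, b => a / b
  | .mod, a, b => a % b
  | .lt, a, b => if a < b then 1 else 0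
  | .eq, a, b => if a = b then 1 else 0
  -- Junk value for the bitwise operations and shifts; `Op.Safe` is `False` for them, so it is never
  -- relied on.
  | _, _, _ => 0

/-- A sufficient condition for an operation on words to agree with the one on numbers. -/
def Op.Safe (W : ℕ) : Op → ℕ → ℕ → Prop
  | .add, a, b => a + b < W
  | .sub, a, b => b ≤ a
  | .mul, a, b => a * b < W
  | .div, _, _ => True
  | .mod, _, _ => True
  | .lt, _, _ => True
  | .eq, _, _ => True
  | _, _, _ => False

/-- Positive word length matters for the comparisons only: in words of no bits, `1` equals `0`. -/
theorem Op.eval_toNat {w : ℕ} (hw : 1 ≤ w) (o : Op) (a b : BitVec w)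
    (h : o.Safe (2 ^ w) a.toNat b.toNat) : (o.eval a b).toNat = o.nat a.toNat b.toNat := by
  have h1 : (1 : ℕ) < 2 ^ w := Nat.one_lt_two_pow (by omega)
  cases o <;> simp only [Op.Safe, Op.eval, Op.nat] at h ⊢
  · rw [BitVec.toNat_add, Nat.mod_eq_of_lt h]
  · rw [BitVec.toNat_sub_of_le (BitVec.le_def.2 h)]
  · rw [BitVec.toNat_mul, Nat.mod_eq_of_lt h]
  · rw [BitVec.toNat_udiv]
  · rw [BitVec.toNat_umod]
  · split_ifs <;> simp [Nat.mod_eq_of_lt h1]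
  · simp only [BitVec.toNat_inj]
    split_ifs <;> simp [Nat.mod_eq_of_lt h1]

/-- The number of variables; the register of this number holds the base address of the arrays,
and the registers above it hold intermediate results. -/
abbrev baseReg : ℕ := 39

/-- The layout of the memory: the array `0` begins at the address `0` and has `base` cells; the
arrays `1, …, 15` have `cap` cells each and are interleaved above `base`. -/
structure Layout (w : ℕ) where
  base : ℕ
  cap : ℕ
  one_le : 1 ≤ w
  base_le : base ≤ 2 ^ w
  -- The alternative `cap = 0` serves `flatLayout`, where the array `0` fills the whole memory.
  cap_lt : cap = 0 ∨ base + 16 * cap < 2 ^ w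

namespace Layout
variable {w : ℕ} (Γ : Layout w)

/-- The address of an array cell. -/
def addr (k i : ℕ) : ℕ := if k = 0 then i else Γ.base + 16 * i + k

/-- The array cells that exist. -/
def Valid (k i : ℕ) : Prop := if k = 0 then i < Γ.base else k < 16 ∧ i < Γ.cap

theorem addr_lt {k i : ℕ} (h : Γ.Valid k i) : Γ.addr k i < 2 ^ w := by
  have h1 := Γ.base_le
  have h2 := Γ.cap_lt
  unfold Valid at h
  unfold addr
  split_ifs at * <;> omega

theorem addr_inj {k i k' i' : ℕ} (h : Γ.Valid k i) (h' : Γ.Valid k' i')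
    (e : Γ.addr k i = Γ.addr k' i') : k = k' ∧ i = i' := by
  unfold Valid at h h'
  unfold addr at e
  split_ifs at * <;> omega

/-- The store `s` describes the machine state `σ`. -/
structure Rel (s : Store) (σ : State w) : Prop where
  var : ∀ x < baseReg, (σ.reg x).toNat = s.var x
  base : σ.reg baseReg = BitVec.ofNat w Γ.base
  mem : ∀ k i, Γ.Valid k i → (σ.mem (BitVec.ofNat w (Γ.addr k i))).toNat = s.arr k i
  used : σ.used = s.used

end Layout

namespace Expr
variable {w : ℕ} (Γ : Layout w) (s : Store)

/-- The value of an expression. -/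
def eval : Expr → ℕ
  | num k => k
  | var x => s.var x
  | bin o a b => o.nat a.eval b.eval
  | rd k i => s.arr k i.eval

/-- The evaluation of the expression neither overflows nor leaves the arrays. -/
def Safe : Expr → Prop
  | num k => k < 2 ^ w
  | var x => x < baseReg
  | bin o a b => a.Safe ∧ b.Safe ∧ o.Safe (2 ^ w) (a.eval s) (b.eval s)
  | rd k i => i.Safe ∧ Γ.Valid k (i.eval s)

/-- The number of steps that the evaluation takes. -/
def cost : Expr → ℕ
  | num _ => 1
  | var _ => 1
  | bin _ a b => a.cost + b.cost + 1
  | rd _ i => i.cost + 6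

end Expr

/-- Turn the index in register `d` into an address of the array `k`. -/
def addrProg (k d : ℕ) : Prog :=
  if k = 0 then .const (d + 1) 0 else
    .seq (.const (d + 1) 16) (.seq (.op .mul d d (d + 1)) (.seq (.op .add d d baseReg)
      (.seq (.const (d + 1) k) (.op .add d d (d + 1)))))

/-- Compute the expression into register `d`. -/
def Expr.comp : Expr → ℕ → Prog
  | num k, d => .const d k
  -- The machine has no move instruction; the bitwise `or` of a word with itself is a copy that
  -- cannot overflow.
  | var x, d => .op .or d x x
  | bin o a b, d => .seq (a.comp d) (.seq (b.comp (d + 1)) (.op o d d (d + 1)))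
  | rd k i, d => .seq (i.comp d) (.seq (addrProg k d) (.load d d))

@[simp] theorem State.setReg_reg {w : ℕ} (s : State w) (r : ℕ) (x : BitVec w) (y : ℕ) :
    (s.setReg r x).reg y = if y = r then x else s.reg y := by
  simp [setReg, Function.update_apply]

@[simp] theorem State.setReg_mem {w : ℕ} (s : State w) (r : ℕ) (x : BitVec w) :
    (s.setReg r x).mem = s.mem := rfl

@[simp] theorem State.setReg_used {w : ℕ} (s : State w) (r : ℕ) (x : BitVec w) :
    (s.setReg r x).used = s.used := rfl

theorem exec_addrProg {w : ℕ} (Γ : Layout w) (ω : Tape w) (k d : ℕ) (hd : 40 ≤ d) (s : Store)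
    (σ : State w) (h : Γ.Rel s σ) :
    ∃ t σ', Exec ω (addrProg k d) σ t σ' ∧ t ≤ 5 ∧ σ'.mem = σ.mem ∧ σ'.used = σ.used ∧
      (∀ x < d, σ'.reg x = σ.reg x) ∧
      σ'.reg d = BitVec.ofNat w (Γ.addr k (σ.reg d).toNat) := by
  unfold addrProg
  by_cases hk : k = 0
  · simp only [hk, if_true]
    refine ⟨1, _, Exec.const _ _ _, by omega, rfl, rfl, ?_, ?_⟩
    · intro x hx
      rw [State.setReg_reg, if_neg (by omega)]
    · rw [State.setReg_reg, if_neg (by omega)]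
      simp [Layout.addr]
  · simp only [hk, if_false]
    refine ⟨1 + (1 + (1 + (1 + 1))), _, Exec.seq _ _ _ _ _ _ _ (Exec.const _ _ _)
      (Exec.seq _ _ _ _ _ _ _ (Exec.op _ _ _ _ _) (Exec.seq _ _ _ _ _ _ _ (Exec.op _ _ _ _ _)
      (Exec.seq _ _ _ _ _ _ _ (Exec.const _ _ _) (Exec.op _ _ _ _ _)))), by omega,
      rfl, rfl, ?_, ?_⟩
    · intro x hx
      simp [show x ≠ d by omega, show x ≠ d + 1 by omega]
    · have hb : σ.reg 39 = BitVec.ofNat w Γ.base := h.base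
      have e1 : (39 : ℕ) ≠ d := by omega
      have e2 : (39 : ℕ) ≠ d + 1 := by omega
      have e3 : σ.reg d = BitVec.ofNat w (σ.reg d).toNat := by simp
      simp only [State.setReg_reg, if_true, if_neg e1, if_neg e2, if_neg (Nat.succ_ne_self d),
        if_neg (Nat.succ_ne_self d).symm, Op.eval, hb, Layout.addr, if_neg hk]
      -- Overflow is harmless here: `BitVec.ofNat` respects sums and products modulo `2 ^ w`,
      -- whether or not the cell exists.
      rw [e3, ← BitVec.ofNat_mul, ← BitVec.ofNat_add, ← BitVec.ofNat_add]
      congr 1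
      simp only [BitVec.ofNat_toNat, BitVec.setWidth_eq]
      ring

namespace Expr
variable {w : ℕ} (Γ : Layout w) (ω : Tape w)

/-- The registers from `d` on act as an evaluation stack: the second operand is computed in `d + 1`,
so everything below `d` survives. With `40 ≤ d` the variables and the base register are out of
reach. -/
theorem exec_comp (e : Expr) : ∀ (d : ℕ) (_ : 40 ≤ d) (s : Store) (σ : State w),
    Γ.Rel s σ → e.Safe Γ s →
    ∃ t σ', Exec ω (e.comp d) σ t σ' ∧ t ≤ e.cost ∧ σ'.mem = σ.mem ∧ σ'.used = σ.used ∧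
      (∀ x < d, σ'.reg x = σ.reg x) ∧ (σ'.reg d).toNat = e.eval s ∧ Γ.Rel s σ' := by
  have key : ∀ (d : ℕ) (_ : 40 ≤ d) (s : Store) (σ σ' : State w), Γ.Rel s σ →
      σ'.mem = σ.mem → σ'.used = σ.used → (∀ x < d, σ'.reg x = σ.reg x) → Γ.Rel s σ' := by
    intro d hd s σ σ' h h1 h2 h3
    refine ⟨fun x hx => ?_, ?_, ?_, ?_⟩
    · rw [h3 x (lt_of_lt_of_le hx (by show 39 ≤ d; omega))]; exact h.var x hx
    · rw [h3 _ (show 39 < d by omega)]; exact h.base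
    · intro k i hv; rw [h1]; exact h.mem k i hv
    · rw [h2]; exact h.used
  induction e with
  | num k =>
    intro d hd s σ h hs
    refine ⟨1, _, Exec.const _ _ _, le_refl _, rfl, rfl, ?_, ?_, ?_⟩
    · intro x hx; simp [show x ≠ d by omega]
    · simpa [eval] using Nat.mod_eq_of_lt hs
    · refine key d hd s σ _ h rfl rfl ?_
      intro x hx; simp [show x ≠ d by omega]
  | var y =>
    intro d hd s σ h hs
    refine ⟨1, _, Exec.op _ _ _ _ _, le_refl _, rfl, rfl, ?_, ?_, ?_⟩
    · intro x hx; simp [show x ≠ d by omega]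
    · simpa [eval, Op.eval] using h.var y hs
    · refine key d hd s σ _ h rfl rfl ?_
      intro x hx; simp [show x ≠ d by omega]
  | bin o a b iha ihb =>
    intro d hd s σ h hs
    obtain ⟨ha, hb, ho⟩ := hs
    obtain ⟨t1, σ1, x1, c1, m1, u1, r1, v1, R1⟩ := iha d hd s σ h ha
    obtain ⟨t2, σ2, x2, c2, m2, u2, r2, v2, R2⟩ := ihb (d + 1) (by omega) s σ1 R1 hb
    have hr : ∀ x < d, σ2.reg x = σ.reg x := fun x hx => by rw [r2 x (by omega), r1 x hx]
    refine ⟨t1 + (t2 + 1), _, Exec.seq _ _ _ _ _ _ _ x1 (Exec.seq _ _ _ _ _ _ _ x2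
      (Exec.op _ _ _ _ _)), ?_, m2.trans m1, u2.trans u1, ?_, ?_, ?_⟩
    · simp only [cost]; omega
    · intro x hx; simp only [State.setReg_reg, if_neg (show x ≠ d by omega)]; exact hr x hx
    · simp only [State.setReg_reg, if_true, eval]
      have e : (σ2.reg d).toNat = a.eval s := by rw [r2 d (by omega), v1]
      rw [Op.eval_toNat Γ.one_le, e, v2]
      rw [e, v2]; exact ho
    · refine key d hd s σ _ h (m2.trans m1) (u2.trans u1) ?_
      intro x hx; simp only [State.setReg_reg, if_neg (show x ≠ d by omega)]; exact hr x hx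
  | rd k i ih =>
    intro d hd s σ h hs
    obtain ⟨hi, hv⟩ := hs
    obtain ⟨t1, σ1, x1, c1, m1, u1, r1, v1, R1⟩ := ih d hd s σ h hi
    obtain ⟨t2, σ2, x2, c2, m2, u2, r2, v2⟩ := exec_addrProg Γ ω k d hd s σ1 R1
    have hr : ∀ x < d, σ2.reg x = σ.reg x := fun x hx => by rw [r2 x (by omega), r1 x hx]
    refine ⟨t1 + (t2 + 1), _, Exec.seq _ _ _ _ _ _ _ x1 (Exec.seq _ _ _ _ _ _ _ x2
      (Exec.load _ _ _)), ?_, m2.trans m1, u2.trans u1, ?_, ?_, ?_⟩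
    · simp only [cost]; omega
    · intro x hx; simp only [State.setReg_reg, if_neg (show x ≠ d by omega)]; exact hr x hx
    · simp only [State.setReg_reg, if_true, eval]
      rw [v2, m2, v1]
      exact R1.mem _ _ hv
    · refine key d hd s σ _ h (m2.trans m1) (u2.trans u1) ?_
      intro x hx; simp only [State.setReg_reg, if_neg (show x ≠ d by omega)]; exact hr x hx

end Expr

/-- Loop-free statements. -/
inductive Stm
  | skip
  | set (x : ℕ) (e : Expr)
  | wr (k : ℕ) (i e : Expr)
  | seq (p q : Stm)
  | ite (e : Expr) (p q : Stm)

namespace Stm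

/-- The effect of a statement. -/
def run : Stm → Store → Store
  | skip, s => s
  | set x e, s => s.setVar x (e.eval s)
  | wr k i e, s => s.setArr k (i.eval s) (e.eval s)
  | seq p q, s => q.run (p.run s)
  | ite e p q, s => if e.eval s ≠ 0 then p.run s else q.run s

/-- No step of the statement overflows or leaves the arrays. -/
def Safe {w : ℕ} (Γ : Layout w) : Stm → Store → Prop
  | skip, _ => True
  | set x e, s => x < 39 ∧ e.Safe Γ s
  | wr k i e, s => i.Safe Γ s ∧ e.Safe Γ s ∧ Γ.Valid k (i.eval s)
  | seq p q, s => p.Safe Γ s ∧ q.Safe Γ (p.run s)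
  | ite e p q, s => e.Safe Γ s ∧ (e.eval s ≠ 0 → p.Safe Γ s) ∧ (e.eval s = 0 → q.Safe Γ s)

/-- A bound on the number of steps. -/
def cost : Stm → ℕ
  | skip => 1
  | set _ e => e.cost + 1
  | wr _ i e => i.cost + e.cost + 6
  | seq p q => p.cost + q.cost
  | ite e p q => e.cost + p.cost + q.cost + 1

/-- The compiled statement. -/
def comp : Stm → Prog
  | skip => .const 40 0
  | set x e => .seq (e.comp 40) (.op .or x 40 40)
  | wr k i e => .seq (e.comp 40) (.seq (i.comp 41) (.seq (addrProg k 41) (.store 41 40)))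
  | seq p q => .seq p.comp q.comp
  | ite e p q => .seq (e.comp 40) (.branch 40 p.comp q.comp)

theorem exec_comp {w : ℕ} (Γ : Layout w) (ω : Tape w) (p : Stm) : ∀ (s : Store) (σ : State w),
    Γ.Rel s σ → p.Safe Γ s →
    ∃ t σ', Exec ω p.comp σ t σ' ∧ t ≤ p.cost ∧ Γ.Rel (p.run s) σ' := by
  induction p with
  | skip =>
    intro s σ h _
    refine ⟨1, _, Exec.const _ _ _, le_refl _, ?_, ?_, h.mem, h.used⟩
    · intro x hx
      simpa [run, show x ≠ 40 from fun e => by subst e; exact absurd hx (by decide)] using h.var x hx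
    · simpa using h.base
  | set x e =>
    intro s σ h hs
    obtain ⟨hx, he⟩ := hs
    obtain ⟨t, σ1, x1, c1, m1, u1, r1, v1, R1⟩ := e.exec_comp Γ ω 40 (le_refl _) s σ h he
    refine ⟨t + 1, _, Exec.seq _ _ _ _ _ _ _ x1 (Exec.op _ _ _ _ _), ?_, ?_, ?_, R1.mem, R1.used⟩
    · simp only [cost]; omega
    · intro y hy
      by_cases e : y = x
      · subst e; simpa [run, Op.eval] using v1
      · simpa [run, e] using R1.var y hy
    · simpa [(show (39 : ℕ) ≠ x from fun e => by subst e; exact absurd hx (by decide))]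
        using R1.base
  | wr k i e =>
    intro s σ h hs
    obtain ⟨hi, he, hv⟩ := hs
    obtain ⟨t, σ1, x1, c1, m1, u1, r1, v1, R1⟩ := e.exec_comp Γ ω 40 (le_refl _) s σ h he
    obtain ⟨t2, σ2, x2, c2, m2, u2, r2, v2, R2⟩ := i.exec_comp Γ ω 41 (by omega) s σ1 R1 hi
    obtain ⟨t3, σ3, x3, c3, m3, u3, r3, v3⟩ :=
      exec_addrProg Γ ω k 41 (by omega) s σ2 R2
    refine ⟨t + (t2 + (t3 + 1)), _, Exec.seq _ _ _ _ _ _ _ x1 (Exec.seq _ _ _ _ _ _ _ x2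
      (Exec.seq _ _ _ _ _ _ _ x3 (Exec.store _ _ _))), ?_, ?_, ?_, ?_, ?_⟩
    · simp only [cost]; omega
    · intro y hy
      have hy' : y < 39 := hy
      show (σ3.reg y).toNat = s.var y
      rw [r3 y (by omega)]; exact R2.var y hy
    · show σ3.reg 39 = _
      rw [r3 39 (by omega)]; exact R2.base
    · intro k' i' hv'
      show (Function.update σ3.mem (σ3.reg 41) (σ3.reg 40) _).toNat = _
      rw [v3, v2, Function.update_apply]
      by_cases e1 : k' = k ∧ i' = i.eval s
      · obtain ⟨rfl, rfl⟩ := e1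
        rw [if_pos rfl, r3 40 (by omega), r2 40 (by omega), v1]
        simp [run]
      · rw [if_neg, m3]
        · rw [R2.mem _ _ hv']
          simp only [run, Store.setArr_arr]
          split_ifs with e2
          · subst e2
            rw [Function.update_of_ne]
            exact fun e3 => e1 ⟨rfl, e3⟩
          · rfl
        · intro e2
          have := congrArg BitVec.toNat e2
          simp only [BitVec.toNat_ofNat] at this
          rw [Nat.mod_eq_of_lt (Γ.addr_lt hv), Nat.mod_eq_of_lt (Γ.addr_lt hv')] at this
          exact e1 (Γ.addr_inj hv' hv this)
    · show σ3.used = _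
      rw [u3]; exact R2.used
  | seq p q ihp ihq =>
    intro s σ h hs
    obtain ⟨t1, σ1, x1, c1, R1⟩ := ihp s σ h hs.1
    obtain ⟨t2, σ2, x2, c2, R2⟩ := ihq _ σ1 R1 hs.2
    exact ⟨_, _, Exec.seq _ _ _ _ _ _ _ x1 x2, by simp only [cost]; omega, R2⟩
  | ite e p q ihp ihq =>
    intro s σ h hs
    obtain ⟨he, hp, hq⟩ := hs
    obtain ⟨t, σ1, x1, c1, m1, u1, r1, v1, R1⟩ := e.exec_comp Γ ω 40 (le_refl _) s σ h he
    by_cases h0 : e.eval s = 0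
    · obtain ⟨t2, σ2, x2, c2, R2⟩ := ihq s σ1 R1 (hq h0)
      refine ⟨_, _, Exec.seq _ _ _ _ _ _ _ x1 (Exec.branch_false _ _ _ _ _ _ ?_ x2), ?_, ?_⟩
      · apply BitVec.eq_of_toNat_eq; simpa using v1.trans h0
      · simp only [cost]; omega
      · simpa [run, h0] using R2
    · obtain ⟨t2, σ2, x2, c2, R2⟩ := ihp s σ1 R1 (hp h0)
      refine ⟨_, _, Exec.seq _ _ _ _ _ _ _ x1 (Exec.branch_true _ _ _ _ _ _ ?_ x2), ?_, ?_⟩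
      · intro e0; rw [e0] at v1; exact h0 (by simpa using v1.symm)
      · simp only [cost]; omega
      · simpa [run, h0] using R2

end Stm

/-! ## A program logic with time bounds -/

/-- Started in a machine state described by `s`, the program `P` halts within `T` steps in a state
described by a store that satisfies `Q`. -/
def wp {w : ℕ} (Γ : Layout w) (ω : Tape w) (P : Prog) (T : ℕ) (Q : Store → Prop) (s : Store) :
    Prop :=
  ∀ σ : State w, Γ.Rel s σ → ∃ t σ' s', Exec ω P σ t σ' ∧ Γ.Rel s' σ' ∧ t ≤ T ∧ Q s'

/-- Run `p` as long as `e` is nonzero. -/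
def whileLoop (e : Expr) (p : Prog) : Prog :=
  .seq (e.comp 40) (.loop 40 (.seq p (e.comp 40)))

/-- Run `p` if `e` is nonzero, and do nothing otherwise. -/
def whenProg (e : Expr) (p : Prog) : Prog :=
  .seq (e.comp 40) (.branch 40 p (.const 40 0))

/-- Run `p` with the variable `x` ranging over the numbers below the value of the variable `y`. -/
def forLoop (x y : ℕ) (p : Prog) : Prog :=
  .seq (Stm.comp (.set x (.num 0))) (whileLoop (.bin .lt (.var x) (.var y))
    (.seq p (Stm.comp (.set x (.bin .add (.var x) (.num 1))))))

section
variable {w : ℕ} {Γ : Layout w} {ω : Tape w} {Q : Store → Prop} {s : Store}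

theorem wp_mono {P : Prog} {T T' : ℕ} {Q' : Store → Prop} (h : wp Γ ω P T Q s) (hT : T ≤ T')
    (hQ : ∀ s', Q s' → Q' s') : wp Γ ω P T' Q' s := by
  intro σ hσ
  obtain ⟨t, σ', s', x, R, ht, q⟩ := h σ hσ
  exact ⟨t, σ', s', x, R, ht.trans hT, hQ _ q⟩

theorem wp_stm (p : Stm) {T : ℕ} (hs : p.Safe Γ s) (hT : p.cost ≤ T) (hQ : Q (p.run s)) :
    wp Γ ω p.comp T Q s := by
  intro σ hσ
  obtain ⟨t, σ', x, c, R⟩ := p.exec_comp Γ ω s σ hσ hs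
  exact ⟨t, σ', _, x, R, c.trans hT, hQ⟩

theorem wp_seq {p q : Prog} {T T1 T2 : ℕ} (hT : T1 + T2 ≤ T)
    (h : wp Γ ω p T1 (fun s' => wp Γ ω q T2 Q s') s) : wp Γ ω (.seq p q) T Q s := by
  intro σ hσ
  obtain ⟨t, σ', s', x, R, ht, hq⟩ := h σ hσ
  obtain ⟨t2, σ2, s2, x2, R2, ht2, hq2⟩ := hq σ' R
  exact ⟨_, _, s2, Exec.seq _ _ _ _ _ _ _ x x2, R2, by omega, hq2⟩

theorem wp_rand {x : ℕ} {T : ℕ} (hx : x < baseReg) (hT : 1 ≤ T)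
    (hQ : Q { s.setVar x (ω s.used : ℕ) with used := s.used + 1 }) :
    wp Γ ω (.rand x) T Q s := by
  intro σ hσ
  refine ⟨1, _, { s.setVar x (ω s.used : ℕ) with used := s.used + 1 }, Exec.rand _ _,
    ⟨?_, ?_, hσ.mem, ?_⟩, hT, hQ⟩
  · intro y hy
    by_cases e : y = x
    · subst e; simp [hσ.used, Store.setVar]
    · simpa [e, Store.setVar] using hσ.var y hy
  · simpa [(show (39 : ℕ) ≠ x from fun e => by subst e; exact absurd hx (by decide))]
      using hσ.base
  · exact congrArg (· + 1) hσ.used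

/-- Of the two extra steps one is the test and the other the dummy instruction in the empty branch.
-/
theorem wp_when {e : Expr} {p : Prog} {T : ℕ} (he : e.Safe Γ s)
    (h1 : e.eval s ≠ 0 → wp Γ ω p T Q s) (h0 : e.eval s = 0 → Q s) :
    wp Γ ω (whenProg e p) (T + e.cost + 2) Q s := by
  intro σ hσ
  obtain ⟨t, σ1, x1, c1, m1, u1, r1, v1, R1⟩ := e.exec_comp Γ ω 40 (le_refl _) s σ hσ he
  by_cases hz : e.eval s = 0
  · refine ⟨_, _, s, Exec.seq _ _ _ _ _ _ _ x1 (Exec.branch_false _ _ _ _ _ _ ?_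
      (Exec.const _ _ _)), ⟨?_, ?_, R1.mem, R1.used⟩, by omega, h0 hz⟩
    · apply BitVec.eq_of_toNat_eq; simpa using v1.trans hz
    · intro x hx
      simpa [show x ≠ 40 from fun e => by subst e; exact absurd hx (by decide)] using R1.var x hx
    · simpa using R1.base
  · obtain ⟨t2, σ2, s2, x2, R2, c2, q2⟩ := h1 hz σ1 R1
    refine ⟨_, _, s2, Exec.seq _ _ _ _ _ _ _ x1 (Exec.branch_true _ _ _ _ _ _ ?_ x2), R2,
      by omega, q2⟩
    intro e0; rw [e0] at v1; exact hz (by simpa using v1.symm)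

/-- `Φ` is a clock: every iteration lowers it by its own time plus the next evaluation and test of
the guard. So it bounds the total time, and termination follows by induction on a bound for it. -/
theorem wp_while {e : Expr} {p : Prog} (Inv : Store → Prop) (Φ : Store → ℕ)
    (hs : ∀ s, Inv s → e.Safe Γ s)
    (hstep : ∀ s, Inv s → e.eval s ≠ 0 →
      ∃ T, wp Γ ω p T (fun s' => Inv s' ∧ T + (e.cost + 1) + Φ s' ≤ Φ s) s)
    {T : ℕ} (hT : Φ s + e.cost + 1 ≤ T) (h0 : Inv s) (hQ : ∀ s', Inv s' → e.eval s' = 0 → Q s') :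
    wp Γ ω (whileLoop e p) T Q s := by
  have key : ∀ (N : ℕ) (s : Store) (σ : State w), Φ s ≤ N → Inv s → Γ.Rel s σ →
      (σ.reg 40).toNat = e.eval s → ∃ t σ' s', Exec ω (.loop 40 (.seq p (e.comp 40))) σ t σ' ∧
        Γ.Rel s' σ' ∧ t ≤ Φ s + 1 ∧ Q s' := by
    intro N
    induction N with
    | zero =>
      intro s σ hN hI hR hv
      by_cases hz : e.eval s = 0
      · refine ⟨1, σ, s, Exec.loop_false _ _ _ ?_, hR, by omega, hQ s hI hz⟩
        apply BitVec.eq_of_toNat_eq; simpa using hv.trans hz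
      · obtain ⟨T, hT⟩ := hstep s hI hz
        obtain ⟨t1, σ1, s1, x1, R1, c1, I1, f1⟩ := hT σ hR
        omega
    | succ N ih =>
      intro s σ hN hI hR hv
      by_cases hz : e.eval s = 0
      · refine ⟨1, σ, s, Exec.loop_false _ _ _ ?_, hR, by omega, hQ s hI hz⟩
        apply BitVec.eq_of_toNat_eq; simpa using hv.trans hz
      · obtain ⟨T, hT⟩ := hstep s hI hz
        obtain ⟨t1, σ1, s1, x1, R1, c1, I1, f1⟩ := hT σ hR
        obtain ⟨t2, σ2, x2, c2, m2, u2, r2, v2, R2⟩ :=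
          e.exec_comp Γ ω 40 (le_refl _) s1 σ1 R1 (hs s1 I1)
        obtain ⟨t3, σ3, s3, x3, R3, c3, q3⟩ := ih s1 σ2 (by omega) I1 R2 v2
        refine ⟨_, σ3, s3, Exec.loop_true _ _ _ _ _ _ _ ?_ (Exec.seq _ _ _ _ _ _ _ x1 x2) x3,
          R3, by omega, q3⟩
        intro e0; rw [e0] at hv; exact hz (by simpa using hv.symm)
  intro σ hσ
  obtain ⟨t2, σ2, x2, c2, m2, u2, r2, v2, R2⟩ :=
    e.exec_comp Γ ω 40 (le_refl _) s σ hσ (hs s h0)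
  obtain ⟨t3, σ3, s3, x3, R3, c3, q3⟩ := key _ s σ2 (le_refl _) h0 R2 v2
  exact ⟨_, σ3, s3, Exec.seq _ _ _ _ _ _ _ x2 x3, R3, by omega, q3⟩

/-- The potential `Ψ` pays for iterations that exceed `T`; `wp_search` needs this, where most arcs
are merely tested and only a few are explored. The `8` is four steps for the increment, three for
the guard and one for the test; the `6` is the initialization and the first guard and test. -/
theorem wp_for_amortized {x y : ℕ} {p : Prog} (J : ℕ → Store → Prop) (Ψ : Store → ℕ) (N T : ℕ)
    (hx : x < baseReg) (hy : y < baseReg) (hxy : y ≠ x) (hN : N < 2 ^ w) (hy0 : s.var y = N)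
    (hΨ : ∀ s v, Ψ (s.setVar x v) = Ψ s) (h0 : J 0 (s.setVar x 0))
    (hstep : ∀ k < N, ∀ s, s.var x = k → s.var y = N → J k s →
      ∃ t, wp Γ ω p t (fun s' => s'.var x = k ∧ s'.var y = N ∧ J (k + 1) (s'.setVar x (k + 1)) ∧
        t + Ψ s' ≤ T + Ψ s) s)
    {T' : ℕ} (hT : N * (T + 8) + 6 + Ψ s ≤ T')
    (hQ : ∀ s', s'.var x = N → s'.var y = N → J N s' → Q s') :
    wp Γ ω (forLoop x y p) T' Q s := by
  have h2 : (1 : ℕ) < 2 ^ w := Nat.one_lt_two_pow (by have := Γ.one_le; omega)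
  refine wp_seq (T1 := 2) (T2 := N * (T + 8) + 4 + Ψ s) (by omega)
    (wp_stm _ ⟨hx, Nat.pos_of_ne_zero (by positivity)⟩ (le_refl _) ?_)
  refine wp_while (fun s => s.var x ≤ N ∧ s.var y = N ∧ J (s.var x) s)
    (fun s => (N - s.var x) * (T + 8) + Ψ s) ?_ ?_ ?_ ?_ ?_
  · exact fun s _ => ⟨hx, hy, trivial⟩
  · rintro s ⟨h1, h3, h4⟩ hlt
    have hlt' : s.var x < N := by
      by_contra hc
      apply hlt
      simp [Expr.eval, Op.nat, h3, hc]
    obtain ⟨t, ht⟩ := hstep _ hlt' s rfl h3 h4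
    refine ⟨t + 4, wp_seq (T1 := t) (T2 := 4) (le_refl _) (wp_mono ht (le_refl _) ?_)⟩
    rintro s' ⟨e1, e2, e3, e5⟩
    refine wp_stm _ (show x < baseReg ∧ (x < baseReg ∧ 1 < 2 ^ w ∧ s'.var x + 1 < 2 ^ w) from
      ⟨hx, hx, h2, by omega⟩) (le_refl _) ?_
    have e4 : (Stm.set x (Expr.bin .add (.var x) (.num 1))).run s' =
        s'.setVar x (s.var x + 1) := by
      simp [Stm.run, Expr.eval, Op.nat, e1]
    rw [e4]
    refine ⟨⟨?_, ?_, ?_⟩, ?_⟩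
    · simpa using hlt'
    · simpa [hxy] using e2
    · simpa using e3
    · obtain ⟨q, hq⟩ : ∃ q, N - s.var x = q + 1 := ⟨N - s.var x - 1, by omega⟩
      have : N - (s.var x + 1) = q := by omega
      simp only [Store.setVar_var, if_true, this, hq, Expr.cost, hΨ]
      rw [add_mul]
      omega
  · simp only [Stm.run, Expr.eval, Store.setVar_var, if_true, Expr.cost, Nat.sub_zero, hΨ]
    omega
  · simp only [Stm.run, Expr.eval, Store.setVar_var, if_true, if_neg hxy]
    exact ⟨Nat.zero_le _, hy0, h0⟩
  · rintro s' ⟨h1, h3, h4⟩ h5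
    have : s'.var x = N := by
      by_contra hc
      have : s'.var x < N := by omega
      simp [Expr.eval, Op.nat, h3, this] at h5
    exact hQ s' this h3 (by rwa [this] at h4)

theorem wp_for {x y : ℕ} {p : Prog} (J : ℕ → Store → Prop) (N T : ℕ) (hx : x < baseReg)
    (hy : y < baseReg) (hxy : y ≠ x) (hN : N < 2 ^ w) (hy0 : s.var y = N)
    (h0 : J 0 (s.setVar x 0))
    (hstep : ∀ k < N, ∀ s, s.var x = k → s.var y = N → J k s →
      wp Γ ω p T (fun s' => s'.var x = k ∧ s'.var y = N ∧ J (k + 1) (s'.setVar x (k + 1))) s)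
    {T' : ℕ} (hT : N * (T + 8) + 6 ≤ T')
    (hQ : ∀ s', s'.var x = N → s'.var y = N → J N s' → Q s') :
    wp Γ ω (forLoop x y p) T' Q s :=
  wp_for_amortized J (fun _ => 0) N T hx hy hxy hN hy0 (fun _ _ => rfl) h0
    (fun k hk s e1 e2 h => ⟨T, wp_mono (hstep k hk s e1 e2 h) (le_refl _)
      fun _ ⟨q1, q2, q3⟩ => ⟨q1, q2, q3, le_refl _⟩⟩) hT hQ

end

end WordRAM

namespace WordRAM

/-! ## Tournament trees -/

/-- Every inner node of the tree with `n` leaves holds the minimum of its children. -/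
def TreeOK (n : ℕ) (t : ℕ → ℕ) : Prop :=
  ∀ q, 1 ≤ q → q < n → t q = min (t (2 * q)) (t (2 * q + 1))

/-- Heap numbering: inner nodes are `1, …, n - 1` and leaves `n, …, 2 * n - 1`, for any `n`, not
only powers of two. Values do not increase on the way up through the parents `p / 2`. -/
theorem TreeOK.root_le {n : ℕ} {t : ℕ → ℕ} (h : TreeOK n t) {p : ℕ} (hp : 1 ≤ p)
    (hn : p < 2 * n) : t 1 ≤ t p := by
  induction p using Nat.strong_induction_on with
  | _ p ih =>
    by_cases h1 : p = 1
    · rw [h1]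
    · have h2 := ih (p / 2) (by omega) (by omega) (by omega)
      have h3 := h (p / 2) (by omega) (by omega)
      rcases Nat.even_or_odd' p with ⟨c, rfl | rfl⟩
      · rw [show 2 * c / 2 = c by omega] at *
        exact h2.trans (h3.le.trans (min_le_left _ _))
      · rw [show (2 * c + 1) / 2 = c by omega] at *
        exact h2.trans (h3.le.trans (min_le_right _ _))

/-- Descend to a child that attains the minimum until a leaf is reached. -/
theorem TreeOK.exists_leaf {n : ℕ} {t : ℕ → ℕ} (h : TreeOK n t) (p : ℕ) (hp : 1 ≤ p)
    (hn : p < 2 * n) : ∃ v < n, t p = t (n + v) := by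
  induction hk : 2 * n - p using Nat.strong_induction_on generalizing p with
  | _ k ih =>
    by_cases h1 : n ≤ p
    · exact ⟨p - n, by omega, by congr 1; omega⟩
    · have h3 := h p hp (by omega)
      rcases min_choice (t (2 * p)) (t (2 * p + 1)) with h4 | h4
      · obtain ⟨v, hv, e⟩ := ih _ (by omega) (2 * p) (by omega) (by omega) rfl
        exact ⟨v, hv, by rw [h3, h4, e]⟩
      · obtain ⟨v, hv, e⟩ := ih _ (by omega) (2 * p + 1) (by omega) (by omega) rfl
        exact ⟨v, hv, by rw [h3, h4, e]⟩

/-- The store `s'` agrees with `s` on the first `nv` variables and the first `na` arrays. -/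
structure Store.Same (nv na : ℕ) (s s' : Store) : Prop where
  var : ∀ x < nv, s'.var x = s.var x
  arr : ∀ k < na, s'.arr k = s.arr k
  used : s'.used = s.used

theorem Store.Same.refl (nv na : ℕ) (s : Store) : Store.Same nv na s s :=
  ⟨fun _ _ => rfl, fun _ _ => rfl, rfl⟩

theorem Store.Same.trans {nv na : ℕ} {s s' s'' : Store} (h : Store.Same nv na s s')
    (h' : Store.Same nv na s' s'') : Store.Same nv na s s'' :=
  ⟨fun x hx => (h'.var x hx).trans (h.var x hx), fun k hk => (h'.arr k hk).trans (h.arr k hk),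
    h'.used.trans h.used⟩

/-- Variables and arrays are numbered so that a subroutine writes only numbers above those that its
callers have to keep. A frame condition is therefore a pair of bounds, and the one of a subroutine
weakens to the one of its caller. -/
theorem Store.Same.mono {nv na nv' na' : ℕ} {s s' : Store} (h : Store.Same nv na s s')
    (h1 : nv' ≤ nv) (h2 : na' ≤ na) : Store.Same nv' na' s s' :=
  ⟨fun x hx => h.var x (by omega), fun k hk => h.arr k (by omega), h.used⟩

theorem Store.Same.setVar {nv na : ℕ} {s s' : Store} (h : Store.Same nv na s s') {x v : ℕ}
    (hx : nv ≤ x) : Store.Same nv na s (s'.setVar x v) :=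
  ⟨fun y hy => by simpa [show y ≠ x by omega] using h.var y hy, h.arr, h.used⟩

theorem Store.Same.setArr {nv na : ℕ} {s s' : Store} (h : Store.Same nv na s s') {k i v : ℕ}
    (hx : na ≤ k) : Store.Same nv na s (s'.setArr k i v) :=
  ⟨h.var, fun y hy => by simpa [show y ≠ k by omega] using h.arr y hy, h.used⟩

infixr:50 " ;; " => Stm.seq
infixr:50 " ;> " => Prog.seq

namespace Expr

instance : Add Expr := ⟨bin .add⟩
instance : Sub Expr := ⟨bin .sub⟩
instance : Mul Expr := ⟨bin .mul⟩
instance : Div Expr := ⟨bin .div⟩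
instance : Mod Expr := ⟨bin .mod⟩
instance (k : ℕ) : OfNat Expr k := ⟨num k⟩

/-- Comparison of two expressions. -/
def lt (a b : Expr) : Expr := bin .lt a b

/-- Equality of two expressions. -/
def eq (a b : Expr) : Expr := bin .eq a b

section
variable {w : ℕ} (Γ : Layout w) (s : Store) (a b : Expr)

@[simp] theorem eval_add : (a + b).eval s = a.eval s + b.eval s := rfl
@[simp] theorem eval_sub : (a - b).eval s = a.eval s - b.eval s := rfl
@[simp] theorem eval_mul : (a * b).eval s = a.eval s * b.eval s := rfl
@[simp] theorem eval_div : (a / b).eval s = a.eval s / b.eval s := rfl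
@[simp] theorem eval_mod : (a % b).eval s = a.eval s % b.eval s := rfl
@[simp] theorem eval_lt : (a.lt b).eval s = if a.eval s < b.eval s then 1 else 0 := rfl
@[simp] theorem eval_eq : (a.eq b).eval s = if a.eval s = b.eval s then 1 else 0 := rfl
@[simp] theorem eval_num (k : ℕ) :
    eval s (no_index (OfNat.ofNat k : Expr)) = (OfNat.ofNat k : ℕ) := rfl
@[simp] theorem eval_const (k : ℕ) : (num k).eval s = k := rfl
@[simp] theorem eval_var (x : ℕ) : (var x).eval s = s.var x := rfl
@[simp] theorem eval_rd (k : ℕ) : (rd k a).eval s = s.arr k (a.eval s) := rfl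

@[simp] theorem safe_add : (a + b).Safe Γ s ↔ a.Safe Γ s ∧ b.Safe Γ s ∧
    a.eval s + b.eval s < 2 ^ w := Iff.rfl
@[simp] theorem safe_sub : (a - b).Safe Γ s ↔ a.Safe Γ s ∧ b.Safe Γ s ∧
    b.eval s ≤ a.eval s := Iff.rfl
@[simp] theorem safe_mul : (a * b).Safe Γ s ↔ a.Safe Γ s ∧ b.Safe Γ s ∧
    a.eval s * b.eval s < 2 ^ w := Iff.rfl
@[simp] theorem safe_div : (a / b).Safe Γ s ↔ a.Safe Γ s ∧ b.Safe Γ s := by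
  show _ ∧ _ ∧ True ↔ _
  simp
@[simp] theorem safe_mod : (a % b).Safe Γ s ↔ a.Safe Γ s ∧ b.Safe Γ s := by
  show _ ∧ _ ∧ True ↔ _
  simp
@[simp] theorem safe_lt : (a.lt b).Safe Γ s ↔ a.Safe Γ s ∧ b.Safe Γ s := by
  show _ ∧ _ ∧ True ↔ _
  simp
@[simp] theorem safe_eq : (a.eq b).Safe Γ s ↔ a.Safe Γ s ∧ b.Safe Γ s := by
  show _ ∧ _ ∧ True ↔ _
  simp
@[simp] theorem safe_num (k : ℕ) :
    Safe Γ s (no_index (OfNat.ofNat k : Expr)) ↔ (OfNat.ofNat k : ℕ) < 2 ^ w := Iff.rfl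
@[simp] theorem safe_const (k : ℕ) : (num k).Safe Γ s ↔ k < 2 ^ w := Iff.rfl
@[simp] theorem safe_var (x : ℕ) : (var x).Safe Γ s ↔ x < 39 := Iff.rfl
@[simp] theorem safe_rd (k : ℕ) : (rd k a).Safe Γ s ↔ a.Safe Γ s ∧
    Γ.Valid k (a.eval s) := Iff.rfl

end
end Expr

attribute [simp] Stm.run Stm.Safe

theorem Layout.valid_zero {w : ℕ} (Γ : Layout w) (i : ℕ) : Γ.Valid 0 i ↔ i < Γ.base := by
  simp [Layout.Valid]

/-- Write the key in variable `28` into the node whose number is in variable `27`, a leaf of the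
tree in array `11`, and update the ancestors of that leaf. -/
def updateProg : Prog :=
  Stm.comp (.wr 11 (.var 27) (.var 28)) ;>
  whileLoop (.lt 1 (.var 27))
    (Stm.comp (.set 27 (.var 27 / 2) ;;
      .ite (.lt (.rd 11 (2 * .var 27)) (.rd 11 (2 * .var 27 + 1)))
        (.wr 11 (.var 27) (.rd 11 (2 * .var 27)))
        (.wr 11 (.var 27) (.rd 11 (2 * .var 27 + 1)))))

/-- A time bound for updates of a tree with `n` leaves. -/
def updateTime (n : ℕ) : ℕ := 100 * (Nat.log 2 (2 * n) + 1)

/-- After the leaf has been overwritten, the tree is correct except possibly at the parent of the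
current node. Recomputing that parent moves the defect up one level, so logarithmically many rounds
suffice. Only the leaves are described in the conclusion; `TreeOK` determines the rest. -/
theorem wp_update {w : ℕ} {Γ : Layout w} {ω : Tape w} {n i : ℕ} {s : Store} (hi : i < n)
    (h27 : s.var 27 = n + i) (ht : TreeOK n (s.arr 11)) (hcap : 2 * n ≤ Γ.cap) :
    wp Γ ω updateProg (updateTime n) (fun s' => s.Same 27 11 s' ∧ TreeOK n (s'.arr 11) ∧
      ∀ p, n ≤ p → s'.arr 11 p = Function.update (s.arr 11) (n + i) (s.var 28) p) s := by
  have hlt : 2 * n < 2 ^ w := by have := Γ.cap_lt; omega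
  have hlt2 : 2 < 2 ^ w := by have := Γ.cap_lt; omega
  have hw := Γ.one_le
  have hv : ∀ j, Γ.Valid 11 j ↔ j < Γ.cap := fun j => by simp [Layout.Valid]
  refine wp_seq (T1 := 8) (T2 := 100 * Nat.log 2 (2 * n) + 10)
    (by unfold updateTime; omega) (wp_stm _ ?_ (le_refl _) ?_)
  · simp [hv]; omega
  refine wp_while (fun s' => s.Same 27 11 s' ∧ 1 ≤ s'.var 27 ∧ s'.var 27 < 2 * n ∧
      (∀ q, 1 ≤ q → q < n → q ≠ s'.var 27 / 2 →
        s'.arr 11 q = min (s'.arr 11 (2 * q)) (s'.arr 11 (2 * q + 1))) ∧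
      ∀ p, n ≤ p → s'.arr 11 p = Function.update (s.arr 11) (n + i) (s.var 28) p)
    (fun s' => 100 * Nat.log 2 (s'.var 27)) ?_ ?_ ?_ ?_ ?_
  · intro s' _
    simp; omega
  · rintro s' ⟨h1, h2, h3, h4, h5⟩ h6
    have h7 : 1 < s'.var 27 := by
      by_contra hc
      simp [hc] at h6
    refine ⟨94, wp_stm _ ?_ (by decide) ?_⟩
    · simp [hv]
      omega
    · have hlog : Nat.log 2 (s'.var 27) = Nat.log 2 (s'.var 27 / 2) + 1 := by
        rw [Nat.log_div_base]
        have : 1 ≤ Nat.log 2 (s'.var 27) := Nat.log_pos (by omega) (by omega)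
        omega
      set p := s'.var 27 / 2 with hp
      have hp1 : 1 ≤ p := by omega
      have hpn : p < n := by omega
      have e : ((Stm.set 27 (.var 27 / 2) ;;
          .ite (.lt (.rd 11 (2 * .var 27)) (.rd 11 (2 * .var 27 + 1)))
          (.wr 11 (.var 27) (.rd 11 (2 * .var 27)))
          (.wr 11 (.var 27) (.rd 11 (2 * .var 27 + 1)))).run s') =
          (s'.setVar 27 p).setArr 11 p (min (s'.arr 11 (2 * p)) (s'.arr 11 (2 * p + 1))) := by
        simp only [Stm.run, Expr.eval_div, Expr.eval_lt, Expr.eval_var, Expr.eval_num,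
          Expr.eval_rd, Expr.eval_mul, Expr.eval_add, Store.setVar_var, if_true,
          Store.setVar_arr, ← hp]
        by_cases hl : s'.arr 11 (2 * p) < s'.arr 11 (2 * p + 1)
        · simp [hl, min_eq_left hl.le]
        · simp [hl, min_eq_right (not_lt.1 hl)]
      rw [e]
      refine ⟨⟨(h1.setVar (by omega)).setArr (by omega), ?_, ?_, ?_, ?_⟩, ?_⟩
      · simpa using hp1
      · simp; omega
      · intro q hq1 hq2 hq3
        simp only [Store.setArr_var, Store.setVar_var, if_true] at hq3
        simp only [Store.setArr_arr, if_true, Store.setVar_arr]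
        rw [Function.update_of_ne (show 2 * q ≠ p by omega),
          Function.update_of_ne (show 2 * q + 1 ≠ p by omega)]
        by_cases hqp : q = p
        · rw [hqp, Function.update_self]
        · rw [Function.update_of_ne hqp, h4 q hq1 hq2 (by omega)]
      · intro q hq
        simp only [Store.setArr_arr, if_true, Store.setVar_arr]
        rw [Function.update_of_ne (by omega)]
        exact h5 q hq
      · simp only [Store.setArr_var, Store.setVar_var, if_true]
        show 94 + (3 + 1) + _ ≤ _
        omega
  · simp only [Stm.run, Store.setArr_var, h27]
    have : Nat.log 2 (n + i) ≤ Nat.log 2 (2 * n) := Nat.log_mono_right (by omega)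
    show _ + 3 + 1 ≤ _
    omega
  · simp only [Stm.run, Expr.eval_var, h27]
    refine ⟨(Store.Same.refl _ _ _).setArr (by omega), ?_, ?_, ?_, ?_⟩
    · simp only [Store.setArr_var, h27]; omega
    · simp only [Store.setArr_var, h27]; omega
    · intro q hq1 hq2 hq3
      simp only [Store.setArr_var, h27] at hq3
      simp only [Store.setArr_arr, if_true]
      rw [Function.update_of_ne (show q ≠ n + i by omega),
        Function.update_of_ne (show 2 * q ≠ n + i by omega),
        Function.update_of_ne (show 2 * q + 1 ≠ n + i by omega)]
      exact ht q hq1 hq2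
    · intro p hp
      simp
  · rintro s' ⟨h1, h2, h3, h4, h5⟩ h6
    refine ⟨h1, ?_, h5⟩
    have h7 : s'.var 27 = 1 := by
      by_contra hc
      have : 1 < s'.var 27 := by omega
      simp [this] at h6
    intro q hq1 hq2
    -- At the root the exceptional node is `1 / 2 = 0`, which is not a node of the tree.
    exact h4 q hq1 hq2 (by rw [h7]; omega)

end WordRAM

namespace WordRAM

/-! ## Shortest paths -/

/-- A network of `n` vertices and `arcs` arcs, together with its distance function. -/
structure Net where
  n : ℕ
  arcs : ℕ
  tl : ℕ → ℕ
  hd : ℕ → ℕ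
  wt : ℕ → ℕ
  big : ℕ
  side : ℕ → ℕ
  dist : ℕ → ℕ → ℕ
  n_pos : 0 < n
  tl_lt : ∀ j < arcs, tl j < n
  hd_lt : ∀ j < arcs, hd j < n
  wt_le : ∀ j < arcs, wt j ≤ big
  side_le : ∀ v < n, side v ≤ 1
  dist_self : ∀ x < n, dist x x = 0
  dist_comm : ∀ x < n, ∀ y < n, dist x y = dist y x
  dist_tri : ∀ x < n, ∀ y < n, ∀ z < n, dist x z ≤ dist x y + dist y z
  dist_lt : ∀ x < n, ∀ v < n, dist x v < big
  dist_arc : ∀ j < arcs, dist (tl j) (hd j) ≤ wt j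
  -- Distances are the greatest feasible potential. This dual description is what the final state of
  -- Dijkstra's algorithm can be compared with, and it avoids walks.
  le_dist : ∀ x < n, ∀ D : ℕ → ℕ, D x = 0 → (∀ j < arcs, D (hd j) ≤ D (tl j) + wt j) →
    ∀ v < n, D v ≤ dist x v

namespace Net
variable (G : Net)

theorem dist_step {x : ℕ} (hx : x < G.n) {j : ℕ} (hj : j < G.arcs) :
    G.dist x (G.hd j) ≤ G.dist x (G.tl j) + G.wt j :=
  (G.dist_tri x hx _ (G.tl_lt j hj) _ (G.hd_lt j hj)).trans
    (Nat.add_le_add_left (G.dist_arc j hj) _)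

/-- The number of the last arc below `i` with tail `v`, plus one, or `0` if there is none. -/
def last : ℕ → ℕ → ℕ
  | 0, _ => 0
  | i + 1, v => if G.tl i = v then i + 1 else last i v

/-- The number of arcs below `i` with tail `v`. -/
def deg : ℕ → ℕ → ℕ
  | 0, _ => 0
  | i + 1, v => if G.tl i = v then deg i v + 1 else deg i v

theorem last_le (i v : ℕ) : G.last i v ≤ i := by
  induction i with
  | zero => exact le_refl _
  | succ i ih => unfold last; split_ifs <;> omega

theorem last_tl (i v : ℕ) (h : G.last i v ≠ 0) : G.tl (G.last i v - 1) = v := by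
  induction i with
  | zero => exact absurd rfl h
  | succ i ih =>
    unfold last at h ⊢
    split_ifs at h ⊢ with h1
    · simpa using h1
    · exact ih h

/-- Following `last` downwards from `arcs` therefore meets every arc with tail `v`: this is the
linked list stored in the arrays `4` and `5`. -/
theorem last_skip (i v j : ℕ) (h : G.last i v ≤ j) (hj : j < i) : G.tl j ≠ v := by
  induction i with
  | zero => omega
  | succ i ih =>
    unfold last at h
    split_ifs at h with h1
    · omega
    · by_cases e : j = i
      · rwa [e]
      · exact ih h (by omega)

/-- `deg` at the current pointer counts the arcs left in the list; it is the clock of the relaxation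
loop. -/
theorem deg_last (i v : ℕ) : G.deg (G.last i v) v = G.deg i v := by
  induction i with
  | zero => rfl
  | succ i ih =>
    unfold last
    split_ifs with h1
    · rfl
    · rw [ih]; simp [deg, h1]

theorem deg_pred {p v : ℕ} (hp : p ≠ 0) (h : G.tl (p - 1) = v) :
    G.deg p v = G.deg (p - 1) v + 1 := by
  obtain ⟨q, rfl⟩ : ∃ q, p = q + 1 := ⟨p - 1, by omega⟩
  rw [Nat.add_sub_cancel] at *
  simp [deg, h]

theorem sum_deg {i : ℕ} (hi : i ≤ G.arcs) : ∑ v ∈ Finset.range G.n, G.deg i v = i := by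
  induction i with
  | zero => simp [deg]
  | succ i ih =>
    have h1 : ∀ v, G.deg (i + 1) v = G.deg i v + if G.tl i = v then 1 else 0 := by
      intro v; simp only [deg]; split_ifs <;> rfl
    simp only [h1, Finset.sum_add_distrib, ih (by omega)]
    simp [G.tl_lt i (by omega)]

/-- The vertex `u` has been reached and has been removed from the tree. -/
def Done (D t : ℕ → ℕ) (u : ℕ) : Prop := t (G.n + u) = G.big * G.n ∧ D u < G.big

/-- The invariant of the shortest-path computation from `src` with tentative distances `D` and
tree `t`; the arcs in `pend` have not been relaxed. -/
structure DInv (src : ℕ) (D t : ℕ → ℕ) (pend : ℕ → Prop) : Prop where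
  tree : TreeOK G.n t
  lower : ∀ v < G.n, G.dist src v ≤ D v
  upper : ∀ v < G.n, D v ≤ G.big
  src0 : D src = 0
  leaf : ∀ v < G.n, t (G.n + v) = G.big * G.n ∨ (t (G.n + v) = D v * G.n + v ∧ D v < G.big)
  -- The sentinel also marks tails not yet reached; for them `D` is `big`, and the inequality is
  -- harmless.
  arc : ∀ j < G.arcs, t (G.n + G.tl j) = G.big * G.n → ¬ pend j →
    D (G.hd j) ≤ D (G.tl j) + G.wt j
  order : ∀ u < G.n, ∀ v < G.n, G.Done D t u → ¬ G.Done D t v → D u ≤ D v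

variable {G}

/-- The key `D v * n + v` sorts by distance and reveals the vertex modulo `n`. Keys of live vertices
stay below the sentinel `big * n`, which marks vertices not yet reached as well as removed ones; `D
v < big` tells these apart. -/
theorem key_lt {d v : ℕ} (hd : d < G.big) (hv : v < G.n) : d * G.n + v < G.big * G.n := by
  calc d * G.n + v < d * G.n + G.n := by omega
    _ = (d + 1) * G.n := by ring
    _ ≤ G.big * G.n := Nat.mul_le_mul_right _ hd

/-- If the root is at the sentinel, no leaf holds a live key, so all arcs are relaxed and `D` is a
feasible potential. Then `le_dist` gives one inequality, and `lower` is the other. -/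
theorem DInv.final {src : ℕ} {D t : ℕ → ℕ} (hs : src < G.n)
    (h : G.DInv src D t fun _ => False) (ht : G.big * G.n ≤ t 1) :
    ∀ v < G.n, D v = G.dist src v := by
  intro v hv
  refine le_antisymm (G.le_dist src hs D h.src0 (fun j hj => h.arc j hj ?_ id) v hv)
    (h.lower v hv)
  have h1 := h.tree.root_le (p := G.n + G.tl j) (by have := G.n_pos; omega)
    (by have := G.tl_lt j hj; omega)
  rcases h.leaf _ (G.tl_lt j hj) with h2 | ⟨h2, h3⟩
  · exact h2
  · have := key_lt h3 (G.tl_lt j hj)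
    omega

/-- The root identifies a live vertex `a` with least tentative distance. Removing it keeps `order`
because removed vertices already have values at most `D a`, and all remaining ones have values at
least `D a`. The arcs that leave `a` become pending. -/
theorem DInv.extract {src : ℕ} {D t t' : ℕ → ℕ} {a : ℕ}
    (h : G.DInv src D t fun _ => False) (ht : t 1 < G.big * G.n) (ha : a = t 1 % G.n)
    (hT : TreeOK G.n t')
    (hl : ∀ p, G.n ≤ p → t' p = Function.update t (G.n + a) (G.big * G.n) p) :
    a < G.n ∧ ¬ G.Done D t a ∧ G.Done D t' a ∧ (∀ v < G.n, v ≠ a → (G.Done D t' v ↔ G.Done D t v)) ∧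
      (∀ u < G.n, G.Done D t' u → D u ≤ D a) ∧ G.DInv src D t' fun j => G.tl j = a := by
  have hn := G.n_pos
  obtain ⟨v, hv, e⟩ := h.tree.exists_leaf 1 (le_refl _) (by omega)
  have hlv : t (G.n + v) = D v * G.n + v ∧ D v < G.big := by
    rcases h.leaf v hv with h2 | h2
    · omega
    · exact h2
  have hav : a = v := by
    rw [ha, e, hlv.1, Nat.mul_comm, Nat.mul_add_mod, Nat.mod_eq_of_lt hv]
  subst hav
  have hother : ∀ u < G.n, u ≠ a → t' (G.n + u) = t (G.n + u) := by
    intro u _ hne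
    rw [hl _ (by omega), Function.update_of_ne (by omega)]
  have hself : t' (G.n + a) = G.big * G.n := by rw [hl _ (by omega), Function.update_self]
  have hnd : ¬ G.Done D t a := fun hd => by
    have := hd.1
    omega
  have hiff : ∀ v < G.n, v ≠ a → (G.Done D t' v ↔ G.Done D t v) := by
    intro v hv hne
    unfold Done
    rw [hother v hv hne]
  have hmax : ∀ u < G.n, G.Done D t' u → D u ≤ D a := by
    intro u hu hd
    by_cases e : u = a
    · rw [e]
    · exact h.order u hu a hv ((hiff u hu e).1 hd) hnd
  refine ⟨hv, hnd, ⟨hself, hlv.2⟩, hiff, hmax, hT, h.lower, h.upper, h.src0, ?_, ?_, ?_⟩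
  · intro u hu
    by_cases e : u = a
    · left; rw [e]; exact hself
    · rw [hother u hu e]; exact h.leaf u hu
  · intro j hj h1 h2
    refine h.arc j hj ?_ id
    rwa [hother _ (G.tl_lt j hj) h2] at h1
  · intro u hu w hw h1 h2
    refine (hmax u hu h1).trans ?_
    have hwa : w ≠ a := fun e => h2 (e ▸ ⟨hself, hlv.2⟩)
    rcases h.leaf w hw with h3 | ⟨h3, h4⟩
    · have : ¬ D w < G.big := fun h4 => h2 ⟨by rw [hother w hw hwa]; exact h3, h4⟩
      omega
    · have h5 := h.tree.root_le (p := G.n + w) (by omega) (by omega)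
      rw [e, hlv.1, h3] at h5
      by_contra hc
      have : (D w + 1) * G.n ≤ D a * G.n := Nat.mul_le_mul_right _ (by omega)
      rw [add_mul] at this
      omega

theorem DInv.mono {src : ℕ} {D t : ℕ → ℕ} {pend pend' : ℕ → Prop}
    (h : G.DInv src D t pend) (hp : ∀ i < G.arcs, pend i → pend' i) : G.DInv src D t pend' :=
  ⟨h.tree, h.lower, h.upper, h.src0, h.leaf,
    fun i hi h1 h2 => h.arc i hi h1 fun h3 => h2 (hp i hi h3), h.order⟩

theorem DInv.skip {src : ℕ} {D t : ℕ → ℕ} {pend pend' : ℕ → Prop}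
    (h : G.DInv src D t pend) {j : ℕ} (hp : ∀ i < G.arcs, i ≠ j → pend i → pend' i)
    (hj : D (G.hd j) ≤ D (G.tl j) + G.wt j) : G.DInv src D t pend' := by
  refine ⟨h.tree, h.lower, h.upper, h.src0, h.leaf, ?_, h.order⟩
  intro i hi h1 h2
  by_cases e : i = j
  · rw [e]; exact hj
  · exact h.arc i hi h1 fun h3 => h2 (hp i hi e h3)

/-- Weights are nonnegative and removed vertices have values at most that of the tail, so a head
that can still be improved has not been removed. Hence values of removed vertices never change. -/
theorem DInv.relax {src : ℕ} {D t t' : ℕ → ℕ} {pend pend' : ℕ → Prop} (hs : src < G.n)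
    (h : G.DInv src D t pend) {j : ℕ} (hj : j < G.arcs)
    (hp : ∀ i < G.arcs, i ≠ j → pend i → pend' i) (hmax : ∀ u < G.n, G.Done D t u → D u ≤ D (G.tl j))
    (hlt : D (G.tl j) + G.wt j < D (G.hd j)) (hT : TreeOK G.n t')
    (hl : ∀ p, G.n ≤ p → t' p = Function.update t (G.n + G.hd j)
      ((D (G.tl j) + G.wt j) * G.n + G.hd j) p) :
    (∀ v < G.n, G.Done (Function.update D (G.hd j) (D (G.tl j) + G.wt j)) t' v ↔ G.Done D t v) ∧
    (∀ v < G.n, G.Done D t v →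
      Function.update D (G.hd j) (D (G.tl j) + G.wt j) v = D v) ∧
    G.DInv src (Function.update D (G.hd j) (D (G.tl j) + G.wt j)) t' pend' := by
  set b := G.hd j with hb
  set nd := D (G.tl j) + G.wt j with hnd
  have hbn : b < G.n := G.hd_lt j hj
  have hb_nd : ¬ G.Done D t b := fun hd => by have := hmax b hbn hd; omega
  have hbig : nd < G.big := lt_of_lt_of_le hlt (h.upper b hbn)
  have hother : ∀ u < G.n, u ≠ b → t' (G.n + u) = t (G.n + u) := by
    intro u _ hne
    rw [hl _ (by omega), Function.update_of_ne (by omega)]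
  have hself : t' (G.n + b) = nd * G.n + b := by rw [hl _ (by omega), Function.update_self]
  have hkey := key_lt hbig hbn
  have hiff : ∀ v < G.n, G.Done (Function.update D b nd) t' v ↔ G.Done D t v := by
    intro v hv
    by_cases e : v = b
    · subst e
      refine ⟨fun hd => ?_, fun hd => absurd hd hb_nd⟩
      have := hd.1
      omega
    · unfold Done
      rw [hother v hv e, Function.update_of_ne e]
  have hsame : ∀ v < G.n, G.Done D t v → Function.update D b nd v = D v := by
    intro v hv hd
    rw [Function.update_of_ne]
    rintro rfl
    exact hb_nd hd
  have hle : ∀ v, Function.update D b nd v ≤ D v := by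
    intro v
    by_cases e : v = b
    · rw [e, Function.update_self]; exact hlt.le
    · rw [Function.update_of_ne e]
  refine ⟨hiff, hsame, hT, ?_, ?_, ?_, ?_, ?_, ?_⟩
  · intro v hv
    by_cases e : v = b
    · rw [e, Function.update_self]
      exact (G.dist_step hs hj).trans (Nat.add_le_add_right (h.lower _ (G.tl_lt j hj)) _)
    · rw [Function.update_of_ne e]; exact h.lower v hv
  · intro v hv; exact (hle v).trans (h.upper v hv)
  · have := hle src
    rw [h.src0] at this
    omega
  · intro v hv
    by_cases e : v = b
    · right
      rw [e, Function.update_self]; exact ⟨hself, hbig⟩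
    · rw [hother v hv e, Function.update_of_ne e]; exact h.leaf v hv
  · intro i hi h1 h2
    have hib : G.tl i ≠ b := by
      intro e
      rw [e] at h1
      omega
    rw [Function.update_of_ne hib]
    by_cases e : i = j
    · rw [e, ← hb, Function.update_self]
    · rw [hother _ (G.tl_lt i hi) hib] at h1
      exact (hle _).trans (h.arc i hi h1 fun h3 => h2 (hp i hi e h3))
  · intro u hu v hv h1 h2
    rw [hiff u hu] at h1
    rw [hiff v hv] at h2
    rw [hsame u hu h1]
    by_cases e : v = b
    · rw [e, Function.update_self]
      exact (hmax u hu h1).trans (by omega)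
    · rw [Function.update_of_ne e]; exact h.order u hu v hv h1 h2

theorem DInv.init {src : ℕ} {D t t' : ℕ → ℕ} (hs : src < G.n)
    (hD : ∀ v < G.n, D v = if v = src then 0 else G.big)
    (ht : ∀ v < G.n, t (G.n + v) = G.big * G.n) (hT : TreeOK G.n t')
    (hl : ∀ p, G.n ≤ p → t' p = Function.update t (G.n + src) src p) :
    G.DInv src D t' fun _ => False := by
  have hpos : 0 < G.big := lt_of_le_of_lt (Nat.zero_le _) (G.dist_lt src hs src hs)
  have hother : ∀ u < G.n, u ≠ src → t' (G.n + u) = G.big * G.n := by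
    intro u hu hne
    rw [hl _ (by omega), Function.update_of_ne (by omega), ht u hu]
  have hself : t' (G.n + src) = src := by rw [hl _ (by omega), Function.update_self]
  have hkey := key_lt hpos hs
  have hne : ∀ u < G.n, t' (G.n + u) = G.big * G.n → D u = G.big := by
    intro u hu h1
    rw [hD u hu, if_neg]
    rintro rfl
    omega
  refine ⟨hT, ?_, ?_, ?_, ?_, ?_, ?_⟩
  · intro v hv
    rw [hD v hv]
    split_ifs with e
    · rw [e, G.dist_self src hs]
    · exact (G.dist_lt src hs v hv).le
  · intro v hv
    rw [hD v hv]
    split_ifs <;> omega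
  · rw [hD src hs, if_pos rfl]
  · intro v hv
    by_cases e : v = src
    · right
      rw [e, hD src hs, if_pos rfl, hself]
      exact ⟨by omega, hpos⟩
    · left; exact hother v hv e
  · intro j hj h1 _
    rw [hne _ (G.tl_lt j hj) h1, hD _ (G.hd_lt j hj)]
    split_ifs <;> omega
  · intro u hu v hv h1 _
    have := hne u hu h1.1
    have := h1.2
    omega

end Net
end WordRAM

/-! ### Dijkstra's algorithm as a program -/

namespace WordRAM

/-- The store holds the network. -/
structure Net.Loaded (G : Net) (s : Store) : Prop where
  n : s.var 1 = G.n
  arcs : s.var 2 = G.arcs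
  big : s.var 3 = G.big
  tl : ∀ j < G.arcs, s.arr 1 j = G.tl j
  hd : ∀ j < G.arcs, s.arr 2 j = G.hd j
  wt : ∀ j < G.arcs, s.arr 3 j = G.wt j
  next : ∀ j < G.arcs, s.arr 4 j = G.last j (G.tl j)
  first : ∀ v < G.n, s.arr 5 v = G.last G.arcs v
  side : ∀ v < G.n, s.arr 6 v = G.side v

theorem Net.Loaded.same {G : Net} {s s' : Store} {nv na : ℕ} (h : G.Loaded s)
    (hs : s.Same nv na s') (hv : 4 ≤ nv) (ha : 7 ≤ na) : G.Loaded s' := by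
  refine ⟨?_, ?_, ?_, ?_, ?_, ?_, ?_, ?_, ?_⟩
  · rw [hs.var _ (by omega)]; exact h.n
  · rw [hs.var _ (by omega)]; exact h.arcs
  · rw [hs.var _ (by omega)]; exact h.big
  · rw [hs.arr _ (by omega)]; exact h.tl
  · rw [hs.arr _ (by omega)]; exact h.hd
  · rw [hs.arr _ (by omega)]; exact h.wt
  · rw [hs.arr _ (by omega)]; exact h.next
  · rw [hs.arr _ (by omega)]; exact h.first
  · rw [hs.arr _ (by omega)]; exact h.side

/-- The words are long enough for computations with the network. -/
structure Net.Fits {w : ℕ} (G : Net) (Γ : Layout w) : Prop where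
  n_cap : 2 * G.n ≤ Γ.cap
  arcs_cap : G.arcs ≤ Γ.cap
  word : (2 * G.big + 2) * (G.n + 1) < 2 ^ w

section
variable {w : ℕ} {G : Net} {Γ : Layout w}

theorem Net.Fits.cap_lt (h : G.Fits Γ) : Γ.cap < 2 ^ w := by
  have := Γ.cap_lt
  have := h.n_cap
  have := G.n_pos
  omega

theorem Net.Fits.big_mul (h : G.Fits Γ) : G.big * G.n < 2 ^ w := by
  have := h.word
  nlinarith

theorem Net.Fits.two_big (h : G.Fits Γ) : 2 * G.big + 2 < 2 ^ w := by
  have := h.word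
  nlinarith

end

/-- Initialize the distances and the tree. -/
def initProg : Prog :=
  forLoop 21 1 (Stm.comp (.wr 10 (.var 21) (.var 3) ;; .wr 11 (.var 21) (.var 3 * .var 1) ;;
    .wr 11 (.var 1 + .var 21) (.var 3 * .var 1))) ;>
  Stm.comp (.wr 10 (.var 20) 0 ;; .set 27 (.var 1 + .var 20) ;; .set 28 (.var 20)) ;>
  updateProg

/-- Relax the arc whose number is in variable `23`, minus one, and go to the next arc. -/
def relaxProg : Prog :=
  Stm.comp (.set 24 (.rd 2 (.var 23 - 1)) ;; .set 25 (.rd 10 (.var 22) + .rd 3 (.var 23 - 1))) ;>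
  whenProg (.lt (.var 25) (.rd 10 (.var 24)))
    (Stm.comp (.wr 10 (.var 24) (.var 25) ;; .set 27 (.var 1 + .var 24) ;;
      .set 28 (.var 25 * .var 1 + .var 24)) ;> updateProg) ;>
  Stm.comp (.set 23 (.rd 4 (.var 23 - 1)))

/-- Extract the vertex of least key and relax the arcs that leave it. -/
def settleProg : Prog :=
  Stm.comp (.set 22 (.rd 11 1 % .var 1) ;; .set 27 (.var 1 + .var 22) ;;
    .set 28 (.var 3 * .var 1)) ;>
  updateProg ;> Stm.comp (.set 23 (.rd 5 (.var 22))) ;> whileLoop (.var 23) relaxProg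

/-- Dijkstra's algorithm: compute the distances from the vertex in variable `20` into the
array `10`. -/
def dijkstraProg : Prog :=
  initProg ;> whileLoop (.lt (.rd 11 1) (.var 3 * .var 1)) settleProg

namespace Net
variable {w : ℕ} {G : Net} {Γ : Layout w} {ω : Tape w}

theorem wp_init {s : Store} (hL : G.Loaded s) (hF : G.Fits Γ) (hs : s.var 20 < G.n) :
    wp Γ ω initProg (38 * G.n + 20 + updateTime G.n) (fun s' => s.Same 20 10 s' ∧
      G.DInv (s.var 20) (s'.arr 10) (s'.arr 11) fun _ => False) s := by
  have h1 := hF.cap_lt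
  have h2 := hF.n_cap
  have h3 := hF.big_mul
  have hw := Γ.one_le
  have hv10 : ∀ j, Γ.Valid 10 j ↔ j < Γ.cap := fun j => by simp [Layout.Valid]
  have hv11 : ∀ j, Γ.Valid 11 j ↔ j < Γ.cap := fun j => by simp [Layout.Valid]
  have hb : (0 : ℕ) < 2 ^ w := by positivity
  refine wp_seq (T1 := 38 * G.n + 6) (T2 := 14 + updateTime G.n) (by omega)
    (wp_for (N := G.n) (T := 30) (fun k s' => s.Same 21 10 s' ∧ ∀ v < k, s'.arr 10 v = G.big ∧
      s'.arr 11 v = G.big * G.n ∧ s'.arr 11 (G.n + v) = G.big * G.n) (by decide) (by decide)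
      (by decide) (by omega) hL.n ?_ ?_ (by omega) ?_)
  · exact ⟨(Store.Same.refl _ _ _).setVar (by omega), fun v hv => absurd hv (by omega)⟩
  · rintro k hk s' e1 e2 ⟨h4, h5⟩
    have e3 : s'.var 3 = G.big := by rw [h4.var 3 (by omega)]; exact hL.big
    refine wp_stm _ ?_ (by decide) ?_
    · simp [hv10, hv11, e1, e2, e3]; omega
    · refine ⟨?_, ?_, ?_, ?_⟩
      · simpa using e1
      · simpa using e2
      · exact (((h4.setArr (by omega)).setArr (by omega)).setArr (by omega)).setVar (by omega)
      · intro v hv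
        simp only [Stm.run, Expr.eval_var, Store.setVar_arr, Store.setArr_arr, Store.setArr_var,
          Expr.eval_mul, Expr.eval_add, e1, e2, e3]
        by_cases e : v = k
        · subst e
          simp [Function.update_apply]
        · obtain ⟨h6, h7, h8⟩ := h5 v (by omega)
          simp [Function.update_apply, e, h6, h7, h8]
  · rintro s1 e1 e2 ⟨h4, h5⟩
    have e20 : s1.var 20 = s.var 20 := h4.var 20 (by omega)
    refine wp_seq (T1 := 14) (T2 := updateTime G.n) (by omega) (wp_stm _ ?_ (by decide) ?_)
    · simp [hv10, e2, e20]; omega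
    · have ht : ∀ p < 2 * G.n, s1.arr 11 p = G.big * G.n := by
        intro p hp
        by_cases hpn : p < G.n
        · exact (h5 p hpn).2.1
        · have := (h5 (p - G.n) (by omega)).2.2
          rwa [Nat.add_sub_cancel' (by omega)] at this
      refine wp_mono (wp_update hs ?_ ?_ h2) (le_refl _) ?_
      · simp [e2, e20]
      · intro q hq1 hq2
        simp [ht q (by omega), ht (2 * q) (by omega), ht (2 * q + 1) (by omega)]
      · rintro s2 ⟨h6, h7, h8⟩
        simp only [Stm.run, Store.setVar_arr, Store.setArr_arr, Store.setVar_var,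
          Store.setArr_var, Expr.eval_var, if_true, Expr.eval_add, Expr.eval_num, e2, e20] at h8
        refine ⟨?_, DInv.init (t := s1.arr 11) hs ?_ (fun v hv => ht _ (by omega)) h7
          (by simpa using h8)⟩
        · refine (h4.mono (by omega) (by omega)).trans (Store.Same.trans ?_
            (h6.mono (nv' := 20) (na' := 10) (by omega) (by omega)))
          exact (((Store.Same.refl _ _ _).setArr (by omega)).setVar (by omega)).setVar (by omega)
        · intro v hv
          rw [h6.arr 10 (by omega)]
          simp [Function.update_apply, e20, (h5 v hv).1]

/-- The invariant of the loop that relaxes the arcs that leave `a`; `s0` is the state before the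
computation and `s1` the one after the extraction of `a`. -/
structure RInv (G : Net) (src a : ℕ) (s0 s1 s : Store) : Prop where
  same : s0.Same 20 10 s
  a_var : s.var 22 = a
  dinv : G.DInv src (s.arr 10) (s.arr 11) fun j => G.tl j = a ∧ j < s.var 23
  done : G.Done (s.arr 10) (s.arr 11) a
  max : ∀ u < G.n, G.Done (s.arr 10) (s.arr 11) u → s.arr 10 u ≤ s.arr 10 a
  ptr : s.var 23 = 0 ∨ (s.var 23 ≤ G.arcs ∧ G.tl (s.var 23 - 1) = a)
  iff : ∀ v < G.n, G.Done (s.arr 10) (s.arr 11) v ↔ G.Done (s1.arr 10) (s1.arr 11) v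

theorem wp_relax {src a : ℕ} {s0 s1 s : Store} (hL : G.Loaded s0) (hF : G.Fits Γ)
    (hsrc : src < G.n) (ha : a < G.n) (h : G.RInv src a s0 s1 s) (h0 : s.var 23 ≠ 0) :
    wp Γ ω relaxProg (80 + updateTime G.n) (fun s' => G.RInv src a s0 s1 s' ∧
      G.deg (s'.var 23) a + 1 = G.deg (s.var 23) a) s := by
  have hcl := hF.cap_lt
  have h2 := hF.n_cap
  have h2' := hF.arcs_cap
  have h3 := hF.big_mul
  have h3' := hF.two_big
  have hw := Γ.one_le
  have hv : ∀ k j, 0 < k → k < 16 → (Γ.Valid k j ↔ j < Γ.cap) := fun k j h h' => by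
    simp [Layout.Valid, show k ≠ 0 by omega, h']
  have hb : (0 : ℕ) < 2 ^ w := by positivity
  obtain ⟨hsame, havar, hD, hdone, hmax, hptr, hiff⟩ := h
  have hLs := hL.same hsame (by omega) (by omega)
  obtain ⟨hp, htl⟩ : s.var 23 ≤ G.arcs ∧ G.tl (s.var 23 - 1) = a := hptr.resolve_left h0
  set j := s.var 23 - 1 with hj
  have hjm : j < G.arcs := by omega
  have hwt := G.wt_le j hjm
  have hhd := G.hd_lt j hjm
  have hDa := hD.upper a ha
  have hDb := hD.upper _ hhd
  have hlast := G.last_le j a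
  have hdeg : G.deg (G.last j a) a + 1 = G.deg (s.var 23) a := by
    rw [deg_last, deg_pred G h0 htl]
  have hptr' : G.last j a = 0 ∨ (G.last j a ≤ G.arcs ∧ G.tl (G.last j a - 1) = a) := by
    by_cases hz : G.last j a = 0
    · exact Or.inl hz
    · exact Or.inr ⟨by omega, G.last_tl j a hz⟩
  have hpend : ∀ i < G.arcs, i ≠ j → (G.tl i = a ∧ i < s.var 23) →
      (G.tl i = a ∧ i < G.last j a) := by
    rintro i hi hne ⟨h4, h5⟩
    refine ⟨h4, ?_⟩
    by_contra hc
    exact G.last_skip j a i (by omega) (by omega) h4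
  refine wp_seq (T1 := 28) (T2 := 52 + updateTime G.n) (by omega) (wp_stm _ ?_ (by decide) ?_)
  · simp only [Stm.Safe, Stm.run, Expr.safe_rd, Expr.safe_sub, Expr.safe_add, Expr.safe_var,
      Expr.safe_num, Expr.eval_sub, Expr.eval_var, Expr.eval_num, Expr.eval_rd,
      hv 2 _ (by omega) (by omega), hv 3 _ (by omega) (by omega), hv 10 _ (by omega) (by omega),
      Store.setVar_var, Store.setVar_arr, havar, ← hj]
    simp [← hj, hLs.wt j hjm]
    omega
  set s2 : Store := (s.setVar 24 (G.hd j)).setVar 25 (s.arr 10 a + G.wt j) with hs2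
  have e : (Stm.set 24 (.rd 2 (.var 23 - 1)) ;;
      .set 25 (.rd 10 (.var 22) + .rd 3 (.var 23 - 1))).run s = s2 := by
    simp [hs2, ← hj, havar, hLs.wt j hjm, hLs.hd j hjm]
  rw [e]
  have hsame2 : s.Same 20 10 s2 :=
    ((Store.Same.refl _ _ _).setVar (by omega)).setVar (by omega)
  refine wp_seq (T1 := 36 + updateTime G.n) (T2 := 10) (by omega)
    (wp_mono (wp_when (T := 20 + updateTime G.n) (Q := fun s3 => s.Same 20 10 s3 ∧ s3.var 22 = a ∧
      s3.var 23 = s.var 23 ∧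
      G.DInv src (s3.arr 10) (s3.arr 11) (fun j' => G.tl j' = a ∧ j' < G.last j a) ∧
      (∀ v < G.n, G.Done (s3.arr 10) (s3.arr 11) v ↔ G.Done (s.arr 10) (s.arr 11) v) ∧
      (∀ v < G.n, G.Done (s.arr 10) (s.arr 11) v → s3.arr 10 v = s.arr 10 v)) ?_ ?_ ?_) ?_ ?_)
  · simp [hv, hs2]; omega
  · intro hc
    have hlt : s.arr 10 a + G.wt j < s.arr 10 (G.hd j) := by
      by_contra hn
      apply hc
      simp [hs2]
      omega
    have hkey := key_lt (lt_of_lt_of_le hlt hDb) hhd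
    refine wp_seq (T1 := 20) (T2 := updateTime G.n) (by omega) (wp_stm _ ?_ (by decide) ?_)
    · simp [hv, hs2, hLs.n]
      omega
    · refine wp_mono (wp_update hhd ?_ ?_ h2) (le_refl _) ?_
      · simp [hs2, hLs.n]
      · simpa [hs2] using hD.tree
      · rintro s3 ⟨h6, h7, h8⟩
        have e10 : s3.arr 10 =
            Function.update (s.arr 10) (G.hd j) (s.arr 10 a + G.wt j) := by
          rw [h6.arr 10 (by omega)]; simp [hs2]
        subst htl
        obtain ⟨r1, r2, r3⟩ := hD.relax hsrc hjm hpend hmax hlt h7 (by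
          intro p hp
          rw [h8 p hp]
          simp [hs2, hLs.n])
        refine ⟨?_, ?_, ?_, ?_, ?_, ?_⟩
        · refine Store.Same.trans ?_ (h6.mono (nv' := 20) (na' := 10) (by omega) (by omega))
          exact ((hsame2.setArr (by omega)).setVar (by omega)).setVar (by omega)
        · rw [h6.var 22 (by omega)]; simp [hs2, havar]
        · rw [h6.var 23 (by omega)]; simp [hs2]
        · rw [e10]; exact r3
        · rw [e10]; exact r1
        · rw [e10]; exact r2
  · intro hc
    have hge : s.arr 10 (G.hd j) ≤ s.arr 10 a + G.wt j := by
      by_contra hn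
      have : s.arr 10 a + G.wt j < s.arr 10 (G.hd j) := by omega
      simp [hs2, this] at hc
    refine ⟨hsame2, by simp [hs2, havar], by simp [hs2], ?_, ?_, ?_⟩
    · exact hD.skip hpend (by rw [htl]; exact hge)
    · intro v _; exact Iff.rfl
    · intro v _ _; rfl
  · show 20 + updateTime G.n + (1 + (1 + 6) + 1) + 2 ≤ _
    omega
  · rintro s3 ⟨q1, q2, q3, q4, q5, q6⟩
    have hL3 := hLs.same q1 (by omega) (by omega)
    refine wp_stm _ ?_ (by decide) ?_
    · simp [hv, q3, ← hj]
      omega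
    · have e3 : (Stm.set 23 (.rd 4 (.var 23 - 1))).run s3 = s3.setVar 23 (G.last j a) := by
        simp [q3, ← hj, hL3.next j hjm, htl]
      rw [e3]
      refine ⟨⟨(hsame.trans q1).setVar (by omega), by simpa using q2, by simpa using q4, ?_, ?_,
        by simpa using hptr', ?_⟩, by simpa using hdeg⟩
      · exact (q5 a ha).2 hdone
      · intro u hu hd
        have hd' := (q5 u hu).1 hd
        simp only [Store.setVar_arr]
        rw [q6 u hu hd', q6 a ha hdone]
        exact hmax u hu hd'
      · intro v hv
        exact (q5 v hv).trans (hiff v hv)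

end Net
end WordRAM

namespace WordRAM
namespace Net
variable {w : ℕ} {G : Net} {Γ : Layout w} {ω : Tape w}

open Classical in
/-- The time that the vertices that are not done still need. -/
noncomputable def rest (G : Net) (s : Store) : ℕ :=
  ∑ v ∈ Finset.range G.n, if G.Done (s.arr 10) (s.arr 11) v then 0 else
    (updateTime G.n + 100) * (G.deg G.arcs v + 1)

theorem rest_extract {s s' : Store} {a : ℕ} (ha : a < G.n)
    (h0 : ¬ G.Done (s.arr 10) (s.arr 11) a) (h1 : G.Done (s'.arr 10) (s'.arr 11) a)
    (h : ∀ v < G.n, v ≠ a →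
      (G.Done (s'.arr 10) (s'.arr 11) v ↔ G.Done (s.arr 10) (s.arr 11) v)) :
    G.rest s' + (updateTime G.n + 100) * (G.deg G.arcs a + 1) = G.rest s := by
  classical
  unfold rest
  rw [← Finset.sum_erase_add _ _ (Finset.mem_range.2 ha),
    ← Finset.sum_erase_add _ _ (Finset.mem_range.2 ha), if_pos h1, if_neg h0, add_zero]
  congr 1
  refine Finset.sum_congr rfl fun v hv => ?_
  rw [Finset.mem_erase, Finset.mem_range] at hv
  simp only [h v hv.2 hv.1]

theorem rest_le (s : Store) : G.rest s ≤ (updateTime G.n + 100) * (G.arcs + G.n) := by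
  classical
  unfold rest
  calc _ ≤ ∑ v ∈ Finset.range G.n, (updateTime G.n + 100) * (G.deg G.arcs v + 1) :=
        Finset.sum_le_sum fun v _ => by split_ifs <;> omega
    _ = _ := by
        rw [← Finset.mul_sum, Finset.sum_add_distrib, G.sum_deg (le_refl _)]
        simp

/-- The removed vertex pays with its share of `rest`: one tree update for the removal and at most
one for each arc that leaves it. The `12` is the cost of the outer guard and its test. -/
theorem wp_settle {src : ℕ} {s0 s : Store} (hL : G.Loaded s0) (hF : G.Fits Γ)
    (hsrc : src < G.n) (hsame : s0.Same 20 10 s)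
    (hD : G.DInv src (s.arr 10) (s.arr 11) fun _ => False) (hlt : s.arr 11 1 < G.big * G.n) :
    ∃ T, wp Γ ω settleProg T (fun s' => (s0.Same 20 10 s' ∧
      G.DInv src (s'.arr 10) (s'.arr 11) fun _ => False) ∧ T + 12 + G.rest s' ≤ G.rest s) s := by
  have hcl := hF.cap_lt
  have h2 := hF.n_cap
  have h2' := hF.arcs_cap
  have h3 := hF.big_mul
  have hn := G.n_pos
  have hv : ∀ k j, 0 < k → k < 16 → (Γ.Valid k j ↔ j < Γ.cap) := fun k j h h' => by
    simp [Layout.Valid, show k ≠ 0 by omega, h']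
  have hb : (0 : ℕ) < 2 ^ w := by positivity
  have hLs := hL.same hsame (by omega) (by omega)
  set a := s.arr 11 1 % G.n with ha
  have han : a < G.n := Nat.mod_lt _ hn
  have hw := Γ.one_le
  set Td := updateTime G.n + 85 with hTd
  refine ⟨60 + updateTime G.n + Td * G.deg G.arcs a,
    wp_seq (T1 := 20) (T2 := 40 + updateTime G.n + Td * G.deg G.arcs a) (by omega)
      (wp_stm _ ?_ (by decide) ?_)⟩
  · simp [hv, hLs.n, hLs.big, ← ha]
    omega
  set s2 : Store := ((s.setVar 22 a).setVar 27 (G.n + a)).setVar 28 (G.big * G.n) with hs2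
  have e : (Stm.set 22 (.rd 11 1 % .var 1) ;; .set 27 (.var 1 + .var 22) ;;
      .set 28 (.var 3 * .var 1)).run s = s2 := by
    simp [hs2, hLs.n, hLs.big, ← ha]
  rw [e]
  have hsame2 : s.Same 20 10 s2 :=
    (((Store.Same.refl _ _ _).setVar (by omega)).setVar (by omega)).setVar (by omega)
  refine wp_seq (T1 := updateTime G.n) (T2 := 40 + Td * G.deg G.arcs a) (by omega)
    (wp_mono (wp_update han (by simp [hs2]) (by simpa [hs2] using hD.tree) h2) (le_refl _) ?_)
  rintro s3 ⟨h6, h7, h8⟩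
  have e10 : s3.arr 10 = s.arr 10 := by rw [h6.arr 10 (by omega)]; simp [hs2]
  obtain ⟨_, r1, r2, r3, r4, r5⟩ := hD.extract hlt ha h7 (by
    intro p hp; rw [h8 p hp]; simp [hs2])
  have hsame3 : s0.Same 20 10 s3 :=
    (hsame.trans hsame2).trans (h6.mono (by omega) (by omega))
  have hL3 := hL.same hsame3 (by omega) (by omega)
  have e22 : s3.var 22 = a := by rw [h6.var 22 (by omega)]; simp [hs2]
  have hll := G.last_le G.arcs a
  refine wp_seq (T1 := 8) (T2 := 32 + Td * G.deg G.arcs a) (by omega) (wp_stm _ ?_ (by decide) ?_)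
  · simp [hv, e22]; omega
  have e4 : (Stm.set 23 (.rd 5 (.var 22))).run s3 = s3.setVar 23 (G.last G.arcs a) := by
    simp [e22, hL3.first a han]
  rw [e4]
  refine wp_while (fun s' => G.RInv src a s0 s3 s') (fun s' => Td * G.deg (s'.var 23) a)
    ?_ ?_ ?_ ?_ ?_
  · intro s' _; simp
  · intro s' hI hne
    refine ⟨80 + updateTime G.n, wp_mono (wp_relax hL hF hsrc han hI hne) (le_refl _) ?_⟩
    rintro s'' ⟨hI', hd⟩
    refine ⟨hI', ?_⟩
    rw [← hd]
    show 80 + updateTime G.n + (1 + 1) + Td * _ ≤ _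
    rw [mul_add, hTd]
    omega
  · simp only [Store.setVar_var, if_true, deg_last]
    show _ + 1 + 1 ≤ _
    omega
  · refine ⟨hsame3.setVar (by omega), by simpa using e22, ?_, ?_, ?_, ?_, ?_⟩
    · simp only [Store.setVar_arr, Store.setVar_var, if_true, e10]
      refine r5.mono fun i hi h => ⟨h, ?_⟩
      by_contra hc
      exact G.last_skip G.arcs a i (by omega) hi h
    · simpa [e10] using r2
    · simpa [e10] using r4
    · by_cases hz : G.last G.arcs a = 0
      · left; simpa using hz
      · right; simpa using ⟨hll, G.last_tl _ a hz⟩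
    · intro v hv
      exact Iff.rfl
  · rintro s' ⟨i1, i2, i3, i4, i5, i6, i7⟩ h0
    have h0' : s'.var 23 = 0 := h0
    refine ⟨⟨i1, ?_⟩, ?_⟩
    · rw [h0'] at i3
      exact i3.mono fun i _ h => absurd h.2 (by omega)
    · have hr := rest_extract (s := s) (s' := s') han r1 i4 (by
        intro v hv hne
        rw [i7 v hv, e10]
        exact r3 v hv hne)
      have : Td * G.deg G.arcs a ≤ (updateTime G.n + 100) * G.deg G.arcs a :=
        Nat.mul_le_mul_right _ (by omega)
      rw [mul_add] at hr
      omega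

/-- A time bound for Dijkstra's algorithm. -/
def dijkstraTime (G : Net) : ℕ := (updateTime G.n + 100) * (G.arcs + 2 * G.n + 1)

theorem wp_dijkstra {s : Store} (hL : G.Loaded s) (hF : G.Fits Γ) (hs : s.var 20 < G.n) :
    wp Γ ω dijkstraProg G.dijkstraTime (fun s' => s.Same 20 10 s' ∧
      ∀ v < G.n, s'.arr 10 v = G.dist (s.var 20) v) s := by
  have hcl := hF.cap_lt
  have h2 := hF.n_cap
  have h3 := hF.big_mul
  have hn := G.n_pos
  have hw := Γ.one_le
  refine wp_seq (T1 := 38 * G.n + 20 + updateTime G.n)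
    (T2 := (updateTime G.n + 100) * (G.arcs + G.n) + 12) ?_
    (wp_mono (wp_init hL hF hs) (le_refl _) ?_)
  · unfold dijkstraTime
    rw [show G.arcs + 2 * G.n + 1 = (G.arcs + G.n) + (G.n + 1) by ring, mul_add _ (_ + _) (_ + 1)]
    nlinarith
  rintro s1 ⟨h4, h5⟩
  refine wp_while (fun s' => s.Same 20 10 s' ∧
      G.DInv (s.var 20) (s'.arr 10) (s'.arr 11) fun _ => False) G.rest ?_ ?_ ?_ ⟨h4, h5⟩ ?_
  · rintro s' ⟨h6, _⟩
    have hL' := hL.same h6 (by omega) (by omega)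
    simp [hL'.n, hL'.big, Layout.Valid]
    omega
  · rintro s' ⟨h6, h7⟩ h8
    have hL' := hL.same h6 (by omega) (by omega)
    have : s'.arr 11 1 < G.big * G.n := by
      by_contra hc
      simp [hL'.n, hL'.big, hc] at h8
    exact wp_settle hL hF hs h6 h7 this
  · show _ + 11 + 1 ≤ _
    have := G.rest_le s1
    omega
  · rintro s' ⟨h6, h7⟩ h8
    have hL' := hL.same h6 (by omega) (by omega)
    refine ⟨h6, h7.final hs ?_⟩
    by_contra hc
    simp [hL'.n, hL'.big, not_le.1 hc] at h8

end Net
end WordRAM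

/-! ### Closest vertices and eccentricities -/

namespace WordRAM

/-- Find a vertex `v` of the side in variable `12` with the least value of `e`, an expression in
the variable `13`; the value and the vertex are left in the variables `14` and `15`. -/
def scanProg (e : Expr) : Prog :=
  Stm.comp (.set 14 (.var 3 + 1) ;; .set 15 0) ;>
  forLoop 13 1 (Stm.comp (.ite (.eq (.rd 6 (.var 13)) (.var 12))
    (.ite (.lt e (.var 14)) (.set 14 e ;; .set 15 (.var 13)) .skip) .skip))

/-- Find the vertex of the side in variable `12` that is closest to the vertex in variable `6`,
and compute the distances from it. -/
def nearProg : Prog :=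
  Stm.comp (.set 20 (.var 6)) ;> dijkstraProg ;> scanProg (.rd 10 (.var 13)) ;>
  Stm.comp (.set 20 (.var 15)) ;> dijkstraProg

/-- Find the vertex of side `1` that is closest to the vertex in variable `6`, and update the least
eccentricity in variable `11`. -/
def exploreProg : Prog :=
  Stm.comp (.set 12 1) ;> nearProg ;> Stm.comp (.set 12 0) ;>
  -- An eccentricity is a maximum while the scan finds minima, so distances are replaced by their
  -- differences from `big`.
  scanProg (.var 3 - .rd 10 (.var 13)) ;>
  Stm.comp (.ite (.lt (.var 3 - .var 14) (.var 11)) (.set 11 (.var 3 - .var 14)) .skip)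

namespace Net

/-- The vertex `u` is a closest one to `x` among the vertices of side `b`. -/
structure Closest (G : Net) (b x u : ℕ) : Prop where
  lt : u < G.n
  side : G.side u = b
  le : ∀ v < G.n, G.side v = b → G.dist x u ≤ G.dist x v

/-- The greatest distance from `u` to a vertex of side `0` is `e`. -/
structure IsEcc (G : Net) (u e : ℕ) : Prop where
  ex : ∃ t < G.n, G.side t = 0 ∧ G.dist u t = e
  le : ∀ t < G.n, G.side t = 0 → G.dist u t ≤ e

variable {w : ℕ} {G : Net} {Γ : Layout w} {ω : Tape w}

/-- The initial value `big + 1` exceeds every `f v`, so at the end it can only mean that the side is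
empty, which `hex` excludes. -/
theorem wp_scan {s : Store} (hL : G.Loaded s) (hF : G.Fits Γ) {e : Expr} (f : ℕ → ℕ)
    (he : ∀ s' v, s.Same 13 12 s' → s'.var 13 = v → v < G.n → e.Safe Γ s' ∧ e.eval s' = f v)
    (hc : e.cost ≤ 20) (hf : ∀ v < G.n, f v ≤ G.big)
    (hex : ∃ v < G.n, G.side v = s.var 12) :
    wp Γ ω (scanProg e) (100 * G.n + 20) (fun s' => s.Same 13 12 s' ∧ ∃ u < G.n,
      G.side u = s.var 12 ∧ s'.var 15 = u ∧ s'.var 14 = f u ∧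
      ∀ v < G.n, G.side v = s.var 12 → f u ≤ f v) s := by
  have hcl := hF.cap_lt
  have h2 := hF.n_cap
  have h3 := hF.two_big
  have hn := G.n_pos
  have hw := Γ.one_le
  have hb : (0 : ℕ) < 2 ^ w := by positivity
  have hv : ∀ k j, 0 < k → k < 16 → (Γ.Valid k j ↔ j < Γ.cap) := fun k j h h' => by
    simp [Layout.Valid, show k ≠ 0 by omega, h']
  set s1 := (s.setVar 14 (G.big + 1)).setVar 15 0 with hs1
  have hsame1 : s.Same 13 12 s1 := ((Store.Same.refl _ _ _).setVar (by omega)).setVar (by omega)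
  refine wp_seq (T1 := 6) (T2 := 100 * G.n + 14) (by omega) (wp_stm _ ?_ (by decide) ?_)
  · simp [hL.big]; omega
  have e1 : (Stm.set 14 (.var 3 + 1) ;; .set 15 0).run s = s1 := by simp [hs1, hL.big]
  rw [e1]
  refine wp_for (N := G.n) (T := 70) (fun k s' => s.Same 13 12 s' ∧
      (∀ v < k, G.side v = s.var 12 → s'.var 14 ≤ f v) ∧ (s'.var 14 = G.big + 1 ∨
        (s'.var 15 < G.n ∧ G.side (s'.var 15) = s.var 12 ∧ s'.var 14 = f (s'.var 15))))
    (by decide) (by decide) (by decide) (by omega) ?_ ?_ ?_ (by omega) ?_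
  · rw [hsame1.var 1 (by omega)]; exact hL.n
  · exact ⟨hsame1.setVar (by omega), fun v hv => absurd hv (by omega), by simp [hs1]⟩
  · rintro k hk s' e2 e3 ⟨h4, h5, h6⟩
    have hL' := hL.same h4 (by omega) (by omega)
    obtain ⟨he1, he2⟩ := he s' k h4 e2 hk
    have h12 : s'.var 12 = s.var 12 := h4.var 12 (by omega)
    refine wp_stm _ ?_ ?_ ?_
    · simp only [Stm.Safe, Expr.safe_eq, Expr.safe_rd, Expr.safe_var, hv 6 _ (by omega) (by omega),
        Expr.eval_var, e2, Expr.safe_lt]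
      simp [he1]
      omega
    · show 1 + 6 + 1 + 1 + (e.cost + 1 + 1 + (e.cost + 1 + 2) + 1 + 1) + 1 + 1 ≤ 70
      omega
    · simp only [Stm.run, Expr.eval_eq, Expr.eval_rd, Expr.eval_var, Expr.eval_lt, e2, he2,
        hL'.side k hk, h12]
      by_cases c1 : G.side k = s.var 12
      · by_cases c2 : f k < s'.var 14
        · simp only [c1, c2, if_true, ne_eq, one_ne_zero, not_false_eq_true, Store.setVar_var, e2]
          refine ⟨by simp, by simpa using e3,
            ((h4.setVar (by omega)).setVar (by omega)).setVar (by omega), ?_, ?_⟩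
          · intro v hv hs
            simp
            by_cases e : v = k
            · rw [e]
            · exact c2.le.trans (h5 v (by omega) hs)
          · right
            simpa using ⟨hk, c1⟩
        · simp only [c1, c2, if_true, ne_eq, one_ne_zero, not_false_eq_true, if_false,
            not_true_eq_false]
          refine ⟨e2, e3, h4.setVar (by omega), ?_, by simpa using h6⟩
          intro v hv hs
          simp
          by_cases e : v = k
          · rw [e]; omega
          · exact h5 v (by omega) hs
      · simp only [c1, if_false, ne_eq, not_true_eq_false]
        refine ⟨e2, e3, h4.setVar (by omega), ?_, by simpa using h6⟩
        intro v hv hs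
        simp
        by_cases e : v = k
        · rw [e] at hs; exact absurd hs c1
        · exact h5 v (by omega) hs
  · rintro s' e2 e3 ⟨h4, h5, h6⟩
    obtain ⟨v0, hv0, hs0⟩ := hex
    refine ⟨h4, ?_⟩
    rcases h6 with h6 | ⟨h6, h7, h8⟩
    · have := h5 v0 hv0 hs0
      have := hf v0 hv0
      omega
    · exact ⟨s'.var 15, h6, h7, rfl, h8, fun v hv hs => h8 ▸ h5 v hv hs⟩

/-- A time bound for `nearProg`. -/
def nearTime (G : Net) : ℕ := 2 * G.dijkstraTime + 100 * G.n + 30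

theorem wp_near {s : Store} (hL : G.Loaded s) (hF : G.Fits Γ) (hs : s.var 6 < G.n)
    (hex : ∃ v < G.n, G.side v = s.var 12) :
    wp Γ ω nearProg G.nearTime (fun s' => s.Same 13 10 s' ∧ ∃ u,
      G.Closest (s.var 12) (s.var 6) u ∧ ∀ v < G.n, s'.arr 10 v = G.dist u v) s := by
  have hv : ∀ k j, 0 < k → k < 16 → (Γ.Valid k j ↔ j < Γ.cap) := fun k j h h' => by
    simp [Layout.Valid, show k ≠ 0 by omega, h']
  have h2 := hF.n_cap
  have hsame0 : s.Same 20 10 (s.setVar 20 (s.var 6)) := (Store.Same.refl _ _ _).setVar (by omega)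
  have hL0 := hL.same hsame0 (by omega) (by omega)
  refine wp_seq (T1 := 2) (T2 := 2 * G.dijkstraTime + 100 * G.n + 28)
    (by unfold nearTime; omega) (wp_stm _ (by simp) (by decide) ?_)
  refine wp_seq (T1 := G.dijkstraTime) (T2 := G.dijkstraTime + 100 * G.n + 28) (by omega)
    (wp_mono (wp_dijkstra hL0 hF (by simpa using hs)) (le_refl _) ?_)
  rintro s1 ⟨h4, h5⟩
  simp only [Stm.run, Expr.eval_var, Store.setVar_var, if_true] at h4 h5
  have hsame1 := hsame0.trans h4
  have hL1 := hL.same hsame1 (by omega) (by omega)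
  have e12 : s1.var 12 = s.var 12 := hsame1.var 12 (by omega)
  refine wp_seq (T1 := 100 * G.n + 20) (T2 := G.dijkstraTime + 8) (by omega)
    (wp_mono (wp_scan hL1 hF (fun v => G.dist (s.var 6) v) ?_ (by decide) ?_ ?_) (le_refl _) ?_)
  · intro s' v hs' e hv'
    simp [hv, e, hs'.arr 10 (by omega), h5 v hv']
    omega
  · exact fun v hv' => (G.dist_lt _ hs _ hv').le
  · rwa [e12]
  rintro s2 ⟨h6, u, hu, q1, q2, q3, q4⟩
  rw [e12] at q1 q4
  have hsame2 : s.Same 13 10 s2 :=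
    (hsame1.mono (by omega) (by omega)).trans (h6.mono (by omega) (by omega))
  refine wp_seq (T1 := 2) (T2 := G.dijkstraTime) (by omega) (wp_stm _ (by simp) (by decide) ?_)
  have hsame3 : s.Same 13 10 (s2.setVar 20 u) := hsame2.setVar (by omega)
  simp only [Stm.run, Expr.eval_var, q2]
  refine wp_mono (wp_dijkstra (hL.same hsame3 (by omega) (by omega)) hF (by simpa using hu))
    (le_refl _) ?_
  rintro s4 ⟨h7, h8⟩
  refine ⟨hsame3.trans (h7.mono (by omega) (by omega)), u, ⟨hu, q1, q4⟩, ?_⟩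
  simpa using h8

/-- A time bound for `exploreProg`. -/
def exploreTime (G : Net) : ℕ := G.nearTime + 100 * G.n + 60

theorem wp_explore {s : Store} (hL : G.Loaded s) (hF : G.Fits Γ) (hs : s.var 6 < G.n)
    (h1 : ∃ v < G.n, G.side v = 1) (h0 : ∃ v < G.n, G.side v = 0) :
    wp Γ ω exploreProg G.exploreTime (fun s' => s.Same 11 10 s' ∧ ∃ u e,
      G.Closest 1 (s.var 6) u ∧ G.IsEcc u e ∧ s'.var 11 = min (s.var 11) e) s := by
  have hv : ∀ k j, 0 < k → k < 16 → (Γ.Valid k j ↔ j < Γ.cap) := fun k j h h' => by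
    simp [Layout.Valid, show k ≠ 0 by omega, h']
  have h2 := hF.n_cap
  have hw := Γ.one_le
  have hb : (0 : ℕ) < 2 ^ w := by positivity
  set s0 := s.setVar 12 1 with hs0
  have hsame0 : s.Same 12 10 s0 := (Store.Same.refl _ _ _).setVar (by omega)
  have hL0 := hL.same hsame0 (by omega) (by omega)
  refine wp_seq (T1 := 2) (T2 := G.nearTime + 100 * G.n + 58)
    (by unfold exploreTime; omega) (wp_stm _ (by simp; omega) (by decide) ?_)
  have e0 : (Stm.set 12 1).run s = s0 := by simp [hs0]
  rw [e0]
  refine wp_seq (T1 := G.nearTime) (T2 := 100 * G.n + 58) (by omega)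
    (wp_mono (wp_near hL0 hF (by simpa [hs0] using hs) (by simpa [hs0] using h1)) (le_refl _) ?_)
  rintro s1 ⟨h4, u, hu, h5⟩
  have e6 : s0.var 6 = s.var 6 := by simp [hs0]
  have e12 : s0.var 12 = 1 := by simp [hs0]
  rw [e6, e12] at hu
  set s2 := s1.setVar 12 0 with hs2
  have hsame2 : s.Same 12 10 s2 := (hsame0.trans (h4.mono (by omega) (by omega))).setVar (by omega)
  have hL2 := hL.same hsame2 (by omega) (by omega)
  refine wp_seq (T1 := 2) (T2 := 100 * G.n + 56) (by omega) (wp_stm _ (by simp) (by decide) ?_)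
  have e1 : (Stm.set 12 0).run s1 = s2 := by simp [hs2]
  rw [e1]
  have e12' : s2.var 12 = 0 := by simp [hs2]
  refine wp_seq (T1 := 100 * G.n + 20) (T2 := 36) (by omega)
    (wp_mono (wp_scan hL2 hF (fun v => G.big - G.dist u v) ?_ (by decide) ?_ ?_) (le_refl _) ?_)
  · intro s' v hs' e hv'
    have e3 : s'.var 3 = G.big := (hL2.same hs' (by omega) (by omega)).big
    have e10 : s'.arr 10 v = G.dist u v := by rw [hs'.arr 10 (by omega)]; simp [hs2, h5 v hv']
    have := G.dist_lt u hu.lt v hv'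
    simp [hv, e, e3, e10]
    omega
  · intro v _; simp
  · rwa [e12']
  rintro s3 ⟨h6, t, ht, q1, q2, q3, q4⟩
  rw [e12'] at q1 q4
  have hsame3 : s.Same 11 10 s3 :=
    (hsame2.mono (by omega) (by omega)).trans (h6.mono (by omega) (by omega))
  have e3 : s3.var 3 = G.big := (hL.same hsame3 (by omega) (by omega)).big
  have e11 : s3.var 11 = s.var 11 :=
    (h6.var 11 (by omega)).trans (hsame2.var 11 (by omega))
  have hdt := G.dist_lt u hu.lt t ht
  have hsub : G.big - (G.big - G.dist u t) = G.dist u t := by omega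
  refine wp_stm _ ?_ (by decide) ?_
  · simp [e3, q3]
  have hecc : G.IsEcc u (G.dist u t) := by
    refine ⟨⟨t, ht, q1, rfl⟩, fun t' ht' hs' => ?_⟩
    have := q4 t' ht' hs'
    have := G.dist_lt u hu.lt t' ht'
    omega
  simp only [Stm.run, Expr.eval_lt, Expr.eval_sub, Expr.eval_var, e3, q3, e11, hsub]
  by_cases c : G.dist u t < s.var 11
  · simp only [c, if_true, ne_eq, one_ne_zero, not_false_eq_true]
    exact ⟨hsame3.setVar (by omega), u, _, hu, hecc, by simpa using c.le⟩
  · simp only [c, if_false, ne_eq, not_true_eq_false]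
    exact ⟨hsame3, u, _, hu, hecc, by rw [e11]; omega⟩

end Net
end WordRAM

/-! ### Random samples and the distances from them -/

namespace WordRAM

/-- Update the maxima in the arrays `7` and `8` with the distances in the array `10` and their
differences from the variable `3`. -/
def foldProg : Prog :=
  forLoop 9 1 (Stm.comp (
    .ite (.lt (.rd 7 (.var 9)) (.rd 10 (.var 9))) (.wr 7 (.var 9) (.rd 10 (.var 9))) .skip ;;
    .ite (.lt (.rd 8 (.var 9)) (.var 3 - .rd 10 (.var 9)))
      (.wr 8 (.var 9) (.var 3 - .rd 10 (.var 9))) .skip))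

/-- Draw random arcs, compute the distances from the vertices of side `0` that are closest to their
tails, and take the maxima of these distances. -/
def sampleProg : Prog :=
  -- Tails of random arcs are drawn, not random vertices, since the search phase is limited in the
  -- number of arcs it can try.
  forLoop 5 4 (Prog.rand 6 ;> Stm.comp (.set 6 (.rd 1 (.var 6 % .var 2)) ;; .set 12 0) ;>
    nearProg ;> foldProg)

namespace Net
variable {w : ℕ} {G : Net} {Γ : Layout w} {ω : Tape w}

theorem wp_fold {s : Store} (hL : G.Loaded s) (hF : G.Fits Γ) {u : ℕ} (hu : u < G.n)
    (h10 : ∀ v < G.n, s.arr 10 v = G.dist u v) :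
    wp Γ ω foldProg (G.n * 80 + 6) (fun s' => s.Same 9 7 s' ∧
      (∀ v < G.n, s'.arr 7 v = max (s.arr 7 v) (G.dist u v)) ∧
      ∀ v < G.n, s'.arr 8 v = max (s.arr 8 v) (G.big - G.dist u v)) s := by
  have hv : ∀ k j, 0 < k → k < 16 → (Γ.Valid k j ↔ j < Γ.cap) := fun k j h h' => by
    simp [Layout.Valid, show k ≠ 0 by omega, h']
  have h1 := hF.cap_lt
  have h2 := hF.n_cap
  refine wp_for (N := G.n) (T := 70) (fun k s' => s.Same 9 7 s' ∧ s'.arr 10 = s.arr 10 ∧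
      (∀ v < G.n, s'.arr 7 v = if v < k then max (s.arr 7 v) (G.dist u v) else s.arr 7 v) ∧
      ∀ v < G.n, s'.arr 8 v = if v < k then max (s.arr 8 v) (G.big - G.dist u v) else s.arr 8 v)
    (by decide) (by decide) (by decide) (by omega) hL.n ?_ ?_ (by omega) ?_
  · exact ⟨(Store.Same.refl _ _ _).setVar (by omega), rfl, fun v _ => by simp, fun v _ => by simp⟩
  · rintro k hk s' e1 e2 ⟨h4, h5, h6, h7⟩
    have e3 : s'.var 3 = G.big := (hL.same h4 (by omega) (by omega)).big
    have hlt := G.dist_lt u hu k hk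
    have e7 := h6 k hk
    have e8 := h7 k hk
    rw [if_neg (by omega)] at e7 e8
    refine wp_stm _ ?_ (by decide) ?_
    · simp only [Stm.Safe, Stm.run, Expr.eval_lt, Expr.eval_sub, Expr.eval_rd, Expr.eval_var, e1,
        h5, h10 k hk, e7]
      by_cases c1 : s.arr 7 k < G.dist u k
      · simp [hv, c1, e1, e3, h5, h10 k hk]; omega
      · simp [hv, c1, e1, e3, h5, h10 k hk]; omega
    · have er : (Stm.ite (.lt (.rd 7 (.var 9)) (.rd 10 (.var 9)))
          (.wr 7 (.var 9) (.rd 10 (.var 9))) .skip ;;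
          .ite (.lt (.rd 8 (.var 9)) (.var 3 - .rd 10 (.var 9)))
            (.wr 8 (.var 9) (.var 3 - .rd 10 (.var 9))) .skip).run s' =
          (s'.setArr 7 k (max (s.arr 7 k) (G.dist u k))).setArr 8 k
            (max (s.arr 8 k) (G.big - G.dist u k)) := by
        have u7 : ∀ x : Store, x.setArr 7 k (x.arr 7 k) = x := fun x => by
          simp [Store.setArr]
        have u8 : ∀ x : Store, x.setArr 8 k (x.arr 8 k) = x := fun x => by
          simp [Store.setArr]
        have a1 : (Stm.ite (.lt (.rd 7 (.var 9)) (.rd 10 (.var 9)))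
          (.wr 7 (.var 9) (.rd 10 (.var 9))) .skip).run s' =
            s'.setArr 7 k (max (s.arr 7 k) (G.dist u k)) := by
          by_cases c : s.arr 7 k < G.dist u k
          · simp [e1, e7, h5, h10 k hk, c, max_eq_right c.le]
          · simp [e1, e7, h5, h10 k hk, c, max_eq_left (not_lt.1 c)]
            rw [← e7, u7]
        rw [Stm.run, a1]
        set x := s'.setArr 7 k (max (s.arr 7 k) (G.dist u k)) with hx
        have x9 : x.var 9 = k := by simp [hx, e1]
        have x3 : x.var 3 = G.big := by simp [hx, e3]
        have x8 : x.arr 8 k = s.arr 8 k := by simp [hx, e8]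
        have x10 : x.arr 10 k = G.dist u k := by simp [hx, h5, h10 k hk]
        by_cases c : s.arr 8 k < G.big - G.dist u k
        · simp [x9, x3, x8, x10, c, max_eq_right c.le]
        · simp only [Stm.run, Expr.eval_lt, Expr.eval_sub, Expr.eval_rd, Expr.eval_var, x9, x3,
            x8, x10, c, if_false, ne_eq, not_true_eq_false, max_eq_left (not_lt.1 c)]
          rw [← x8, u8]
      rw [er]
      refine ⟨by simpa using e1, by simpa using e2,
        ((h4.setArr (by omega)).setArr (by omega)).setVar (by omega), by simpa using h5, ?_, ?_⟩
      · intro v hv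
        by_cases e : v = k
        · subst e; simp
        · simp only [Store.setVar_arr, Store.setArr_arr]
          simp [e, h6 v hv, show v < k + 1 ↔ v < k by omega]
      · intro v hv
        by_cases e : v = k
        · subst e; simp
        · simp only [Store.setVar_arr, Store.setArr_arr]
          simp [e, h7 v hv, show v < k + 1 ↔ v < k by omega]
  · rintro s' e1 e2 ⟨h4, h5, h6, h7⟩
    refine ⟨h4, fun v hv => ?_, fun v hv => ?_⟩
    · rw [h6 v hv, if_pos hv]
    · rw [h7 v hv, if_pos hv]

/-- The store `s` with the number of random words that have been used increased by `k`. -/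
def _root_.WordRAM.Store.use (s : Store) (k : ℕ) : Store := { s with used := s.used + k }

/-- The tail of the random arc given by the word number `i` of the tape. -/
def sample (G : Net) (ω : Tape w) (i : ℕ) : ℕ := G.tl ((ω i : ℕ) % G.arcs)

/-- A time bound for an iteration of `sampleProg`. -/
def sampleTime (G : Net) : ℕ := G.nearTime + 80 * G.n + 30

/-- The array `7` gives the distance to the farthest sample. The array `8` gives `big` minus the
distance to the nearest one, so that both are maxima and can start from cleared memory. -/
theorem wp_sample {s : Store} (hL : G.Loaded s) (hF : G.Fits Γ) (ha : 0 < G.arcs) {K : ℕ}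
    (hK : s.var 4 = K) (hK2 : K < 2 ^ w) (h0 : ∃ v < G.n, G.side v = 0)
    (h7 : ∀ v < G.n, s.arr 7 v = 0) (h8 : ∀ v < G.n, s.arr 8 v = 0) (hused : s.used = 0) :
    wp Γ ω sampleProg (K * (G.sampleTime + 8) + 6) (fun s' => (s.use K).Same 5 7 s' ∧
      ∃ y : ℕ → ℕ, (∀ i < K, G.Closest 0 (G.sample ω i) (y i)) ∧
      (∀ v < G.n, s'.arr 7 v = (Finset.range K).sup fun i => G.dist (y i) v) ∧
      ∀ v < G.n, s'.arr 8 v = (Finset.range K).sup fun i => G.big - G.dist (y i) v) s := by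
  have hv : ∀ k j, 0 < k → k < 16 → (Γ.Valid k j ↔ j < Γ.cap) := fun k j h h' => by
    simp [Layout.Valid, show k ≠ 0 by omega, h']
  have h1 := hF.cap_lt
  have h2 := hF.arcs_cap
  have hb : (0 : ℕ) < 2 ^ w := by positivity
  refine wp_for (N := K) (T := G.sampleTime) (fun k s' => (s.use k).Same 5 7 s' ∧
      ∃ y : ℕ → ℕ, (∀ i < k, G.Closest 0 (G.sample ω i) (y i)) ∧
      (∀ v < G.n, s'.arr 7 v = (Finset.range k).sup fun i => G.dist (y i) v) ∧
      ∀ v < G.n, s'.arr 8 v = (Finset.range k).sup fun i => G.big - G.dist (y i) v)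
    (by decide) (by decide) (by decide) hK2 hK ?_ ?_ (le_refl _) ?_
  · refine ⟨(Store.Same.refl _ _ _).setVar (by omega), fun _ => 0, fun i hi => absurd hi (by omega),
      ?_, ?_⟩
    · simpa using h7
    · simpa using h8
  · rintro k hk s' e1 e2 ⟨h4, y, hy, hy7, hy8⟩
    have hu : s'.used = k := by rw [h4.used]; simp [Store.use, hused]
    refine wp_seq (T1 := 1) (T2 := G.sampleTime - 1) (by unfold sampleTime; omega)
      (wp_rand (by decide) (le_refl _) ?_)
    set s1 : Store := { s'.setVar 6 (ω s'.used : ℕ) with used := s'.used + 1 } with hs1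
    have hsame1 : (s.use (k + 1)).Same 5 7 s1 := by
      refine ⟨fun x hx => ?_, h4.arr, ?_⟩
      · have : s1.var x = (s'.setVar 6 (ω s'.used : ℕ)).var x := rfl
        rw [this, Store.setVar_var, if_neg (by omega)]
        exact h4.var x hx
      · show s'.used + 1 = s.used + (k + 1)
        omega
    have hj : (ω k : ℕ) % G.arcs < G.arcs := Nat.mod_lt _ ha
    have e6 : s1.var 6 = ω k := by
      show (s'.setVar 6 (ω s'.used : ℕ)).var 6 = _
      simp [hu]
    have e5 : s1.var 5 = k := by
      show (s'.setVar 6 (ω s'.used : ℕ)).var 5 = _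
      simp [e1]
    have a2 : s1.var 2 = G.arcs := by rw [hsame1.var 2 (by omega)]; exact hL.arcs
    have a1 : ∀ j < G.arcs, s1.arr 1 j = G.tl j := by
      rw [hsame1.arr 1 (by omega)]; exact hL.tl
    refine wp_seq (T1 := 12) (T2 := G.nearTime + 80 * G.n + 16) (by unfold sampleTime; omega)
      (wp_stm _ ?_ (by decide) ?_)
    · simp [hv, a2, e6]; omega
    set s2 := (s1.setVar 6 (G.sample ω k)).setVar 12 0 with hs2
    have e : (Stm.set 6 (.rd 1 (.var 6 % .var 2)) ;; .set 12 0).run s1 = s2 := by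
      simp [hs2, a2, e6, a1 _ hj, sample]
    rw [e]
    have hsame2 : (s.use (k + 1)).Same 5 7 s2 := (hsame1.setVar (by omega)).setVar (by omega)
    have hL2 : G.Loaded s2 := by
      have hsame2' : s.Same 5 7 { s2 with used := s.used } :=
        ⟨hsame2.var, hsame2.arr, rfl⟩
      have := hL.same hsame2' (by omega) (by omega)
      exact ⟨this.n, this.arcs, this.big, this.tl, this.hd, this.wt, this.next, this.first,
        this.side⟩
    have b6 : s2.var 6 = G.sample ω k := by simp [hs2]
    have b12 : s2.var 12 = 0 := by simp [hs2]
    refine wp_seq (T1 := G.nearTime) (T2 := G.n * 80 + 6) (by omega)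
      (wp_mono (wp_near hL2 hF (by rw [b6]; exact G.tl_lt _ hj) (by rwa [b12])) (le_refl _) ?_)
    rintro s3 ⟨q1, u, q2, q3⟩
    rw [b6, b12] at q2
    have hL3 := hL2.same q1 (by omega) (by omega)
    refine wp_mono (wp_fold hL3 hF q2.lt q3) (le_refl _) ?_
    rintro s4 ⟨r1, r2, r3⟩
    have hsame24 : s2.Same 9 7 s4 := (q1.mono (by omega) (by omega)).trans r1
    have e7 : s2.arr 7 = s'.arr 7 := by simp [hs2, hs1]
    have e8 : s2.arr 8 = s'.arr 8 := by simp [hs2, hs1]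
    refine ⟨?_, ?_, ?_, Function.update y k u, ?_, ?_, ?_⟩
    · rw [hsame24.var 5 (by omega)]; simp [hs2, e5]
    · rw [hsame24.var 4 (by omega), hsame2.var 4 (by omega)]; exact hK
    · exact (hsame2.trans (hsame24.mono (by omega) (by omega))).setVar (by omega)
    · intro i hi
      by_cases e : i = k
      · rw [e, Function.update_self]; exact q2
      · rw [Function.update_of_ne e]; exact hy i (by omega)
    · intro v hv
      rw [Store.setVar_arr, r2 v hv, q1.arr 7 (by omega), e7, hy7 v hv, Finset.range_add_one,
        Finset.sup_insert, Function.update_self, max_comm]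
      show max _ _ = max _ _
      congr 1
      refine Finset.sup_congr rfl fun i hi => ?_
      rw [Function.update_of_ne (Finset.mem_range.1 hi).ne]
    · intro v hv
      rw [Store.setVar_arr, r3 v hv, q1.arr 8 (by omega), e8, hy8 v hv, Finset.range_add_one,
        Finset.sup_insert, Function.update_self, max_comm]
      show max _ _ = max _ _
      congr 1
      refine Finset.sup_congr rfl fun i hi => ?_
      rw [Function.update_of_ne (Finset.mem_range.1 hi).ne]
  · rintro s' _ _ ⟨h4, y, h5⟩
    exact ⟨h4, y, h5⟩

end Net
end WordRAM

/-! ### The farthest vertex and the search around it -/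

namespace WordRAM

/-- Find the vertex of side `0` with the least entry in the array `8`, and compute the distances
from it, doubled for the vertices of side `1`, into the array `9`. -/
def pickProg : Prog :=
  Stm.comp (.set 12 0) ;> scanProg (.rd 8 (.var 13)) ;>
  Stm.comp (.set 7 (.var 3 - .var 14) ;; .set 20 (.var 15)) ;> dijkstraProg ;>
  forLoop 9 1 (Stm.comp (.wr 9 (.var 9) (.rd 10 (.var 9) * (1 + .rd 6 (.var 9)))))

/-- Explore the head of the arc in variable `9` if its tail has an entry in the array `9` that is
less than the variable `7`, and if fewer than `K` arcs have been explored. -/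
def searchStep : Prog :=
  whenProg (.lt (.rd 9 (.rd 1 (.var 9))) (.var 7)) (whenProg (.lt (.var 8) (.var 4))
    (Stm.comp (.set 8 (.var 8 + 1) ;; .set 6 (.rd 2 (.var 9))) ;> exploreProg))

/-- Explore the vertex of side `1` with the least entry in the array `7`, and then the heads of the
arcs whose tails have entries in the array `9` that are less than the variable `7`. -/
def searchProg : Prog :=
  Stm.comp (.set 11 (.var 3) ;; .set 12 1) ;> scanProg (.rd 7 (.var 13)) ;>
  Stm.comp (.set 6 (.var 15) ;; .set 8 0) ;> exploreProg ;> forLoop 9 2 searchStep ;>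
  Stm.comp (.set 0 (.var 11))

namespace Net

/-- The number `b` is at most the eccentricity of a vertex of side `1` closest to `f`. -/
def Explored (G : Net) (f b : ℕ) : Prop := ∃ u e, G.Closest 1 f u ∧ G.IsEcc u e ∧ b ≤ e

/-- The number `b` is the eccentricity of a vertex of side `1`, or `G.big`. -/
def Attained (G : Net) (b : ℕ) : Prop := b = G.big ∨ ∃ u < G.n, G.side u = 1 ∧ G.IsEcc u b

/-- The number of arcs below `k` whose tails have values less than `r`. -/
def light (G : Net) (κ : ℕ → ℕ) (r k : ℕ) : ℕ :=
  ((Finset.range k).filter fun j => κ (G.tl j) < r).card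

variable {w : ℕ} {G : Net} {Γ : Layout w} {ω : Tape w}

theorem light_succ (κ : ℕ → ℕ) (r k : ℕ) :
    G.light κ r (k + 1) = G.light κ r k + if κ (G.tl k) < r then 1 else 0 := by
  unfold light
  rw [Finset.range_add_one, Finset.filter_insert]
  split_ifs with h
  · rw [Finset.card_insert_of_notMem (by simp)]
  · rfl

theorem Explored.mono {f b b' : ℕ} (h : G.Explored f b) (hb : b' ≤ b) : G.Explored f b' := by
  obtain ⟨u, e, h1, h2, h3⟩ := h
  exact ⟨u, e, h1, h2, hb.trans h3⟩

theorem Attained.min {b u e : ℕ} (h : G.Attained b) (hu : u < G.n) (hs : G.side u = 1)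
    (he : G.IsEcc u e) : G.Attained (Min.min b e) := by
  rcases min_choice b e with h1 | h1 <;> rw [h1]
  · exact h
  · exact Or.inr ⟨u, hu, hs, he⟩

/-- A time bound for `pickProg`. -/
def pickTime (G : Net) : ℕ := G.dijkstraTime + 200 * G.n + 50

theorem wp_pick {s : Store} (hL : G.Loaded s) (hF : G.Fits Γ)
    (h0 : ∃ v < G.n, G.side v = 0) (h8 : ∀ v < G.n, s.arr 8 v ≤ G.big) :
    wp Γ ω pickProg G.pickTime (fun s' => s.Same 7 9 s' ∧ ∃ t < G.n, G.side t = 0 ∧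
      (∀ v < G.n, G.side v = 0 → s.arr 8 t ≤ s.arr 8 v) ∧ s'.var 7 = G.big - s.arr 8 t ∧
      ∀ v < G.n, s'.arr 9 v = G.dist t v * (1 + G.side v)) s := by
  have hv : ∀ k j, 0 < k → k < 16 → (Γ.Valid k j ↔ j < Γ.cap) := fun k j h h' => by
    simp [Layout.Valid, show k ≠ 0 by omega, h']
  have h1 := hF.cap_lt
  have h2 := hF.n_cap
  have h3 := hF.two_big
  have hb : (0 : ℕ) < 2 ^ w := by positivity
  have hw := Γ.one_le
  set s1 := s.setVar 12 0 with hs1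
  have hsame1 : s.Same 12 10 s1 := (Store.Same.refl _ _ _).setVar (by omega)
  have hL1 := hL.same hsame1 (by omega) (by omega)
  have e12 : s1.var 12 = 0 := by simp [hs1]
  refine wp_seq (T1 := 2) (T2 := G.dijkstraTime + 200 * G.n + 48)
    (by unfold pickTime; omega) (wp_stm _ (by simp) (by decide) ?_)
  have e1 : (Stm.set 12 0).run s = s1 := by simp [hs1]
  rw [e1]
  refine wp_seq (T1 := 100 * G.n + 20) (T2 := G.dijkstraTime + 100 * G.n + 28) (by omega)
    (wp_mono (wp_scan hL1 hF (fun v => s.arr 8 v) ?_ (by decide) h8 (by rwa [e12])) (le_refl _) ?_)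
  · intro s' v hs' e hv'
    simp [hv, e, hs'.arr 8 (by omega), hs1]
    omega
  rintro s2 ⟨h4, t, ht, q1, q2, q3, q4⟩
  rw [e12] at q1 q4
  have hsame2 : s.Same 12 10 s2 := hsame1.trans (h4.mono (by omega) (by omega))
  have e3 : s2.var 3 = G.big := by rw [hsame2.var 3 (by omega)]; exact hL.big
  set s3 := (s2.setVar 7 (G.big - s.arr 8 t)).setVar 20 t with hs3
  have hsame3 : s.Same 7 10 s3 :=
    ((hsame2.mono (by omega) (by omega)).setVar (by omega)).setVar (by omega)
  refine wp_seq (T1 := 8) (T2 := G.dijkstraTime + 100 * G.n + 20) (by omega)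
    (wp_stm _ ?_ (by decide) ?_)
  · simp [q3, e3, h8 t ht]
  have e2 : (Stm.set 7 (.var 3 - .var 14) ;; .set 20 (.var 15)).run s2 = s3 := by
    simp [hs3, q2, q3, e3]
  rw [e2]
  have hL3 := hL.same hsame3 (by omega) (by omega)
  have e20 : s3.var 20 = t := by simp [hs3]
  refine wp_seq (T1 := G.dijkstraTime) (T2 := 100 * G.n + 20) (by omega)
    (wp_mono (wp_dijkstra hL3 hF (by rwa [e20])) (le_refl _) ?_)
  rintro s4 ⟨h5, h6⟩
  rw [e20] at h6
  have hsame4 : s.Same 7 10 s4 := hsame3.trans (h5.mono (by omega) (by omega))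
  have hL4 := hL.same hsame4 (by omega) (by omega)
  have e7 : s4.var 7 = G.big - s.arr 8 t := by rw [h5.var 7 (by omega)]; simp [hs3]
  refine wp_for (N := G.n) (T := 40) (fun k s' => s.Same 7 9 s' ∧ s'.var 7 = G.big - s.arr 8 t ∧
      s'.arr 10 = s4.arr 10 ∧ ∀ v < k, s'.arr 9 v = G.dist t v * (1 + G.side v))
    (by decide) (by decide) (by decide) (by omega) hL4.n ?_ ?_ (by omega) ?_
  · exact ⟨(hsame4.mono (by omega) (by omega)).setVar (by omega), by simpa using e7, rfl,
      fun v hv => absurd hv (by omega)⟩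
  · rintro k hk s' c1 c2 ⟨d1, d2, d3, d4⟩
    have hL' := hL.same d1 (by omega) (by omega)
    have hside := hL'.side k hk
    have hdt := G.dist_lt t ht k hk
    have hs1 := G.side_le k hk
    have hmul : G.dist t k * (1 + G.side k) ≤ G.dist t k * 2 :=
      Nat.mul_le_mul_left _ (by omega)
    refine wp_stm _ ?_ (by decide) ?_
    · simp [hv, c1, d3, h6 k hk, hside]
      omega
    · have er : (Stm.wr 9 (.var 9) (.rd 10 (.var 9) * (1 + .rd 6 (.var 9)))).run s' =
          s'.setArr 9 k (G.dist t k * (1 + G.side k)) := by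
        simp [c1, d3, h6 k hk, hside]
      rw [er]
      refine ⟨by simpa using c1, by simpa using c2, (d1.setArr (by omega)).setVar (by omega),
        by simpa using d2, by simpa using d3, ?_⟩
      intro v hv'
      by_cases e : v = k
      · subst e; simp
      · simp [e, d4 v (by omega)]
  · rintro s' c1 c2 ⟨d1, d2, d3, d4⟩
    exact ⟨d1, t, ht, q1, q4, d2, d4⟩

/-- A time bound for `searchProg`. -/
def searchTime (G : Net) (K : ℕ) : ℕ :=
  (K + 1) * (G.exploreTime + 12) + 100 * G.n + 30 * G.arcs + 50

/-- The cap `K` guarantees the running time for every tape. The claim about heads of light arcs is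
made only if the cap is not exceeded, which the samples make likely when it matters. -/
theorem wp_search {s : Store} (hL : G.Loaded s) (hF : G.Fits Γ) {f κ : ℕ → ℕ} {K r : ℕ}
    (h0 : ∃ v < G.n, G.side v = 0) (h1 : ∃ v < G.n, G.side v = 1)
    (h7 : ∀ v < G.n, s.arr 7 v = f v) (hf : ∀ v < G.n, f v ≤ G.big)
    (h9 : ∀ v < G.n, s.arr 9 v = κ v) (hr : s.var 7 = r) (hK : s.var 4 = K)
    (hK2 : K < 2 ^ w) :
    wp Γ ω searchProg (G.searchTime K) (fun s' => G.Attained (s'.var 0) ∧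
      (∃ c < G.n, G.side c = 1 ∧ (∀ v < G.n, G.side v = 1 → f c ≤ f v) ∧
        G.Explored c (s'.var 0)) ∧
      (G.light κ r G.arcs ≤ K → ∀ j < G.arcs, κ (G.tl j) < r → G.Explored (G.hd j) (s'.var 0)))
      s := by
  have hv : ∀ k j, 0 < k → k < 16 → (Γ.Valid k j ↔ j < Γ.cap) := fun k j h h' => by
    simp [Layout.Valid, show k ≠ 0 by omega, h']
  have hcl := hF.cap_lt
  have h2 := hF.n_cap
  have h2' := hF.arcs_cap
  have h3 := hF.two_big
  have hb : (0 : ℕ) < 2 ^ w := by positivity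
  have hw := Γ.one_le
  set s1 := (s.setVar 11 G.big).setVar 12 1 with hs1
  have hsame1 : s.Same 11 10 s1 := ((Store.Same.refl _ _ _).setVar (by omega)).setVar (by omega)
  have hL1 := hL.same hsame1 (by omega) (by omega)
  have e12 : s1.var 12 = 1 := by simp [hs1]
  refine wp_seq (T1 := 4) (T2 := G.searchTime K - 4)
    (by unfold searchTime; omega) (wp_stm _ (by simp; omega) (by decide) ?_)
  have e1 : (Stm.set 11 (.var 3) ;; .set 12 1).run s = s1 := by simp [hs1, hL.big]
  rw [e1]
  refine wp_seq (T1 := 100 * G.n + 20)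
    (T2 := (K + 1) * (G.exploreTime + 12) + 30 * G.arcs + 26) (by unfold searchTime; omega)
    (wp_mono (wp_scan hL1 hF f ?_ (by decide) hf (by rwa [e12])) (le_refl _) ?_)
  · intro s' v hs' e hv'
    simp [hv, e, hs'.arr 7 (by omega), hs1, h7 v hv']
    omega
  rintro s2 ⟨h4, c, hc, q1, q2, q3, q4⟩
  rw [e12] at q1 q4
  have hsame2 : s.Same 11 10 s2 := hsame1.trans (h4.mono (by omega) (by omega))
  have e11 : s2.var 11 = G.big := by rw [h4.var 11 (by omega)]; simp [hs1]
  set s3 := (s2.setVar 6 c).setVar 8 0 with hs3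
  refine wp_seq (T1 := 4) (T2 := (K + 1) * (G.exploreTime + 12) + 30 * G.arcs + 22) (by omega)
    (wp_stm _ (by simp) (by decide) ?_)
  have e2 : (Stm.set 6 (.var 15) ;; .set 8 0).run s2 = s3 := by simp [hs3, q2]
  rw [e2]
  have hsame3 : s.Same 6 10 s3 :=
    ((hsame2.mono (by omega) (by omega)).setVar (by omega)).setVar (by omega)
  have hL3 := hL.same hsame3 (by omega) (by omega)
  refine wp_seq (T1 := G.exploreTime) (T2 := K * (G.exploreTime + 12) + 30 * G.arcs + 30)
    (by rw [add_mul]; omega)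
    (wp_mono (wp_explore hL3 hF (by simpa [hs3] using hc) h1 h0) (le_refl _) ?_)
  rintro s4 ⟨h5, u, e, h6, h8, h10⟩
  have e11' : s4.var 11 = min G.big e := by rw [h10]; simp [hs3, e11]
  have e6 : s3.var 6 = c := by simp [hs3]
  rw [e6] at h6
  have hsame4 : s.Same 6 10 s4 := hsame3.trans (h5.mono (by omega) (by omega))
  have hL4 := hL.same hsame4 (by omega) (by omega)
  have e7 : s4.var 7 = r := by
    rw [h5.var 7 (by omega)]
    simp [hs3, hsame2.var 7 (by omega), hr]
  have e8 : s4.var 8 = 0 := by rw [h5.var 8 (by omega)]; simp [hs3]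
  refine wp_seq (T1 := K * (G.exploreTime + 12) + 30 * G.arcs + 6) (T2 := 2) (by omega)
    (wp_for_amortized (N := G.arcs) (T := 22) (fun k s' => s.Same 6 10 s' ∧ s'.var 7 = r ∧
      s'.var 8 = min K (G.light κ r k) ∧ G.Attained (s'.var 11) ∧ G.Explored c (s'.var 11) ∧
      (G.light κ r k ≤ K → ∀ j < k, κ (G.tl j) < r → G.Explored (G.hd j) (s'.var 11)))
    -- Explorations that are still allowed, each with its time and the overhead beyond a mere test.
    (fun s' => (K - s'.var 8) * (G.exploreTime + 12))
    (by decide) (by decide) (by decide) (by omega) hL4.arcs ?_ ?_ ?_ ?_ ?_)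
  · intro s' v
    simp
  · refine ⟨hsame4.setVar (by omega), by simpa using e7, by simp [e8, light], ?_, ?_, ?_⟩
    · simp only [Store.setVar_var, if_neg (show (11 : ℕ) ≠ 9 by omega), e11']
      exact Attained.min (Or.inl rfl) h6.lt h6.side h8
    · simp only [Store.setVar_var, if_neg (show (11 : ℕ) ≠ 9 by omega), e11']
      exact ⟨u, e, h6, h8, min_le_right _ _⟩
    · exact fun _ j hj => absurd hj (by omega)
  · rintro k hk s' c1 c2 ⟨d1, d2, d3, d4, d5, d6⟩
    have hL' := hL.same d1 (by omega) (by omega)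
    have hK' : s'.var 4 = K := by rw [d1.var 4 (by omega), hK]
    have h9' : s'.arr 9 (G.tl k) = κ (G.tl k) := by
      rw [d1.arr 9 (by omega)]; exact h9 _ (G.tl_lt k hk)
    have hls := G.light_succ κ r k
    have htl := G.tl_lt k hk
    have hhd := G.hd_lt k hk
    have hsafe : (Expr.lt (.rd 9 (.rd 1 (.var 9))) (.var 7)).Safe Γ s' := by
      simp [hv, c1, hL'.tl k hk]
      omega
    by_cases hl : κ (G.tl k) < r
    · rw [if_pos hl] at hls
      have heval : (Expr.lt (.rd 9 (.rd 1 (.var 9))) (.var 7)).eval s' ≠ 0 := by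
        simp [c1, hL'.tl k hk, h9', d2, hl]
      by_cases hfull : s'.var 8 < K
      · refine ⟨G.exploreTime + 34, wp_mono (wp_when (T := G.exploreTime + 17) hsafe
          (fun _ => wp_mono (wp_when (T := G.exploreTime + 12)
            (Q := fun s'' => s''.var 9 = k ∧ s''.var 2 = G.arcs ∧ s.Same 6 10 s'' ∧
              s''.var 7 = r ∧ s''.var 8 = s'.var 8 + 1 ∧
              ∃ u e, G.Closest 1 (G.hd k) u ∧ G.IsEcc u e ∧ s''.var 11 = min (s'.var 11) e)
            ?_ (fun _ => ?_) ?_) (le_refl _) fun _ h => h)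
          fun h => absurd h heval) (le_refl _) ?_⟩
        · simp
        · set s5 := (s'.setVar 8 (s'.var 8 + 1)).setVar 6 (G.hd k) with hs5
          refine wp_seq (T1 := 12) (T2 := G.exploreTime) (by omega) (wp_stm _ ?_ (by decide) ?_)
          · simp [hv, c1]; omega
          have er : (Stm.set 8 (.var 8 + 1) ;; .set 6 (.rd 2 (.var 9))).run s' = s5 := by
            simp [hs5, c1, hL'.hd k hk]
          rw [er]
          have hsame5 : s.Same 6 10 s5 := (d1.setVar (by omega)).setVar (by omega)
          have e6 : s5.var 6 = G.hd k := by simp [hs5]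
          refine wp_mono (wp_explore (hL.same hsame5 (by omega) (by omega)) hF
            (by rw [e6]; exact hhd) h1 h0) (le_refl _) ?_
          rintro s6 ⟨g1, g2⟩
          rw [e6] at g2
          have e11 : s5.var 11 = s'.var 11 := by simp [hs5]
          rw [e11] at g2
          refine ⟨?_, ?_, hsame5.trans (g1.mono (by omega) (by omega)), ?_, ?_, g2⟩
          · rw [g1.var 9 (by omega)]; simp [hs5, c1]
          · rw [g1.var 2 (by omega)]; simp [hs5, c2]
          · rw [g1.var 7 (by omega)]; simp [hs5, d2]
          · rw [g1.var 8 (by omega)]; simp [hs5]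
        · intro h
          simp [hK', hfull] at h
        · rintro s6 ⟨g1, g2, g3, g4, g5, u', e', g6, g7, g8⟩
          have h11 : s6.var 11 ≤ s'.var 11 := by rw [g8]; exact min_le_left _ _
          refine ⟨g1, g2, ⟨g3.setVar (by omega), by simpa using g4, ?_, ?_, ?_, ?_⟩, ?_⟩
          · simp only [Store.setVar_var, if_neg (show (8 : ℕ) ≠ 9 by omega), g5, d3, hls]
            omega
          · simp only [Store.setVar_var, if_neg (show (11 : ℕ) ≠ 9 by omega), g8]
            exact d4.min g6.lt g6.side g7
          · simp only [Store.setVar_var, if_neg (show (11 : ℕ) ≠ 9 by omega)]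
            exact d5.mono h11
          · intro hle j hj hlj
            simp only [Store.setVar_var, if_neg (show (11 : ℕ) ≠ 9 by omega)]
            by_cases e : j = k
            · rw [e, g8]
              exact ⟨u', e', g6, g7, min_le_right _ _⟩
            · exact (d6 (by omega) j (by omega) hlj).mono h11
          · obtain ⟨q, hq⟩ : ∃ q, K - s'.var 8 = q + 1 := ⟨K - s'.var 8 - 1, by omega⟩
            rw [g5, hq, show K - (s'.var 8 + 1) = q by omega, add_mul]
            omega
      -- The cap is already reached and another light arc appears: more than `K` arcs are light, so
      -- the last clause of the invariant becomes vacuous.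
      · refine ⟨22, wp_mono (wp_when (T := 5) hsafe
          (fun _ => wp_mono (wp_when (T := 0) (Q := fun s'' => s'' = s') ?_ (fun h => ?_) ?_)
            (le_refl _) fun _ h => h) fun _ => rfl) (le_refl _) ?_⟩
        · simp
        · simp [hK', hfull] at h
        · exact fun _ => rfl
        · rintro s6 rfl
          refine ⟨c1, c2, ⟨d1.setVar (by omega), by simpa using d2, ?_, by simpa using d4,
            by simpa using d5, ?_⟩, by omega⟩
          · simp only [Store.setVar_var, if_neg (show (8 : ℕ) ≠ 9 by omega), d3, hls]
            omega
          · intro hle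
            omega
    · rw [if_neg hl] at hls
      refine ⟨22, wp_mono (wp_when (T := 5) (Q := fun s'' => s'' = s') hsafe
        (fun h => ?_) fun _ => rfl) (le_refl _) ?_⟩
      · simp [c1, hL'.tl k hk, h9', d2, hl] at h
      · rintro s6 rfl
        refine ⟨c1, c2, ⟨d1.setVar (by omega), by simpa using d2, ?_, by simpa using d4,
          by simpa using d5, ?_⟩, by omega⟩
        · simpa [hls] using d3
        · intro hle j hj hlj
          simp only [Store.setVar_var, if_neg (show (11 : ℕ) ≠ 9 by omega)]
          by_cases e : j = k
          · rw [e] at hlj; exact absurd hlj hl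
          · exact d6 (by omega) j (by omega) hlj
  · simp only [e8, Nat.sub_zero]
    omega
  · rintro s' c1 c2 ⟨d1, d2, d3, d4, d5, d6⟩
    refine wp_stm _ (by simp) (by decide) ?_
    simp only [Stm.run, Expr.eval_var, Store.setVar_var, if_true]
    exact ⟨d4, ⟨c, hc, q1, q4, d5⟩, d6⟩

end Net
end WordRAM

/-! ### Reading the input and computing the number of samples -/

namespace WordRAM

/-- Read the sides of the vertices. -/
def readSides : Prog := forLoop 9 1 (Stm.comp (.wr 6 (.var 9) (.rd 0 (2 + .var 9))))

/-- Read the arcs, add them to the lists of the arcs that leave a vertex, and sum up the weights. -/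
def readArcs : Prog :=
  forLoop 9 2 (Stm.comp (.set 10 (2 + .var 1 + 3 * (.var 9 / 2)) ;;
    -- Arc `j` is the edge `j / 2`, reversed when `j` is odd.
    .set 11 (.rd 0 (.var 10 + .var 9 % 2)) ;; .set 12 (.rd 0 (.var 10 + (1 - .var 9 % 2))) ;;
    .set 13 (.rd 0 (.var 10 + 2)) ;;
    .wr 1 (.var 9) (.var 11) ;; .wr 2 (.var 9) (.var 12) ;; .wr 3 (.var 9) (.var 13) ;;
    -- The arc is put in front of the list of its tail. Arc numbers are stored plus one, so that the
    -- initial `0` ends a list.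
    .wr 4 (.var 9) (.rd 5 (.var 11)) ;; .wr 5 (.var 11) (.var 9 + 1) ;;
    .set 3 (.var 3 + .var 13)))

/-- Compute the number of samples: the square root of the number of edges times the logarithm of
the number of vertices, times a constant. -/
def countProg (c : ℕ) : Prog :=
  Stm.comp (.set 17 0) ;>
  whileLoop (.lt (.var 17 * .var 17) (.var 16)) (Stm.comp (.set 17 (.var 17 + 1))) ;>
  Stm.comp (.set 18 (.var 1) ;; .set 19 0) ;>
  whileLoop (.var 18) (Stm.comp (.set 18 (.var 18 / 2) ;; .set 19 (.var 19 + 1))) ;>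
  Stm.comp (.set 4 (.var 17 * (.num c * .var 19)))

/-- Read the input and compute the number of samples. -/
def setupProg (c : ℕ) : Prog :=
  Stm.comp (.set 1 (.rd 0 0) ;; .set 16 (.rd 0 1) ;; .set 2 (.var 16 + .var 16) ;; .set 3 1) ;>
  readSides ;> readArcs ;> countProg c

namespace Net
variable {w : ℕ} {G : Net} {Γ : Layout w} {ω : Tape w}

/-- The list of numbers `x` is an encoding of the network. -/
structure Encodes (G : Net) (m : ℕ) (x : List ℕ) : Prop where
  arcs : G.arcs = 2 * m
  length : x.length = 2 + G.n + 3 * m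
  n : x.getD 0 0 = G.n
  m : x.getD 1 0 = m
  side : ∀ v < G.n, x.getD (2 + v) 0 = G.side v
  tl : ∀ j < G.arcs, x.getD (2 + G.n + 3 * (j / 2) + j % 2) 0 = G.tl j
  hd : ∀ j < G.arcs, x.getD (2 + G.n + 3 * (j / 2) + (1 - j % 2)) 0 = G.hd j
  wt : ∀ j < G.arcs, x.getD (2 + G.n + 3 * (j / 2) + 2) 0 = G.wt j
  big : G.big = 1 + ∑ j ∈ Finset.range G.arcs, G.wt j

theorem wp_readSides {s : Store} {m : ℕ} {x : List ℕ} (hE : G.Encodes m x) (hF : G.Fits Γ)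
    (hbase : Γ.base = x.length) (hx : s.arr 0 = fun i => x.getD i 0) (hn : s.var 1 = G.n) :
    wp Γ ω readSides (G.n * 28 + 6) (fun s' => s.Same 9 6 s' ∧
      (∀ k, 6 < k → s'.arr k = s.arr k) ∧ (∀ y, 9 < y → s'.var y = s.var y) ∧
      ∀ v < G.n, s'.arr 6 v = G.side v) s := by
  have hv : ∀ k j, 0 < k → k < 16 → (Γ.Valid k j ↔ j < Γ.cap) := fun k j h h' => by
    simp [Layout.Valid, show k ≠ 0 by omega, h']
  have hcl := hF.cap_lt
  have h2 := hF.n_cap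
  have hp := G.n_pos
  have hlen := hE.length
  refine wp_for (N := G.n) (T := 20) (fun k s' => s.Same 9 6 s' ∧
      (∀ k, 6 < k → s'.arr k = s.arr k) ∧ (∀ y, 9 < y → s'.var y = s.var y) ∧
      ∀ v < k, s'.arr 6 v = G.side v)
    (by decide) (by decide) (by decide) (by omega) hn ?_ ?_ (by omega) ?_
  · exact ⟨(Store.Same.refl _ _ _).setVar (by omega), fun _ _ => rfl,
      fun y hy => by simp [show y ≠ 9 by omega], fun v hv => absurd hv (by omega)⟩
  · rintro k hk s' c1 c2 ⟨d1, d2, d3, d4⟩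
    refine wp_stm _ ?_ (by decide) ?_
    · simp [hv, c1, Γ.valid_zero, hbase]; omega
    · have er : (Stm.wr 6 (.var 9) (.rd 0 (2 + .var 9))).run s' = s'.setArr 6 k (G.side k) := by
        simp only [Stm.run, Expr.eval_rd, Expr.eval_add, Expr.eval_num, Expr.eval_var, c1,
          d1.arr 0 (by omega), hx]
        rw [hE.side k hk]
      rw [er]
      refine ⟨by simpa using c1, by simpa using c2, (d1.setArr (by omega)).setVar (by omega),
        ?_, ?_, ?_⟩
      · intro i hi
        simp [show i ≠ 6 by omega, d2 i hi]
      · intro y hy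
        simp [show y ≠ 9 by omega, d3 y hy]
      · intro v hv
        by_cases e : v = k
        · subst e; simp
        · simp [e, d4 v (by omega)]
  · rintro s' _ _ h
    exact h

theorem wp_readArcs {s : Store} {m : ℕ} {x : List ℕ} (hE : G.Encodes m x) (hF : G.Fits Γ)
    (hbase : Γ.base = x.length) (hx : s.arr 0 = fun i => x.getD i 0) (hn : s.var 1 = G.n)
    (hm : s.var 2 = G.arcs) (h3 : s.var 3 = 1) (h5 : ∀ v < G.n, s.arr 5 v = 0)
    (h6 : ∀ v < G.n, s.arr 6 v = G.side v) :
    wp Γ ω readArcs (G.arcs * 208 + 6) (fun s' => G.Loaded s' ∧ s'.used = s.used ∧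
      (∀ k, 6 < k → s'.arr k = s.arr k) ∧ (∀ y, 13 < y → s'.var y = s.var y)) s := by
  have hv : ∀ k j, 0 < k → k < 16 → (Γ.Valid k j ↔ j < Γ.cap) := fun k j h h' => by
    simp [Layout.Valid, show k ≠ 0 by omega, h']
  have hcl := hF.cap_lt
  have h2 := hF.n_cap
  have h2' := hF.arcs_cap
  have h2b := hF.two_big
  have hp := G.n_pos
  have hlen := hE.length
  have harcs := hE.arcs
  have hle := Γ.base_le
  have hw := Γ.one_le
  have hb : (0 : ℕ) < 2 ^ w := by positivity
  refine wp_for (N := G.arcs) (T := 200) (fun k s' => s'.used = s.used ∧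
      s'.arr 0 = s.arr 0 ∧ (∀ k, 5 < k → s'.arr k = s.arr k) ∧ s'.var 1 = s.var 1 ∧
      (∀ y, 13 < y → s'.var y = s.var y) ∧
      (∀ j < k, s'.arr 1 j = G.tl j ∧ s'.arr 2 j = G.hd j ∧ s'.arr 3 j = G.wt j ∧
        s'.arr 4 j = G.last j (G.tl j)) ∧ (∀ v < G.n, s'.arr 5 v = G.last k v) ∧
      s'.var 3 = 1 + ∑ j ∈ Finset.range k, G.wt j)
    (by decide) (by decide) (by decide) (by omega) hm ?_ ?_ (by omega) ?_
  · refine ⟨rfl, rfl, fun _ _ => rfl, by simp, fun y hy => by simp [show y ≠ 9 by omega],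
      fun v hv => absurd hv (by omega), ?_, by simpa using h3⟩
    exact h5
  · rintro k hk s' c1 c2 ⟨d1, d2, d3, d4, d5, d6, d7, d8⟩
    have htl := G.tl_lt k hk
    have hsum : (∑ j ∈ Finset.range k, G.wt j) + G.wt k < G.big := by
      rw [hE.big, ← Finset.sum_range_succ]
      have : ∑ j ∈ Finset.range (k + 1), G.wt j ≤ ∑ j ∈ Finset.range G.arcs, G.wt j :=
        Finset.sum_le_sum_of_subset (Finset.range_subset_range.2 hk)
      omega
    have r0 : ∀ i, s'.arr 0 i = x.getD i 0 := fun i => by rw [d2, hx]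
    have e1 : s'.var 1 = G.n := d4.trans hn
    have t1 := hE.tl k hk
    have t2 := hE.hd k hk
    have t3 := hE.wt k hk
    have hm2 : k % 2 ≤ 1 := by omega
    have hk2 : 2 + G.n + 3 * (k / 2) + 2 < x.length := by omega
    set p := 2 + G.n + 3 * (k / 2) with hpdef
    refine wp_stm _ ?_ (by decide) ?_
    · simp [-List.getD_eq_getElem?_getD, hv, Γ.valid_zero, c1, e1, r0, ← hpdef, t1, t2, t3, d8]
      omega
    · have er : ((Stm.set 10 (2 + .var 1 + 3 * (.var 9 / 2)) ;;
          .set 11 (.rd 0 (.var 10 + .var 9 % 2)) ;; .set 12 (.rd 0 (.var 10 + (1 - .var 9 % 2))) ;;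
          .set 13 (.rd 0 (.var 10 + 2)) ;;
          .wr 1 (.var 9) (.var 11) ;; .wr 2 (.var 9) (.var 12) ;; .wr 3 (.var 9) (.var 13) ;;
          .wr 4 (.var 9) (.rd 5 (.var 11)) ;; .wr 5 (.var 11) (.var 9 + 1) ;;
          .set 3 (.var 3 + .var 13)).run s') =
          (((((((((s'.setVar 10 p).setVar 11 (G.tl k)).setVar 12 (G.hd k)).setVar 13
            (G.wt k)).setArr 1 k (G.tl k)).setArr 2 k (G.hd k)).setArr 3 k (G.wt k)).setArr 4 k
            (G.last k (G.tl k))).setArr 5 (G.tl k) (k + 1)).setVar 3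
            (1 + ∑ j ∈ Finset.range (k + 1), G.wt j) := by
        simp [-List.getD_eq_getElem?_getD, c1, e1, r0, ← hpdef, t1, t2, t3, d7 _ htl, d8,
          Finset.sum_range_succ, add_assoc]
      rw [er]
      refine ⟨by simpa using c1, by simpa using c2, d1, by simpa using d2, ?_, by simpa using d4,
        ?_, ?_, ?_, by simp⟩
      · intro i hi
        simp [show i ≠ 5 by omega, show i ≠ 4 by omega, show i ≠ 3 by omega,
          show i ≠ 2 by omega, show i ≠ 1 by omega, d3 i hi]
      · intro y hy
        simp [show y ≠ 9 by omega, show y ≠ 3 by omega, show y ≠ 13 by omega,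
          show y ≠ 12 by omega, show y ≠ 11 by omega, show y ≠ 10 by omega, d5 y hy]
      · intro j hj
        by_cases e : j = k
        · subst e; simp
        · obtain ⟨f1, f2, f3, f4⟩ := d6 j (by omega)
          simp [e, f1, f2, f3, f4]
      · intro v hv
        simp only [last, Store.setVar_arr, Store.setArr_arr]
        by_cases e : v = G.tl k
        · subst e; simp
        · simp [e, Ne.symm e, d7 v hv]
  · rintro s' c1 c2 ⟨d1, d2, d3, d4, d5, d6, d7, d8⟩
    refine ⟨⟨d4.trans hn, c2, by rw [d8, hE.big], fun j hj => (d6 j hj).1,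
      fun j hj => (d6 j hj).2.1, fun j hj => (d6 j hj).2.2.1, fun j hj => (d6 j hj).2.2.2, d7, ?_⟩,
      d1, fun k hk => d3 k (by omega), d5⟩
    rw [d3 6 (by omega)]
    exact h6

/-- The number `K` is `c` times the square root of `m`, rounded up, times the logarithm of `n`. -/
def Count (c m n K : ℕ) : Prop :=
  ∃ r l, K = r * (c * l) ∧ m ≤ r * r ∧ (r = 0 ∨ (r - 1) * (r - 1) < m) ∧ n < 2 ^ l ∧
    (l = 0 ∨ 2 ^ (l - 1) ≤ n)

/-- The root is found by counting up and the logarithm by halving, with `2 ^ l * q ≤ n < 2 ^ l * (q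
+ 1)` as invariant. Crude linear bounds on the time are good enough. -/
theorem wp_count {s : Store} {c m n : ℕ} (hn : s.var 1 = n) (hm : s.var 16 = m)
    (hmm : m * m < 2 ^ w) (hc : c < 2 ^ w) (hn2 : n < 2 ^ w) (hcm : m * (c * n) < 2 ^ w)
    (hcn : c * n < 2 ^ w) (hw2 : 2 < 2 ^ w) :
    wp Γ ω (countProg c) (10 * m + 20 * n + 30) (fun s' => s.Same 4 16 s' ∧
      Count c m n (s'.var 4)) s := by
  have hw := Γ.one_le
  have hb : (0 : ℕ) < 2 ^ w := by positivity
  have hmw : m < 2 ^ w := lt_of_le_of_lt (Nat.le_mul_self m) hmm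
  refine wp_seq (T1 := 2) (T2 := 10 * m + 20 * n + 28) (by omega)
    (wp_stm _ (by simp) (by decide) ?_)
  refine wp_seq (T1 := 10 * m + 6) (T2 := 20 * n + 22) (by omega)
    (wp_while (fun s' => s.Same 4 16 s' ∧ s'.var 1 = n ∧ s'.var 16 = m ∧ s'.var 17 ≤ m ∧
      (s'.var 17 = 0 ∨ (s'.var 17 - 1) * (s'.var 17 - 1) < m)) (fun s' => (m - s'.var 17) * 10)
      ?_ ?_ ?_ ?_ ?_)
  · rintro s' ⟨d1, d2, d3, d4, d5⟩
    simp
    exact lt_of_le_of_lt (Nat.mul_le_mul d4 d4) hmm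
  · rintro s' ⟨d1, d2, d3, d4, d5⟩ h
    have hlt : s'.var 17 * s'.var 17 < m := by
      by_contra hc
      simp [d3, hc] at h
    have hlt2 : s'.var 17 < m := lt_of_le_of_lt (Nat.le_mul_self _) hlt
    refine ⟨4, wp_stm _ ?_ (by decide) ?_⟩
    · simp; omega
    · simp only [Stm.run, Expr.eval_add, Expr.eval_var, Expr.eval_num]
      refine ⟨⟨d1.setVar (by omega), by simpa using d2, by simpa using d3, ?_, ?_⟩, ?_⟩
      · simpa using hlt2
      · right; simpa using hlt
      · simp only [Store.setVar_var, if_true]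
        show 4 + (5 + 1) + _ ≤ _
        omega
  · simp only [Stm.run, Expr.eval_num, Store.setVar_var, if_true]
    show _ + 5 + 1 ≤ _
    omega
  · simp only [Stm.run, Expr.eval_num]
    exact ⟨(Store.Same.refl _ _ _).setVar (by omega), by simpa using hn, by simpa using hm,
      by simp, by simp⟩
  rintro s1 ⟨d1, d2, d3, d4, d5⟩ h
  have hge : m ≤ s1.var 17 * s1.var 17 := by
    by_contra hc
    simp [d3, not_le.1 hc] at h
  refine wp_seq (T1 := 4) (T2 := 20 * n + 18) (by omega) (wp_stm _ (by simp) (by decide) ?_)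
  refine wp_seq (T1 := 20 * n + 10) (T2 := 8) (by omega)
    (wp_while (fun s' => s.Same 4 16 s' ∧ s'.var 17 = s1.var 17 ∧
      2 ^ s'.var 19 * s'.var 18 ≤ n ∧ n < 2 ^ s'.var 19 * (s'.var 18 + 1) ∧
      s'.var 18 + s'.var 19 ≤ n ∧
      (s'.var 19 = 0 ∨ 2 ^ (s'.var 19 - 1) ≤ n)) (fun s' => s'.var 18 * 20) ?_ ?_ ?_ ?_ ?_)
  · intro s' _; simp
  · rintro s' ⟨f1, f2, f3, f4, f6, f5⟩ h'
    have h' : s'.var 18 ≠ 0 := h'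
    refine ⟨8, wp_stm _ ?_ (by decide) ?_⟩
    · simp; omega
    · simp only [Stm.run, Expr.eval_add, Expr.eval_var, Expr.eval_num, Expr.eval_div]
      refine ⟨⟨(f1.setVar (by omega)).setVar (by omega), by simpa using f2, ?_, ?_, ?_, ?_⟩, ?_⟩
      · simp only [Store.setVar_var, if_true]
        simp only [show (18 : ℕ) ≠ 19 by omega, show (19 : ℕ) ≠ 18 by omega, if_false]
        rw [pow_succ, mul_assoc]
        exact (Nat.mul_le_mul_left _ (by omega)).trans f3
      · simp only [Store.setVar_var, if_true]
        simp only [show (18 : ℕ) ≠ 19 by omega, show (19 : ℕ) ≠ 18 by omega, if_false]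
        rw [pow_succ, mul_assoc]
        exact f4.trans_le (Nat.mul_le_mul_left _ (by omega))
      · simp; omega
      · right
        simp
        exact le_trans (Nat.le_mul_of_pos_right _ (Nat.pos_of_ne_zero h')) f3
      · simp only [Store.setVar_var, if_true]
        simp only [show (18 : ℕ) ≠ 19 by omega, if_false]
        show 8 + (1 + 1) + _ ≤ _
        omega
  · simp only [Stm.run, Expr.eval_num, Expr.eval_var, Store.setVar_var, if_true]
    simp only [show (18 : ℕ) ≠ 19 by omega, if_false, d2]
    show _ + 1 + 1 ≤ _
    omega
  · simp only [Stm.run, Expr.eval_num, Expr.eval_var]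
    exact ⟨(d1.setVar (by omega)).setVar (by omega), by simp, by simp [d2], by simp [d2],
      by simp [d2], by simp⟩
  rintro s2 ⟨f1, f2, f3, f4, f6, f5⟩ h'
  have h' : s2.var 18 = 0 := h'
  have hl : s2.var 19 ≤ n := by omega
  refine wp_stm _ ?_ (by show (1 + (1 + 1 + 1) + 1) + 1 ≤ 8; omega) ?_
  · have h1 : c * s2.var 19 ≤ c * n := Nat.mul_le_mul_left _ hl
    have h2 : s1.var 17 * (c * s2.var 19) ≤ m * (c * n) := Nat.mul_le_mul d4 h1
    simp [f2]
    omega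
  · simp only [Stm.run, Expr.eval_mul, Expr.eval_var, Expr.eval_const]
    refine ⟨f1.setVar (by omega), s1.var 17, s2.var 19, ?_, hge, d5, ?_, f5⟩
    · simp [f2]
    · rw [h'] at f4; simpa using f4

theorem wp_setup {s : Store} {c m : ℕ} {x : List ℕ} (hE : G.Encodes m x) (hF : G.Fits Γ)
    (hbase : Γ.base = x.length) (hx : s.arr 0 = fun i => x.getD i 0)
    (hz : ∀ k i, 0 < k → s.arr k i = 0)
    (hmm : m * m < 2 ^ w) (hc : c < 2 ^ w) (hcm : m * (c * G.n) < 2 ^ w)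
    (hcn : c * G.n < 2 ^ w) :
    wp Γ ω (setupProg c) (500 * m + 60 * G.n + 100) (fun s' => G.Loaded s' ∧
      s'.used = s.used ∧ (∀ v, s'.arr 7 v = 0) ∧ (∀ v, s'.arr 8 v = 0) ∧
      Count c m G.n (s'.var 4)) s := by
  have hcl := hF.cap_lt
  have h2 := hF.n_cap
  have h2' := hF.arcs_cap
  have hp := G.n_pos
  have hlen := hE.length
  have harcs := hE.arcs
  have hw := Γ.one_le
  have hb : (0 : ℕ) < 2 ^ w := by positivity
  have en := hE.n
  have em := hE.m
  set s1 := (((s.setVar 1 G.n).setVar 16 m).setVar 2 G.arcs).setVar 3 1 with hs1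
  refine wp_seq (T1 := 30) (T2 := 500 * m + 60 * G.n + 70) (by omega)
    (wp_stm _ ?_ (by decide) ?_)
  · simp [-List.getD_eq_getElem?_getD, Γ.valid_zero, hbase, hx, em]; omega
  have er : (Stm.set 1 (.rd 0 0) ;; .set 16 (.rd 0 1) ;; .set 2 (.var 16 + .var 16) ;;
      .set 3 1).run s = s1 := by
    simp [-List.getD_eq_getElem?_getD, hs1, hx, en, em, harcs, two_mul]
  rw [er]
  refine wp_seq (T1 := G.n * 28 + 6) (T2 := 500 * m + 32 * G.n + 64) (by omega)
    (wp_mono (wp_readSides hE hF hbase (s := s1) (by simpa [hs1] using hx) (by simp [hs1]))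
      (le_refl _) ?_)
  rintro s2 ⟨a1, a2, a3, a4⟩
  refine wp_seq (T1 := G.arcs * 208 + 6) (T2 := 10 * m + 20 * G.n + 30) (by omega)
    (wp_mono (wp_readArcs hE hF hbase (s := s2) ?_ ?_ ?_ ?_ ?_ a4) (le_refl _) ?_)
  · rw [a1.arr 0 (by omega)]; simpa [hs1] using hx
  · rw [a1.var 1 (by omega)]; simp [hs1]
  · rw [a1.var 2 (by omega)]; simp [hs1]
  · rw [a1.var 3 (by omega)]; simp [hs1]
  · intro v _
    rw [a1.arr 5 (by omega)]; simp [hs1, hz 5 v (by omega)]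
  rintro s3 ⟨b1, b2, b3, b4⟩
  have e16 : s3.var 16 = m := by
    rw [b4 16 (by omega), a3 16 (by omega)]; simp [hs1]
  refine wp_mono (wp_count b1.n e16 hmm hc (by omega) hcm hcn
    (by have := hF.two_big; omega)) (le_refl _) ?_
  rintro s4 ⟨c1, c2⟩
  refine ⟨b1.same c1 (by omega) (by omega), ?_, ?_, ?_, c2⟩
  · rw [c1.used, b2, a1.used]; rfl
  · intro v
    rw [c1.arr 7 (by omega), b3 7 (by omega), a2 7 (by omega)]
    exact hz 7 v (by omega)
  · intro v
    rw [c1.arr 8 (by omega), b3 8 (by omega), a2 8 (by omega)]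
    exact hz 8 v (by omega)

end Net
end WordRAM

/-! ### The complete approximation program -/

namespace WordRAM

/-- The layout that consists of the array `0` only. -/
def flatLayout {w : ℕ} (hw : 1 ≤ w) : Layout w := ⟨2 ^ w, 0, hw, le_refl _, Or.inl rfl⟩

/-- The store that holds the input `x`. -/
def inputStore (x : List ℕ) : Store := ⟨fun _ => 0, fun k i => if k = 0 then x.getD i 0 else 0, 0⟩

theorem rel_init {w : ℕ} (hw : 1 ≤ w) (x : List ℕ) (hx : ∀ i, x.getD i 0 < 2 ^ w) :
    (flatLayout hw).Rel (inputStore x) (State.init w x) := by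
  refine ⟨fun _ _ => by simp [State.init, inputStore], ?_, ?_, rfl⟩
  -- As a word the base `2 ^ w` is `0`, which is what the base register contains at the start.
  · apply BitVec.eq_of_toNat_eq
    simp only [State.init, flatLayout, BitVec.toNat_ofNat, Nat.mod_self]
    rfl
  · intro k i hv
    by_cases hk : k = 0
    · subst hk
      have hi : i < 2 ^ w := by simpa [Layout.Valid, flatLayout] using hv
      simp only [Layout.addr, State.init, inputStore, if_true, BitVec.toNat_ofNat,
        Nat.mod_eq_of_lt hi, Nat.mod_eq_of_lt (hx i)]
    · simp [Layout.Valid, flatLayout, hk] at hv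

/-- The length of the input has to be read from the input before the arrays can be placed behind it.
The memory there is still zero, so it can be reinterpreted as fifteen cleared arrays. -/
theorem Layout.Rel.rebase {w : ℕ} {hw : 1 ≤ w} {Γ : Layout w} {x : List ℕ} {s : Store}
    {σ : State w} (h : (flatLayout hw).Rel s σ) (hx : s.arr 0 = fun i => x.getD i 0)
    (hb : Γ.base = x.length) :
    Γ.Rel ⟨s.var, fun k i => if k = 0 then x.getD i 0 else 0, s.used⟩
      (σ.setReg baseReg (BitVec.ofNat w Γ.base)) := by
  have key : ∀ a < 2 ^ w, (σ.mem (BitVec.ofNat w a)).toNat = x.getD a 0 := by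
    intro a ha
    have := h.mem 0 a (by simpa [Layout.Valid, flatLayout] using ha)
    simpa [Layout.addr, hx] using this
  refine ⟨?_, by simp, ?_, h.used⟩
  · intro y hy
    rw [State.setReg_reg, if_neg (ne_of_lt hy)]
    exact h.var y hy
  · intro k i hv
    rw [State.setReg_mem, key _ (Γ.addr_lt hv)]
    by_cases hk : k = 0
    · simp [Layout.addr, hk]
    · simp only [Layout.addr, hk, if_false]
      rw [List.getD_eq_default _ _ (by omega)]

/-- The approximation algorithm for Bichromatic Radius; the number of samples is proportional
to `c`. -/
def radiusProg (c : ℕ) : Prog :=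
  -- Statements cannot write the base register, so a bare instruction copies the length into it.
  (Stm.comp (.set 10 (2 + .rd 0 0 + 3 * .rd 0 1)) ;> Prog.op .or baseReg 10 10) ;>
  setupProg c ;> sampleProg ;> pickProg ;> searchProg

namespace Net
variable {w : ℕ} {G : Net} {Γ : Layout w} {ω : Tape w}

/-- What is known about the result `b` of the algorithm if the samples are `z 0, …, z (K - 1)`. -/
def Outcome (G : Net) (K : ℕ) (z : ℕ → ℕ) (b : ℕ) : Prop :=
  ∃ y : ℕ → ℕ, ∃ t c r : ℕ, (∀ i < K, G.Closest 0 (z i) (y i)) ∧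
    (t < G.n ∧ G.side t = 0 ∧ ∀ v < G.n, G.side v = 0 →
      ((Finset.range K).sup fun i => G.big - G.dist (y i) t) ≤
        (Finset.range K).sup fun i => G.big - G.dist (y i) v) ∧
    r = G.big - ((Finset.range K).sup fun i => G.big - G.dist (y i) t) ∧
    (c < G.n ∧ G.side c = 1 ∧ ∀ v < G.n, G.side v = 1 →
      ((Finset.range K).sup fun i => G.dist (y i) c) ≤
        (Finset.range K).sup fun i => G.dist (y i) v) ∧
    G.Attained b ∧ G.Explored c b ∧
    (G.light (fun v => G.dist t v * (1 + G.side v)) r G.arcs ≤ K →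
      ∀ j < G.arcs, G.dist t (G.tl j) * (1 + G.side (G.tl j)) < r → G.Explored (G.hd j) b)

/-- A time bound for the algorithm. -/
def radiusTime (G : Net) (m K : ℕ) : ℕ :=
  500 * m + 60 * G.n + 200 + K * (G.sampleTime + 8) + G.pickTime + G.searchTime K

theorem exec_radius {c m : ℕ} {x : List ℕ} (hE : G.Encodes m x) (hm : 0 < m)
    (hx : ∀ i, x.getD i 0 < 2 ^ w) (h0 : ∃ v < G.n, G.side v = 0)
    (h1 : ∃ v < G.n, G.side v = 1) (hcap : x.length + 16 * (2 * G.n + 2 * m) < 2 ^ w)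
    (hword : (2 * G.big + 2) * (G.n + 1) < 2 ^ w) (hmm : m * m < 2 ^ w)
    (hcm : m * (c * G.n) < 2 ^ w) :
    ∃ K, Count c m G.n K ∧ ∀ ω : Tape w, ∃ t σ', Exec ω (radiusProg c) (State.init w x) t σ' ∧
      t ≤ G.radiusTime m K ∧ G.Outcome K (G.sample ω) (σ'.reg 0).toNat := by
  have hp := G.n_pos
  have hlen := hE.length
  have hw : 1 ≤ w := by
    rcases Nat.eq_zero_or_pos w with rfl | h
    · simp at hcap
      omega
    · exact h
  have hcn : c * G.n < 2 ^ w := lt_of_le_of_lt (Nat.le_mul_of_pos_left _ hm) hcm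
  have hc : c < 2 ^ w := lt_of_le_of_lt (Nat.le_mul_of_pos_right _ hp) hcn
  set Γ : Layout w := ⟨x.length, 2 * G.n + 2 * m, hw, by omega, Or.inr hcap⟩ with hΓ
  have hF : G.Fits Γ := ⟨by simp [hΓ], by simp [hΓ, hE.arcs], hword⟩
  have main : ∀ ω : Tape w, ∃ K, Count c m G.n K ∧ ∃ t σ',
      Exec ω (radiusProg c) (State.init w x) t σ' ∧ t ≤ G.radiusTime m K ∧
        G.Outcome K (G.sample ω) (σ'.reg 0).toNat := by
    intro ω
    obtain ⟨t1, σ1, x1, l1, R1⟩ := Stm.exec_comp (flatLayout hw) ω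
      (.set 10 (2 + .rd 0 0 + 3 * .rd 0 1)) _ _ (rel_init hw x hx) (by
        simp [-List.getD_eq_getElem?_getD, inputStore, Layout.valid_zero, flatLayout, hE.n, hE.m]
        omega)
    have e10 : ((Stm.set 10 (2 + .rd 0 0 + 3 * .rd 0 1)).run (inputStore x)).var 10 =
        x.length := by
      simp [-List.getD_eq_getElem?_getD, inputStore, hE.n, hE.m, hlen]
    have hbase : Γ.base = x.length := rfl
    have R2 := R1.rebase (Γ := Γ) (x := x) rfl rfl
    have e39 : σ1.reg 10 = BitVec.ofNat w Γ.base := by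
      apply BitVec.eq_of_toNat_eq
      rw [R1.var 10 (by decide), e10, BitVec.toNat_ofNat, Nat.mod_eq_of_lt (by omega)]
    have x2 : Exec ω (Prog.op .or baseReg 10 10) σ1 1
        (σ1.setReg baseReg (BitVec.ofNat w Γ.base)) := by
      have := Exec.op (ω := ω) .or baseReg 10 10 σ1
      rwa [show Op.or.eval (σ1.reg 10) (σ1.reg 10) = BitVec.ofNat w Γ.base by
        rw [e39]; exact BitVec.or_self] at this
    set s2 : Store := ⟨((Stm.set 10 (2 + .rd 0 0 + 3 * .rd 0 1)).run (inputStore x)).var,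
      fun k i => if k = 0 then x.getD i 0 else 0,
      ((Stm.set 10 (2 + .rd 0 0 + 3 * .rd 0 1)).run (inputStore x)).used⟩ with hs2
    obtain ⟨t3, σ3, s3, x3, R3, l3, b1, b2, b3, b4, b5⟩ := wp_setup (ω := ω) hE hF rfl (s := s2)
      (by simp [hs2]) (fun k i hk => by simp [hs2, show k ≠ 0 by omega]) hmm hc hcm hcn _ R2
    have hu : s3.used = 0 := b2
    refine ⟨s3.var 4, b5, ?_⟩
    have hK : s3.var 4 < 2 ^ w := by
      have := R3.var 4 (by decide)
      have h' := (σ3.reg 4).isLt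
      omega
    set K := s3.var 4 with hKdef
    obtain ⟨t4, σ4, s4, x4, R4, l4, c1, y, c2, c3, c4⟩ := wp_sample (ω := ω) (K := K) b1 hF
      (by rw [hE.arcs]; omega) rfl hK h0 (fun v _ => b3 v) (fun v _ => b4 v) hu _ R3
    have hL4 : G.Loaded s4 := by
      have hsame : s3.Same 5 7 { s4 with used := s3.used } := ⟨c1.var, c1.arr, rfl⟩
      have := b1.same hsame (by omega) (by omega)
      exact ⟨this.n, this.arcs, this.big, this.tl, this.hd, this.wt, this.next, this.first,
        this.side⟩
    obtain ⟨t5, σ5, s5, x5, R5, l5, d1, t, d2, d3, d4, d5, d6⟩ := wp_pick (ω := ω) hL4 hF h0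
      (fun v hv => by rw [c4 v hv]; exact Finset.sup_le fun i _ => Nat.sub_le _ _) _ R4
    have hL5 := hL4.same d1 (by omega) (by omega)
    obtain ⟨t6, σ6, s6, x6, R6, l6, f1, ⟨c', f2, f3, f4, f5⟩, f6⟩ := wp_search (ω := ω) hL5 hF h0 h1
      (f := fun v => (Finset.range K).sup fun i => G.dist (y i) v)
      (κ := fun v => G.dist t v * (1 + G.side v)) (r := G.big - s4.arr 8 t) (K := K)
      (fun v hv => by rw [d1.arr 7 (by omega), c3 v hv])
      (fun v hv => Finset.sup_le fun i hi =>
        (G.dist_lt _ (c2 i (Finset.mem_range.1 hi)).lt _ hv).le) d6 d5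
      (by rw [d1.var 4 (by omega), c1.var 4 (by omega)]; rfl) hK _ R5
    refine ⟨_, σ6, Exec.seq _ _ _ _ _ _ _ (Exec.seq _ _ _ _ _ _ _ x1 x2)
      (Exec.seq _ _ _ _ _ _ _ x3 (Exec.seq _ _ _ _ _ _ _ x4
        (Exec.seq _ _ _ _ _ _ _ x5 x6))), ?_, ?_⟩
    · have : (Stm.set 10 (2 + .rd 0 0 + 3 * .rd 0 1)).cost ≤ 30 := by decide
      unfold radiusTime
      omega
    · rw [R6.var 0 (by decide)]
      refine ⟨y, t, c', G.big - s4.arr 8 t, c2, ⟨d2, d3, fun v hv hs => ?_⟩, by rw [c4 t d2],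
        ⟨f2, f3, f4⟩, f1, f5, f6⟩
      rw [← c4 t d2, ← c4 v hv]
      exact d4 v hv hs
  -- The probability estimate needs one `K` for all tapes, whereas `main` provides it tape by tape.
  -- Rounding up makes both factors of `K` unique, so any single tape may be used to obtain it.
  have huniq : ∀ K K', Count c m G.n K → Count c m G.n K' → K = K' := by
    rintro K K' ⟨r, l, e1, a1, a2, a3, a4⟩ ⟨r', l', e2, b1, b2, b3, b4⟩
    have hr : ∀ r r' : ℕ, m ≤ r * r → (r' = 0 ∨ (r' - 1) * (r' - 1) < m) → r' ≤ r := by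
      intro r r' h1 h2
      by_contra hc
      rcases h2 with h2 | h2
      · omega
      · have : r * r ≤ (r' - 1) * (r' - 1) := Nat.mul_le_mul (by omega) (by omega)
        omega
    have hl : ∀ l l' : ℕ, G.n < 2 ^ l → (l' = 0 ∨ 2 ^ (l' - 1) ≤ G.n) → l' ≤ l := by
      intro l l' h1 h2
      by_contra hc
      rcases h2 with h2 | h2
      · omega
      · have : 2 ^ l ≤ 2 ^ (l' - 1) := Nat.pow_le_pow_right (by omega) (by omega)
        omega
    rw [e1, e2, le_antisymm (hr _ _ b1 a2) (hr _ _ a1 b2), le_antisymm (hl _ _ b3 a4) (hl _ _ a3 b4)]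
  obtain ⟨K, hK, _⟩ := main fun _ => ⟨0, by positivity⟩
  refine ⟨K, hK, fun ω => ?_⟩
  obtain ⟨K', hK', t, σ', h⟩ := main ω
  rw [huniq K K' hK hK']
  exact ⟨t, σ', h⟩

end Net
end WordRAM

/-! ### Why the outcome is within the factor 5/3 -/

namespace WordRAM
namespace Net
variable {G : Net}

/-- There is a walk of length `L` from `x` to `v`. -/
inductive Walk (G : Net) : ℕ → ℕ → ℕ → Prop
  | nil (x : ℕ) (hx : x < G.n) : Walk G x x 0
  | cons (j v L : ℕ) (hj : j < G.arcs) (h : Walk G (G.hd j) v L) : Walk G (G.tl j) v (G.wt j + L)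

theorem Walk.lt {x v L : ℕ} (h : G.Walk x v L) : x < G.n ∧ v < G.n := by
  induction h with
  | nil x hx => exact ⟨hx, hx⟩
  | cons j v L hj h ih => exact ⟨G.tl_lt j hj, ih.2⟩

theorem Walk.dist_le {x v L : ℕ} (h : G.Walk x v L) : G.dist x v ≤ L := by
  induction h with
  | nil x hx => rw [G.dist_self x hx]
  | cons j v L hj h ih =>
    exact (G.dist_tri _ (G.tl_lt j hj) _ (G.hd_lt j hj) _ h.lt.2).trans
      (Nat.add_le_add (G.dist_arc j hj) ih)

/-- A walk from `t` to `s` passes through an arc whose tail is close to `t` and whose head is close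
to `s`. -/
theorem Walk.exists_arc {t s R v L : ℕ} (ht : t < G.n) (hs : G.side s = 1) (h : G.Walk v s L) :
    ∀ acc, G.dist t v ≤ acc → acc + L ≤ R →
      -- Here `acc` is the length walked so far. The alternatives keep the cost of the current
      -- vertex at most `2R/3`: within `R/3` of `t` even the doubled distance is small enough, and
      -- farther away only vertices of `T`, whose distance is not doubled, are passed.
      (3 * acc ≤ R ∨ (G.side v = 0 ∧ R < 3 * acc ∧ 3 * acc ≤ 2 * R)) →
      (v = s ∧ 3 * acc ≤ R) ∨ ∃ j < G.arcs, 3 * (G.dist t (G.tl j) * (1 + G.side (G.tl j))) ≤ 2 * R ∧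
        ((G.side (G.hd j) = 1 ∧ 3 * G.dist (G.hd j) s ≤ 2 * R) ∨ 3 * G.dist (G.hd j) s ≤ R) := by
  induction h with
  | nil x hx =>
    intro acc h1 h2 h3
    rcases h3 with h3 | ⟨h3, _⟩
    · exact Or.inl ⟨rfl, h3⟩
    · omega
  | cons j v L hj h ih =>
    intro acc h1 h2 h3
    right
    have hd := h.dist_le
    have hb := G.hd_lt j hj
    have hsb := G.side_le _ hb
    have hst := G.side_le _ (G.tl_lt j hj)
    have hstep : G.dist t (G.hd j) ≤ acc + G.wt j :=
      (G.dist_step ht hj).trans (Nat.add_le_add_right h1 _)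
    have hκ : 3 * (G.dist t (G.tl j) * (1 + G.side (G.tl j))) ≤ 2 * R := by
      rcases h3 with h3 | ⟨h3, h4, h5⟩
      · have : G.dist t (G.tl j) * (1 + G.side (G.tl j)) ≤ G.dist t (G.tl j) * 2 :=
          Nat.mul_le_mul_left _ (by omega)
        omega
      · rw [h3]
        omega
    -- Entering `S` after more than `R/3` leaves less than `2R/3` of the walk.
    have hself : G.side (G.hd j) = 1 → R < 3 * (acc + G.wt j) → ∃ j < G.arcs,
        3 * (G.dist t (G.tl j) * (1 + G.side (G.tl j))) ≤ 2 * R ∧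
        ((G.side (G.hd j) = 1 ∧ 3 * G.dist (G.hd j) v ≤ 2 * R) ∨ 3 * G.dist (G.hd j) v ≤ R) :=
      fun h4 h5 => ⟨j, hj, hκ, Or.inl ⟨h4, by omega⟩⟩
    by_cases hc : 3 * (acc + G.wt j) ≤ R
    · rcases ih hs _ hstep (by omega) (Or.inl hc) with ⟨h4, _⟩ | h4
      -- The walk ends at the head, so its distance to the end is `0`.
      · exact ⟨j, hj, hκ, Or.inr (by rw [h4, G.dist_self v h.lt.2]; omega)⟩
      · exact h4
    · by_cases h4 : G.side (G.hd j) = 1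
      · exact hself h4 (by omega)
      · by_cases h5 : 3 * (acc + G.wt j) ≤ 2 * R
        · rcases ih hs _ hstep (by omega) (Or.inr ⟨by omega, by omega, h5⟩) with ⟨h6, _⟩ | h6
          · exact absurd hs (h6 ▸ h4)
          · exact h6
        -- The arc jumps beyond `2R/3`, so less than `R/3` remains after its head.
        · exact ⟨j, hj, hκ, Or.inr (by omega)⟩

/-- If every vertex of side `0` that is close to the tails of many arcs is close to one of the
samples, then the result of the algorithm is a good approximation of the radius `R`. -/
theorem Outcome.approx {K R b c₀ : ℕ} {z : ℕ → ℕ} (h : G.Outcome K z b)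
    (hwalk : ∀ x < G.n, ∀ v < G.n, G.Walk x v (G.dist x v))
    (hz : ∀ i < K, z i < G.n)
    (hc₀ : c₀ < G.n) (hs₀ : G.side c₀ = 1)
    (hR : ∀ t < G.n, G.side t = 0 → G.dist c₀ t ≤ R) (hbig : R ≤ G.big)
    (hmin : ∀ u < G.n, G.side u = 1 → ∀ e, G.IsEcc u e → R ≤ e)
    (hgood : ∀ t < G.n, G.side t = 0 → ∀ r,
      K ≤ G.light (fun v => G.dist t v * (1 + G.side v)) r G.arcs →
      ∃ i < K, G.dist t (z i) * (1 + G.side (z i)) < r) :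
    R ≤ b ∧ 3 * b ≤ 5 * R := by
  obtain ⟨y, t, c, r, hy, ⟨ht, hst, htmin⟩, hr, ⟨hc, hsc, hcmin⟩, hatt, hexp, hlight⟩ := h
  refine ⟨?_, ?_⟩
  · rcases hatt with rfl | ⟨u, hu, hsu, he⟩
    · exact hbig
    · exact hmin u hu hsu b he
  have hecc : ∀ f < G.n, ∀ M, G.Explored f b →
      (∀ u, G.Closest 1 f u → ∀ v < G.n, G.side v = 0 → G.dist u v ≤ M) → b ≤ M := by
    rintro f _ M ⟨u, e, h1, h2, h3⟩ h4
    obtain ⟨v, hv, hsv, rfl⟩ := h2.ex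
    exact h3.trans (h4 u h1 v hv hsv)
  -- In the first case every vertex of `T` is within `2R/3` of a sample, and the center `c` of the
  -- samples is good enough.
  by_cases hcase : 3 * r ≤ 2 * R
  · have h1 : b ≤ R + r := by
      refine hecc c hc _ hexp fun u hu v hv hsv => ?_
      -- Edges of weight `0` are allowed, so the explored vertex `u` need not be `c` itself, but it
      -- has the same distances.
      have h2 : G.dist c u = 0 := by
        have := hu.le c hc hsc
        rw [G.dist_self c hc] at this
        omega
      have h3 : G.dist u v ≤ G.dist c v := by
        have := G.dist_tri u hu.lt c hc v hv
        rw [G.dist_comm u hu.lt c hc] at this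
        omega
      -- The degenerate value `r = big` belongs to a complemented maximum of `0`, as for an empty
      -- sample; then `d(c, v) < big = r` is all that is needed.
      have h4 : r < G.big ∨ r = G.big := by omega
      rcases h4 with h4 | h4
      · have h5 : 0 < (Finset.range K).sup fun i => G.big - G.dist (y i) v :=
          lt_of_lt_of_le (by omega) (htmin v hv hsv)
        have hne : (Finset.range K).Nonempty := by
          by_contra hn
          rw [Finset.not_nonempty_iff_eq_empty] at hn
          rw [hn] at h5
          simp at h5
        obtain ⟨i, hi, he⟩ := Finset.exists_mem_eq_sup _ hne fun i => G.big - G.dist (y i) v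
        have hiK := Finset.mem_range.1 hi
        have hyi := hy i hiK
        have h6 : G.dist (y i) v ≤ r := by
          have := htmin v hv hsv
          rw [he] at this
          have := G.dist_lt _ hyi.lt v hv
          omega
        have h7 : G.dist (y i) c ≤ R := by
          -- The samples lie in `T`, so the optimal `c₀` competes with `c` at value at most `R`.
          have h8 : ((Finset.range K).sup fun i => G.dist (y i) c₀) ≤ R := by
            refine Finset.sup_le fun k hk => ?_
            have hyk := hy k (Finset.mem_range.1 hk)
            rw [G.dist_comm _ hyk.lt _ hc₀]
            exact hR _ hyk.lt hyk.side
          exact ((Finset.le_sup (f := fun i => G.dist (y i) c) hi).trans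
            (hcmin c₀ hc₀ hs₀)).trans h8
        have h8 := G.dist_tri c hc (y i) hyi.lt v hv
        rw [G.dist_comm c hc _ hyi.lt] at h8
        omega
      · have := G.dist_lt c hc v hv
        omega
    omega
  -- Otherwise some sampled tail has cost below `r`. Its chosen vertex `y i` would then be closer to
  -- `t` than `r`, the distance from `t` to the nearest sample.
  · have hfew : G.light (fun v => G.dist t v * (1 + G.side v)) r G.arcs ≤ K := by
      by_contra hc'
      obtain ⟨i, hi, hlt⟩ := hgood t ht hst r (by omega)
      have hyi := hy i hi
      have h1 : r ≤ G.dist (y i) t := by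
        have := Finset.le_sup (f := fun i => G.big - G.dist (y i) t) (Finset.mem_range.2 hi)
        have := G.dist_lt _ hyi.lt t ht
        omega
      rw [G.dist_comm _ hyi.lt _ ht] at h1
      have hsz := G.side_le _ (hz i hi)
      rcases Nat.eq_zero_or_pos (G.side (z i)) with h0 | h0
      · have h2 : G.dist (z i) (y i) = 0 := by
          have := hyi.le _ (hz i hi) h0
          rw [G.dist_self _ (hz i hi)] at this
          omega
        have := G.dist_tri t ht _ (hz i hi) _ hyi.lt
        rw [h0] at hlt
        omega
      · rw [show G.side (z i) = 1 by omega] at hlt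
        have h2 := hyi.le t ht hst
        rw [G.dist_comm _ (hz i hi) _ ht] at h2
        have := G.dist_tri t ht _ (hz i hi) _ hyi.lt
        omega
    have hts : t ≠ c₀ := fun e => by rw [e] at hst; omega
    have hd : G.dist t c₀ ≤ R := by rw [G.dist_comm t ht c₀ hc₀]; exact hR t ht hst
    rcases (hwalk t ht c₀ hc₀).exists_arc (R := R) ht hs₀ 0 (by rw [G.dist_self t ht]) (by omega)
      (Or.inl (by omega)) with ⟨h1, _⟩ | ⟨j, hj, hκ, hnear⟩
    · exact absurd h1 hts
    have hb := G.hd_lt j hj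
    have h1 : ∀ M, 3 * M ≤ 5 * R → b ≤ M → 3 * b ≤ 5 * R := fun M h2 h3 => by omega
    have hex := hlight hfew j hj (by omega)
    obtain ⟨u, e, hu, he, hbe⟩ := hex
    obtain ⟨v, hv, hsv, rfl⟩ := he.ex
    have h2 := G.dist_tri u hu.lt c₀ hc₀ v hv
    have h3 := hR v hv hsv
    have h4 := G.dist_tri u hu.lt _ hb c₀ hc₀
    rw [G.dist_comm u hu.lt _ hb] at h4
    have h5 := hu.le c₀ hc₀ hs₀
    -- In both cases `u` is within `2R/3` of `c₀`: either `u` is at distance `0` from the head, or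
    -- the head is within `R/3` of `c₀` and hence of `u` as well.
    rcases hnear with ⟨h6, h7⟩ | h6
    · have h8 := hu.le _ hb h6
      rw [G.dist_self _ hb] at h8
      omega
    · omega

end Net
end WordRAM

/-! ## Weighted distances -/

section
variable {V : Type*} {G : SimpleGraph V} {wt : Sym2 V → ℕ}

theorem weightedDist_le {u v : V} (p : G.Walk u v) :
    weightedDist G wt u v ≤ (p.edges.map wt).sum :=
  ciInf_le (OrderBot.bddBelow _) p

theorem exists_walk_weightedDist (hG : G.Connected) (u v : V) :
    ∃ p : G.Walk u v, (p.edges.map wt).sum = weightedDist G wt u v := by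
  obtain ⟨p⟩ := hG.preconnected u v
  have : (Set.range fun p : G.Walk u v => (p.edges.map wt).sum).Nonempty := ⟨_, p, rfl⟩
  obtain ⟨q, hq⟩ := Nat.sInf_mem this
  exact ⟨q, hq⟩

theorem weightedDist_self (u : V) : weightedDist G wt u u = 0 :=
  Nat.le_zero.1 (weightedDist_le (SimpleGraph.Walk.nil : G.Walk u u))

theorem weightedDist_comm (hG : G.Connected) (u v : V) :
    weightedDist G wt u v = weightedDist G wt v u := by
  have : ∀ u v, weightedDist G wt u v ≤ weightedDist G wt v u := by
    intro u v
    obtain ⟨p, hp⟩ := exists_walk_weightedDist (wt := wt) hG v u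
    rw [← hp]
    refine (weightedDist_le p.reverse).trans (le_of_eq ?_)
    rw [SimpleGraph.Walk.edges_reverse, List.map_reverse, List.sum_reverse]
  exact le_antisymm (this u v) (this v u)

theorem weightedDist_triangle (hG : G.Connected) (u v x : V) :
    weightedDist G wt u x ≤ weightedDist G wt u v + weightedDist G wt v x := by
  obtain ⟨p, hp⟩ := exists_walk_weightedDist (wt := wt) hG u v
  obtain ⟨q, hq⟩ := exists_walk_weightedDist (wt := wt) hG v x
  rw [← hp, ← hq]
  refine (weightedDist_le (p.append q)).trans (le_of_eq ?_)
  rw [SimpleGraph.Walk.edges_append, List.map_append, List.sum_append]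

theorem weightedDist_adj {u v : V} (h : G.Adj u v) : weightedDist G wt u v ≤ wt s(u, v) := by
  refine (weightedDist_le (SimpleGraph.Walk.cons h SimpleGraph.Walk.nil)).trans (le_of_eq ?_)
  simp

theorem le_sum_of_lipschitz {D : V → ℕ} (hD : ∀ u v, G.Adj u v → D v ≤ D u + wt s(u, v))
    {u v : V} (p : G.Walk u v) : D v ≤ D u + (p.edges.map wt).sum := by
  induction p with
  | nil => simp
  | cons h p ih =>
    have := hD _ _ h
    simp only [SimpleGraph.Walk.edges_cons, List.map_cons, List.sum_cons]
    omega

theorem le_weightedDist (hG : G.Connected) {D : V → ℕ}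
    (hD : ∀ u v, G.Adj u v → D v ≤ D u + wt s(u, v)) {u v : V} (h0 : D u = 0) :
    D v ≤ weightedDist G wt u v := by
  obtain ⟨p, hp⟩ := exists_walk_weightedDist (wt := wt) hG u v
  have := le_sum_of_lipschitz hD p
  rw [← hp]
  omega

/-- A path without repeated vertices uses each edge at most once. This is why one plus the sum of
all weights can serve as infinity. -/
theorem weightedDist_le_sum (hG : G.Connected) (l : List (Sym2 V)) (hl : ∀ e ∈ G.edgeSet, e ∈ l)
    (u v : V) : weightedDist G wt u v ≤ (l.map wt).sum := by
  classical
  obtain ⟨p⟩ := hG.preconnected u v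
  refine (weightedDist_le p.bypass).trans ?_
  have h1 : p.bypass.edges.Nodup := p.bypass_isPath.isTrail.edges_nodup
  have h2 : p.bypass.edges.Subperm l :=
    List.subperm_of_subset h1 fun e he => hl e (p.bypass.edges_subset_edgeSet he)
  obtain ⟨l', hp, hs⟩ := h2
  rw [← (hp.map wt).sum_eq]
  exact (hs.map wt).sum_le_sum fun _ _ => Nat.zero_le _

end

theorem List.getD_flatMap {α : Type*} (f : α → List ℕ) (c : ℕ) (hf : ∀ a, (f a).length = c)
    (l : List α) (i j : ℕ) (hi : i < l.length) (hj : j < c) :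
    (l.flatMap f).getD (c * i + j) 0 = (f l[i]).getD j 0 := by
  induction l generalizing i with
  | nil => simp at hi
  | cons a l ih =>
    rw [List.flatMap_cons]
    cases i with
    | zero =>
      rw [Nat.mul_zero, Nat.zero_add, List.getD_append _ _ _ _ (by rw [hf]; exact hj)]
      rfl
    | succ i =>
      rw [List.getD_append_right _ _ _ _ (by rw [hf, Nat.mul_succ]; omega), hf,
        show c * (i + 1) + j - c = c * i + j by rw [Nat.mul_succ]; omega,
        ih i (by simpa using hi)]
      rfl

/-! ### The network of an instance -/

namespace BichromaticInstance
variable (I : BichromaticInstance)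

/-- The edge number `j / 2`. -/
def arcEnds (j : ℕ) : Option (Fin I.n × Fin I.n) :=
  if j % 2 = 0 then I.edges[j / 2]? else I.edges[j / 2]?.map Prod.swap

theorem arcEnds_eq {j : ℕ} (hj : j < 2 * I.m) : ∃ e, I.arcEnds j = some e ∧
    I.G.Adj e.1 e.2 ∧ e = if j % 2 = 0 then I.edges[j / 2]'(by unfold m at hj; omega) else
      (I.edges[j / 2]'(by unfold m at hj; omega)).swap := by
  have h : j / 2 < I.edges.length := by unfold m at hj; omega
  have hadj : I.G.Adj I.edges[j / 2].1 I.edges[j / 2].2 := by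
    rw [← SimpleGraph.mem_edgeSet, ← I.mem_edges]
    exact List.mem_map.2 ⟨_, List.getElem_mem h, rfl⟩
  unfold arcEnds
  rw [List.getElem?_eq_getElem h]
  split_ifs with h2
  · exact ⟨_, rfl, hadj, rfl⟩
  · exact ⟨_, rfl, hadj.symm, rfl⟩

theorem exists_arcEnds {u v : Fin I.n} (h : I.G.Adj u v) :
    ∃ j < 2 * I.m, I.arcEnds j = some (u, v) := by
  rw [← SimpleGraph.mem_edgeSet, ← I.mem_edges, List.mem_map] at h
  obtain ⟨e, he, h⟩ := h
  obtain ⟨i, hi, rfl⟩ := List.getElem_of_mem he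
  rw [Sym2.eq_iff] at h
  rcases h with ⟨h1, h2⟩ | ⟨h1, h2⟩
  · refine ⟨2 * i, by unfold m; omega, ?_⟩
    unfold arcEnds
    rw [if_pos (by omega), show 2 * i / 2 = i by omega, List.getElem?_eq_getElem hi]
    exact congrArg some (Prod.ext h1 h2)
  · refine ⟨2 * i + 1, by unfold m; omega, ?_⟩
    unfold arcEnds
    rw [if_neg (by omega), show (2 * i + 1) / 2 = i by omega, List.getElem?_eq_getElem hi]
    exact congrArg some (Prod.ext h2 h1)

/-- The tail of an arc. -/
def arcTail (j : ℕ) : ℕ := (I.arcEnds j).elim 0 fun e => e.1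

/-- The head of an arc. -/
def arcHead (j : ℕ) : ℕ := (I.arcEnds j).elim 0 fun e => e.2

/-- The weight of an arc. -/
def arcWeight (j : ℕ) : ℕ := (I.arcEnds j).elim 0 fun e => I.wt s(e.1, e.2)

/-- The program sums weights arc by arc, which counts each edge twice. The arcs with even numbers
alone already give the total weight of the edges. -/
theorem sum_arcWeight : (I.edges.map fun e => I.wt s(e.1, e.2)).sum ≤
    ∑ j ∈ Finset.range (2 * I.m), I.arcWeight j := by
  have h1 : ∑ i ∈ Finset.range I.m, I.arcWeight (2 * i) ≤
      ∑ j ∈ Finset.range (2 * I.m), I.arcWeight j := by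
    rw [← Finset.sum_image (f := I.arcWeight) (g := fun i => 2 * i) (fun a _ b _ h => by
      simpa using h)]
    refine Finset.sum_le_sum_of_subset fun j hj => ?_
    simp only [Finset.mem_image, Finset.mem_range] at hj ⊢
    omega
  refine le_trans (le_of_eq ?_) h1
  rw [Finset.sum_range, ← List.sum_ofFn]
  congr 1
  refine List.ext_getElem (by simp [m]) fun i hi hi' => ?_
  have : i < I.edges.length := by simpa using hi
  simp [arcWeight, arcEnds, this]

open Classical in
/-- The network of an instance. -/
noncomputable def net : WordRAM.Net where
  n := I.n
  arcs := 2 * I.m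
  tl := I.arcTail
  hd := I.arcHead
  wt := I.arcWeight
  big := 1 + ∑ j ∈ Finset.range (2 * I.m), I.arcWeight j
  side v := if h : v < I.n then if (⟨v, h⟩ : Fin I.n) ∈ I.S then 1 else 0 else 0
  dist u v := if h : u < I.n ∧ v < I.n then weightedDist I.G I.wt ⟨u, h.1⟩ ⟨v, h.2⟩ else 0
  n_pos := by
    obtain ⟨s, _⟩ := I.S_nonempty
    exact lt_of_le_of_lt (Nat.zero_le _) s.isLt
  tl_lt j hj := by
    obtain ⟨e, h, -⟩ := I.arcEnds_eq hj
    simp [arcTail, h]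
  hd_lt j hj := by
    obtain ⟨e, h, -⟩ := I.arcEnds_eq hj
    simp [arcHead, h]
  wt_le j hj := by
    have := Finset.single_le_sum (f := I.arcWeight) (fun _ _ => Nat.zero_le _)
      (Finset.mem_range.2 hj)
    omega
  side_le v _ := by split_ifs <;> omega
  dist_self x hx := by simp [hx, weightedDist_self]
  dist_comm x hx y hy := by simp [hx, hy, weightedDist_comm I.connected ⟨x, hx⟩]
  dist_tri x hx y hy z hz := by simp [hx, hy, hz, weightedDist_triangle I.connected]
  dist_lt x hx v hv := by
    simp only [hx, hv, and_self, dite_true]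
    have h1 := weightedDist_le_sum (wt := I.wt) I.connected (I.edges.map fun e => s(e.1, e.2))
      (fun e he => (I.mem_edges e).2 he) ⟨x, hx⟩ ⟨v, hv⟩
    rw [List.map_map] at h1
    have h2 := I.sum_arcWeight
    have h3 : (I.edges.map (I.wt ∘ fun e => s(e.1, e.2))).sum =
      (I.edges.map fun e => I.wt s(e.1, e.2)).sum := rfl
    omega
  dist_arc j hj := by
    obtain ⟨e, h, hadj, -⟩ := I.arcEnds_eq hj
    simpa [arcTail, arcHead, arcWeight, h] using weightedDist_adj hadj
  le_dist x hx D h0 hD v hv := by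
    simp only [hx, hv, and_self, dite_true]
    refine le_weightedDist (D := fun u : Fin I.n => D u) I.connected (fun a b hab => ?_)
      (u := ⟨x, hx⟩) (v := ⟨v, hv⟩) h0
    obtain ⟨j, hj, h⟩ := I.exists_arcEnds hab
    simpa [arcTail, arcHead, arcWeight, h] using hD j hj

theorem net_dist (u v : Fin I.n) : I.net.dist u v = weightedDist I.G I.wt u v := by
  simp [net]

theorem net_side (v : Fin I.n) : (I.net.side v = 1 ↔ v ∈ I.S) ∧ (I.net.side v = 0 ↔ v ∈ I.Sᶜ) := by
  by_cases h : v ∈ I.S <;> simp [net, h]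

theorem walk_net {u v : Fin I.n} (p : I.G.Walk u v) :
    I.net.Walk u v (p.edges.map I.wt).sum := by
  induction p with
  | nil => exact WordRAM.Net.Walk.nil _ (by simp [net])
  | @cons a b c h p ih =>
    obtain ⟨j, hj, h'⟩ := I.exists_arcEnds h
    have h1 : I.net.tl j = a := by simp [net, arcTail, h']
    have h2 : I.net.hd j = b := by simp [net, arcHead, h']
    have h3 : I.net.wt j = I.wt s(a, b) := by simp [net, arcWeight, h']
    have := WordRAM.Net.Walk.cons (G := I.net) j c _ hj (by rw [h2]; exact ih)
    rw [h1, h3] at this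
    simpa using this

theorem net_walk (u v : ℕ) (hu : u < I.n) (hv : v < I.n) : I.net.Walk u v (I.net.dist u v) := by
  obtain ⟨p, hp⟩ := exists_walk_weightedDist (wt := I.wt) I.connected ⟨u, hu⟩ ⟨v, hv⟩
  have := I.walk_net p
  rw [hp, ← net_dist] at this
  exact this

theorem encodes : I.net.Encodes I.m I.encode := by
  have hlen : (I.edges.flatMap fun e => [(e.1 : ℕ), (e.2 : ℕ), I.wt s(e.1, e.2)]).length =
      3 * I.m := by
    rw [List.length_flatMap]
    simp [m, Nat.mul_comm]
  have key : ∀ i c, i < I.m → c < 3 → I.encode.getD (2 + I.n + 3 * i + c) 0 =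
      ((fun e : Fin I.n × Fin I.n => [(e.1 : ℕ), (e.2 : ℕ), I.wt s(e.1, e.2)])
        (I.edges.getD i (⟨0, I.net.n_pos⟩, ⟨0, I.net.n_pos⟩))).getD c 0 := by
    intro i c hi hc
    unfold encode
    rw [show 2 + I.n + 3 * i + c = I.n + (3 * i + c) + 1 + 1 by omega, List.getD_cons_succ,
      List.getD_cons_succ, List.getD_append_right _ _ _ _ (by simp)]
    have hi' : i < I.edges.length := hi
    rw [List.length_ofFn, show I.n + (3 * i + c) - I.n = 3 * i + c by omega,
      List.getD_flatMap _ 3 (fun _ => rfl) _ _ _ hi' hc, List.getD_eq_getElem _ _ hi']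
  refine ⟨rfl, ?_, rfl, rfl, ?_, ?_, ?_, ?_, rfl⟩
  · simp only [encode, List.length_cons, List.length_append, List.length_ofFn, hlen]
    show _ = 2 + I.n + 3 * I.m
    omega
  · intro v hv
    have hv' : v < I.n := hv
    unfold encode
    rw [show 2 + v = v + 1 + 1 by omega, List.getD_cons_succ, List.getD_cons_succ,
      List.getD_append _ _ _ _ (by simpa using hv'), List.getD_eq_getElem _ _ (by simpa using hv')]
    simp [net, hv']
  all_goals
    intro j hj
    have hj2 : j / 2 < I.m := by have : j < 2 * I.m := hj; omega
    have hj3 : j / 2 < I.edges.length := hj2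
    obtain ⟨e, h1, -, h2⟩ := I.arcEnds_eq hj
    show I.encode.getD (2 + I.n + 3 * (j / 2) + _) 0 = _
    rw [key _ _ hj2 (by omega), List.getD_eq_getElem _ _ hj3]
  · show _ = I.arcTail j
    simp only [arcTail, h1, Option.elim, h2]
    rcases Nat.mod_two_eq_zero_or_one j with h | h <;> simp [h]
  · show _ = I.arcHead j
    simp only [arcHead, h1, Option.elim, h2]
    rcases Nat.mod_two_eq_zero_or_one j with h | h <;> simp [h]
  · show _ = I.arcWeight j
    simp only [arcWeight, h1, Option.elim, h2]
    rcases Nat.mod_two_eq_zero_or_one j with h | h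
    · simp [h]
    · simp [h, Sym2.eq_swap]

theorem weightedDist_le_ecc {s t : Fin I.n} (ht : t ∈ I.Sᶜ) :
    weightedDist I.G I.wt s t ≤ I.ecc s :=
  Finset.le_sup' (fun t => weightedDist I.G I.wt s t) ht

theorem ecc_le {s : Fin I.n} {e : ℕ} (h : ∀ t ∈ I.Sᶜ, weightedDist I.G I.wt s t ≤ e) :
    I.ecc s ≤ e := Finset.sup'_le _ _ h

theorem radius_le {s : Fin I.n} (hs : s ∈ I.S) : I.radius ≤ I.ecc s := Finset.inf'_le _ hs

theorem exists_ecc_eq_radius : ∃ s ∈ I.S, I.ecc s = I.radius := by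
  obtain ⟨s, hs, h⟩ := Finset.exists_mem_eq_inf' I.S_nonempty I.ecc
  exact ⟨s, hs, h.symm⟩

theorem isApprox_of_outcome {K b : ℕ} {z : ℕ → ℕ} (h : I.net.Outcome K z b)
    (hz : ∀ i < K, z i < I.n)
    (hgood : ∀ t < I.n, I.net.side t = 0 → ∀ r,
      K ≤ I.net.light (fun v => I.net.dist t v * (1 + I.net.side v)) r (2 * I.m) →
      ∃ i < K, I.net.dist t (z i) * (1 + I.net.side (z i)) < r) :
    I.IsApprox (5 / 3) b := by
  obtain ⟨s, hs, hr⟩ := I.exists_ecc_eq_radius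
  have hradius : I.radius ≤ b ∧ 3 * b ≤ 5 * I.radius := by
    refine h.approx (c₀ := s) (fun x hx v hv => I.net_walk x v hx hv) hz s.isLt
      ((I.net_side s).1.2 hs) (fun t ht hst => ?_) ?_ ?_ hgood
    · rw [← hr]
      have ht' : (⟨t, ht⟩ : Fin I.n) ∈ I.Sᶜ := (I.net_side ⟨t, ht⟩).2.1 hst
      rw [show t = ((⟨t, ht⟩ : Fin I.n) : ℕ) from rfl, net_dist]
      exact I.weightedDist_le_ecc ht'
    · rw [← hr]
      refine I.ecc_le fun t _ => ?_
      rw [← net_dist]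
      exact (I.net.dist_lt _ s.isLt _ t.isLt).le
    · intro u hu hsu e he
      refine (I.radius_le ((I.net_side ⟨u, hu⟩).1.1 hsu)).trans (I.ecc_le fun t ht => ?_)
      rw [← net_dist]
      exact he.le t t.isLt ((I.net_side t).2.2 ht)
  obtain ⟨h1, h2⟩ := hradius
  refine ⟨h1, ?_⟩
  have : ((3 * b : ℕ) : ℝ) ≤ ((5 * I.radius : ℕ) : ℝ) := by exact_mod_cast h2
  push_cast at this
  linarith

end BichromaticInstance

namespace WordRAM

/-! ## Random samples -/

open MeasureTheory

/-- A remainder modulo `M` of a uniform number below `N` is not exactly uniform, but each residue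
`a` has at least `N / M` preimages `a + M * q`. -/
theorem card_le_card_filter_mod {M N : ℕ} (S : Finset ℕ) (hS : S ⊆ Finset.range M) :
    S.card * (N / M) ≤ (Finset.univ.filter fun x : Fin N => (x : ℕ) % M ∈ S).card := by
  have e : (Finset.univ.filter fun x : Fin N => (x : ℕ) % M ∈ S).card =
      ((Finset.range N).filter fun x => x % M ∈ S).card := by
    rw [Finset.card_filter, Finset.card_filter]
    exact Fin.sum_univ_eq_sum_range (fun x => if x % M ∈ S then 1 else 0) N
  have e2 : S.card * (N / M) = (S ×ˢ Finset.range (N / M)).card := by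
    rw [Finset.card_product, Finset.card_range]
  rw [e, e2]
  refine Finset.card_le_card_of_injOn (fun p => p.1 + M * p.2) ?_ ?_
  · intro p hp
    rw [Finset.mem_coe, Finset.mem_product, Finset.mem_range] at hp
    have h1 := Finset.mem_range.1 (hS hp.1)
    rw [Finset.mem_coe, Finset.mem_filter, Finset.mem_range]
    dsimp only
    refine ⟨?_, ?_⟩
    · calc p.1 + M * p.2 < M * (p.2 + 1) := by rw [mul_add]; omega
        _ ≤ M * (N / M) := Nat.mul_le_mul_left _ hp.2
        _ ≤ N := Nat.mul_div_le _ _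
    · rw [Nat.add_mul_mod_self_left, Nat.mod_eq_of_lt h1]
      exact hp.1
  · intro p hp q hq h
    rw [Finset.mem_coe, Finset.mem_product] at hp hq
    have h1 := Finset.mem_range.1 (hS hp.1)
    have h2 := Finset.mem_range.1 (hS hq.1)
    dsimp only at h
    have h3 := congrArg (· % M) h
    have h4 := congrArg (· / M) h
    simp only [Nat.add_mul_mod_self_left, Nat.mod_eq_of_lt h1, Nat.mod_eq_of_lt h2] at h3
    simp only [Nat.add_mul_div_left _ _ (show 0 < M by omega), Nat.div_eq_of_lt h1,
      Nat.div_eq_of_lt h2, zero_add] at h4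
    exact Prod.ext h3 h4

theorem measurableSet_tape_miss (w K : ℕ) (A : Set (Fin (2 ^ w))) :
    MeasurableSet {ω : Tape w | ∀ i < K, ω i ∈ A} := by
  have : {ω : Tape w | ∀ i < K, ω i ∈ A} = (↑(Finset.range K) : Set ℕ).pi fun _ => A := by
    ext ω; simp [Set.mem_pi]
  rw [this]
  exact MeasurableSet.pi (Finset.range K).countable_toSet
    fun _ _ => MeasurableSet.of_discrete

theorem tapeMeasure_forall_mem (w K : ℕ) (A : Finset (Fin (2 ^ w))) :
    (tapeMeasure w).real {ω : Tape w | ∀ i < K, ω i ∈ A} = ((A.card : ℝ) / 2 ^ w) ^ K := by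
  have : {ω : Tape w | ∀ i < K, ω i ∈ A} =
      (↑(Finset.range K) : Set ℕ).pi fun _ => (A : Set (Fin (2 ^ w))) := by
    ext ω; simp [Set.mem_pi]
  rw [this, tapeMeasure, measureReal_def, Measure.infinitePi_pi _
    fun _ _ => MeasurableSet.of_discrete, Finset.prod_const, Finset.card_range,
    PMF.toMeasure_uniformOfFintype_apply _ MeasurableSet.of_discrete]
  simp

instance (w : ℕ) : IsProbabilityMeasure (tapeMeasure w) := by
  unfold tapeMeasure; infer_instance

/-- The probability that a target set is missed by all samples. -/
theorem tapeMeasure_miss_le {w K M : ℕ} (hM : 0 < M) (hMw : M ≤ 2 ^ w) (S : Finset ℕ)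
    (hS : S ⊆ Finset.range M) :
    (tapeMeasure w).real {ω : Tape w | ∀ i < K, (ω i : ℕ) % M ∉ S} ≤
      Real.exp (-(K * S.card / (2 * M))) := by
  have e : {ω : Tape w | ∀ i < K, (ω i : ℕ) % M ∉ S} =
      {ω : Tape w | ∀ i < K, ω i ∈ Finset.univ.filter fun x : Fin (2 ^ w) => (x : ℕ) % M ∉ S} := by
    ext ω; simp
  rw [e, tapeMeasure_forall_mem]
  have hc : (Finset.univ.filter fun x : Fin (2 ^ w) => (x : ℕ) % M ∈ S).card +
      (Finset.univ.filter fun x : Fin (2 ^ w) => (x : ℕ) % M ∉ S).card = 2 ^ w := by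
    rw [Finset.card_filter_add_card_filter_not]; simp
  have h1 := card_le_card_filter_mod (N := 2 ^ w) S hS
  -- Since `M ≤ 2 ^ w`, rounding the quotient down loses at most a factor of two. Hence one sample
  -- hits `S` with probability at least `|S| / (2M)`.
  have h2 : 2 ^ w ≤ 2 * M * (2 ^ w / M) := by
    have h3 := Nat.div_add_mod (2 ^ w) M
    have h4 := Nat.mod_lt (2 ^ w) hM
    have h5 : M * 1 ≤ M * (2 ^ w / M) := Nat.mul_le_mul_left _ (Nat.div_pos hMw hM)
    rw [mul_assoc]
    omega
  have hw : (0 : ℝ) < 2 ^ w := by positivity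
  have hM' : (0 : ℝ) < M := by exact_mod_cast hM
  have h6 : (S.card : ℝ) / (2 * M) ≤
      ((Finset.univ.filter fun x : Fin (2 ^ w) => (x : ℕ) % M ∈ S).card : ℝ) / 2 ^ w := by
    rw [div_le_div_iff₀ (by positivity) hw]
    have h7 : S.card * 2 ^ w ≤
        (Finset.univ.filter fun x : Fin (2 ^ w) => (x : ℕ) % M ∈ S).card * (2 * M) := by
      calc S.card * 2 ^ w ≤ S.card * (2 * M * (2 ^ w / M)) := Nat.mul_le_mul_left _ h2
        _ = S.card * (2 ^ w / M) * (2 * M) := by ring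
        _ ≤ _ := Nat.mul_le_mul_right _ h1
    exact_mod_cast h7
  have h8 : ((Finset.univ.filter fun x : Fin (2 ^ w) => (x : ℕ) % M ∉ S).card : ℝ) / 2 ^ w =
      1 - ((Finset.univ.filter fun x : Fin (2 ^ w) => (x : ℕ) % M ∈ S).card : ℝ) / 2 ^ w := by
    have hc' : ((Finset.univ.filter fun x : Fin (2 ^ w) => (x : ℕ) % M ∈ S).card : ℝ) +
      (Finset.univ.filter fun x : Fin (2 ^ w) => (x : ℕ) % M ∉ S).card = 2 ^ w := by
      exact_mod_cast hc
    rw [eq_sub_iff_add_eq, ← add_div, add_comm, hc', div_self hw.ne']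
  rw [h8, show -((K : ℝ) * S.card / (2 * M)) = K * (-(S.card / (2 * M))) by ring, Real.exp_nat_mul]
  refine pow_le_pow_left₀ ?_ ?_ K
  · rw [← h8]; positivity
  · exact (sub_le_sub_left h6 1).trans (Real.one_sub_le_exp_neg _)

end WordRAM

namespace WordRAM

open MeasureTheory

namespace Net

variable (G : Net)

/-- With high probability, the samples hit all sets that are not light. -/
theorem hit_probability {w m K k : ℕ} (harcs : G.arcs = 2 * m) (hm : 0 < m) (hmw : 2 * m ≤ 2 ^ w)
    (hK : Count (2 * (k + 1)) m G.n K) (κ : ℕ → ℕ → ℕ) :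
    1 - 1 / (G.n : ℝ) ^ k ≤ (tapeMeasure w).real {ω : Tape w | ∀ t < G.n, ∀ r,
      K ≤ G.light (κ t) r (2 * m) → ∃ i < K, κ t (G.sample ω i) < r} := by
  classical
  have hn : (0 : ℝ) < G.n := by exact_mod_cast G.n_pos
  obtain ⟨ρ, l, rfl, h1, -, h2, -⟩ := hK
  set K := ρ * (2 * (k + 1) * l) with hKdef
  have hl : 1 ≤ l := by
    rcases Nat.eq_zero_or_pos l with h | h
    · subst h; have := G.n_pos; simp at h2; omega
    · exact h
  -- Missing `K` of the `2 * m` arcs with `K` samples has probability at most `exp (-K² / (4m))`.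
  -- The factor `2 * (k + 1)` in `K` makes this `n ^ (-(k + 1))`, which leaves room for a union
  -- bound over the vertices.
  have hKm : 4 * m * ((k + 1) * l) ≤ K * K := by
    have h3 : 1 * ((k + 1) * l) ≤ ((k + 1) * l) * ((k + 1) * l) :=
      Nat.mul_le_mul_right _ (Nat.mul_pos (Nat.succ_pos k) hl)
    calc 4 * m * ((k + 1) * l) ≤ 4 * (ρ * ρ) * (((k + 1) * l) * ((k + 1) * l)) :=
          Nat.mul_le_mul (Nat.mul_le_mul_left _ h1) (by omega)
      _ = K * K := by rw [hKdef]; ring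
  have hexp : Real.exp (-(K * K / (4 * m))) ≤ 1 / (G.n : ℝ) ^ (k + 1) := by
    have h3 : ((k : ℝ) + 1) * l ≤ K * K / (4 * m) := by
      rw [le_div_iff₀ (by positivity)]
      have : ((4 * m * ((k + 1) * l) : ℕ) : ℝ) ≤ ((K * K : ℕ) : ℝ) := by exact_mod_cast hKm
      push_cast at this
      linarith
    have h4 : Real.log G.n ≤ l := by
      rw [Real.log_le_iff_le_exp hn]
      calc (G.n : ℝ) ≤ 2 ^ l := by exact_mod_cast h2.le
        _ ≤ (Real.exp 1) ^ l := pow_le_pow_left₀ (by norm_num)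
            (by linarith [Real.add_one_le_exp 1]) l
        _ = Real.exp l := by rw [← Real.exp_nat_mul, mul_one]
    calc Real.exp (-(K * K / (4 * m))) ≤ Real.exp (-((k + 1 : ℕ) * Real.log G.n)) := by
          apply Real.exp_le_exp.2
          have := mul_le_mul_of_nonneg_left h4 (show (0 : ℝ) ≤ k + 1 by positivity)
          push_cast
          linarith
      _ = 1 / (G.n : ℝ) ^ (k + 1) := by
          rw [Real.exp_neg, Real.exp_nat_mul, Real.exp_log hn, one_div]
  -- For fixed `t` the sets of light arcs grow with `r`. It suffices to hit the one for the least
  -- `r` at which there are at least `K` arcs, so there is a single event per vertex rather than one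
  -- per pair.
  have hT : ∀ t, ∃ S ⊆ Finset.range (2 * m), (S = ∅ ∨ K ≤ S.card) ∧
      ∀ r, K ≤ G.light (κ t) r (2 * m) → S.Nonempty ∧ ∀ j ∈ S, κ t (G.tl j) < r := by
    intro t
    by_cases h : ∃ r, K ≤ G.light (κ t) r (2 * m)
    · have hr := Nat.find_spec h
      have hK0 : K ≠ 0 := by
        rintro h0
        rw [h0] at hKm
        have := Nat.mul_pos (Nat.mul_pos (show 0 < 4 by omega) hm) (Nat.mul_pos (show 0 < k + 1 by omega) hl)
        omega
      refine ⟨(Finset.range (2 * m)).filter fun j => κ t (G.tl j) < Nat.find h,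
        Finset.filter_subset _ _, Or.inr hr, fun r h3 => ⟨?_, fun j hj => ?_⟩⟩
      · rw [← Finset.card_pos]
        exact lt_of_lt_of_le (Nat.pos_of_ne_zero hK0) hr
      · exact lt_of_lt_of_le (Finset.mem_filter.1 hj).2 (Nat.find_min' h h3)
    · exact ⟨∅, by simp, Or.inl rfl, fun r hr => absurd ⟨r, hr⟩ h⟩
  choose S hSr hSK hSl using hT
  set B : Set (Tape w) := ⋃ t ∈ (Finset.range G.n).filter fun t => (S t).Nonempty,
    {ω : Tape w | ∀ i < K, (ω i : ℕ) % (2 * m) ∉ S t} with hB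
  have hBm : MeasurableSet B := by
    refine Finset.measurableSet_biUnion _ fun t _ => ?_
    exact measurableSet_tape_miss w K {x | (x : ℕ) % (2 * m) ∉ S t}
  have hBp : (tapeMeasure w).real B ≤ 1 / (G.n : ℝ) ^ k := by
    calc (tapeMeasure w).real B ≤ ∑ t ∈ (Finset.range G.n).filter fun t => (S t).Nonempty,
          (tapeMeasure w).real {ω : Tape w | ∀ i < K, (ω i : ℕ) % (2 * m) ∉ S t} :=
        measureReal_biUnion_finset_le _ _
      _ ≤ ∑ t ∈ (Finset.range G.n).filter fun t => (S t).Nonempty, 1 / (G.n : ℝ) ^ (k + 1) := by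
        refine Finset.sum_le_sum fun t ht => ?_
        refine (tapeMeasure_miss_le (by omega) hmw (S t) (hSr t)).trans (le_trans ?_ hexp)
        apply Real.exp_le_exp.2
        rw [neg_le_neg_iff]
        have hKS : (K : ℝ) ≤ (S t).card := by
          rcases hSK t with h | h
          · exact absurd (Finset.mem_filter.1 ht).2 (by simp [h])
          · exact_mod_cast h
        push_cast
        rw [show (2 * (2 * m) : ℝ) = 4 * m by ring]
        gcongr
      _ ≤ ∑ t ∈ Finset.range G.n, 1 / (G.n : ℝ) ^ (k + 1) :=
        Finset.sum_le_sum_of_subset_of_nonneg (Finset.filter_subset _ _)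
          fun _ _ _ => by positivity
      _ = 1 / (G.n : ℝ) ^ k := by
        rw [Finset.sum_const, Finset.card_range, nsmul_eq_mul, pow_succ]
        field_simp
  calc 1 - 1 / (G.n : ℝ) ^ k ≤ 1 - (tapeMeasure w).real B := by linarith
    _ = (tapeMeasure w).real Bᶜ := (probReal_compl_eq_one_sub hBm).symm
    _ ≤ _ := by
      -- Only the bad event `B` has to be measurable; for the event in the statement, monotonicity
      -- is enough.
      refine measureReal_mono ?_
      intro ω hω t ht r hr
      obtain ⟨hne, hlt⟩ := hSl t r hr
      rw [hB, Set.mem_compl_iff, Set.mem_iUnion₂] at hω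
      have : ¬ ∀ i < K, (ω i : ℕ) % (2 * m) ∉ S t := fun h => hω ⟨t, by simp [ht, hne], h⟩
      push Not at this
      obtain ⟨i, hi, hS⟩ := this
      refine ⟨i, hi, ?_⟩
      have := hlt _ hS
      rwa [← harcs] at this

end Net
end WordRAM

/-! ### Word length and running time -/

theorem List.getD_le_foldr_max (l : List ℕ) (i : ℕ) : l.getD i 0 ≤ l.foldr max 0 := by
  induction l generalizing i with
  | nil => simp
  | cons a l ih =>
    cases i with
    | zero => simp
    | succ i => simpa using le_max_of_le_right (ih i)

/-- Connectedness is what allows time bounds in terms of `m` alone. -/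
theorem BichromaticInstance.n_le_m_add_one (I : BichromaticInstance) : I.n ≤ I.m + 1 := by
  classical
  have h1 := I.connected.card_vert_le_card_edgeSet_add_one
  have h2 : I.G.edgeSet = ((I.edges.map fun e => s(e.1, e.2)).toFinset : Set (Sym2 (Fin I.n))) := by
    ext e; rw [Finset.mem_coe, List.mem_toFinset]; exact (I.mem_edges e).symm
  rw [h2, Nat.card_coe_set_eq, Set.ncard_coe_finset, List.toFinset_card_of_nodup I.edges_nodup,
    List.length_map, Nat.card_fin] at h1
  exact h1

theorem BichromaticInstance.m_pos (I : BichromaticInstance) : 0 < I.m := by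
  obtain ⟨s, hs⟩ := I.S_nonempty
  obtain ⟨t, ht⟩ := I.T_nonempty
  have h1 : s ≠ t := fun h => (Finset.mem_compl.1 ht) (h ▸ hs)
  have h2 : (s : ℕ) ≠ t := fun h => h1 (Fin.ext h)
  have := s.isLt
  have := t.isLt
  have := I.n_le_m_add_one
  omega

namespace WordRAM

theorem le_two_pow_inputBits (x : List ℕ) :
    x.length + x.foldr max 0 + 2 ≤ 2 ^ inputBits x := Nat.le_pow_clog (by omega) _

namespace Net

variable {G : Net}

/-- The numbers that occur in the computation fit into words. -/
theorem Encodes.lt_word {m k w : ℕ} {x : List ℕ} (hE : G.Encodes m x) (hm : 0 < m)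
    (hw : (6 + k) * inputBits x ≤ w) :
    (∀ i, x.getD i 0 < 2 ^ w) ∧ x.length + 16 * (2 * G.n + 2 * m) < 2 ^ w ∧
      (2 * G.big + 2) * (G.n + 1) < 2 ^ w ∧ m * m < 2 ^ w ∧
      m * (2 * (k + 1) * G.n) < 2 ^ w := by
  obtain ⟨N, hN⟩ : ∃ N, N = x.length + x.foldr max 0 + 2 := ⟨_, rfl⟩
  have hlen := hE.length
  have hn := G.n_pos
  have hN8 : 8 ≤ N := by omega
  have hNw : N ^ (6 + k) ≤ 2 ^ w := by
    calc N ^ (6 + k) ≤ (2 ^ inputBits x) ^ (6 + k) :=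
          Nat.pow_le_pow_left (hN ▸ le_two_pow_inputBits x) _
      _ = 2 ^ ((6 + k) * inputBits x) := by rw [← pow_mul, mul_comm]
      _ ≤ 2 ^ w := Nat.pow_le_pow_right (by omega) hw
  -- Every quantity below is bounded by this power of the input size; the spare factor `N` makes the
  -- inequality strict.
  have hlt : ∀ {a : ℕ}, a ≤ N ^ (5 + k) → a < 2 ^ w := fun h =>
    lt_of_le_of_lt h (lt_of_lt_of_le (Nat.pow_lt_pow_right (by omega) (by omega)) hNw)
  have hlt5 : ∀ {a j : ℕ}, a ≤ N ^ j → j ≤ 5 + k → a < 2 ^ w := fun h hj =>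
    hlt (h.trans (Nat.pow_le_pow_right (by omega) hj))
  have hbig : G.big ≤ N * N := by
    have h1 : ∑ j ∈ Finset.range G.arcs, G.wt j ≤ G.arcs * x.foldr max 0 := by
      calc ∑ j ∈ Finset.range G.arcs, G.wt j ≤ ∑ j ∈ Finset.range G.arcs, x.foldr max 0 :=
            Finset.sum_le_sum fun j hj => by
              rw [← hE.wt j (Finset.mem_range.1 hj)]; exact List.getD_le_foldr_max _ _
        _ = _ := by simp
    have h2 : G.arcs ≤ N - 1 := by rw [hE.arcs]; omega
    have h3 : G.arcs * x.foldr max 0 ≤ (N - 1) * N := Nat.mul_le_mul h2 (by omega)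
    rw [hE.big]
    obtain ⟨M, rfl⟩ : ∃ M, N = M + 1 := ⟨N - 1, by omega⟩
    rw [Nat.add_sub_cancel] at h3
    nlinarith
  refine ⟨fun i => hlt5 (j := 1) ?_ (by omega), hlt5 (j := 3) ?_ (by omega),
    hlt5 (j := 4) ?_ (by omega), hlt5 (j := 2) ?_ (by omega), hlt5 (j := 3 + k) ?_ (by omega)⟩
  · have := List.getD_le_foldr_max x i
    rw [pow_one]; omega
  · have : 64 * N ≤ N ^ 3 := by
      calc 64 * N ≤ (N * N) * N := Nat.mul_le_mul_right _ (by nlinarith)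
        _ = N ^ 3 := by ring
    omega
  · calc (2 * G.big + 2) * (G.n + 1) ≤ (N * (N * N)) * N := by
          refine Nat.mul_le_mul ?_ (by omega)
          nlinarith
      _ = N ^ 4 := by ring
  · calc m * m ≤ N * N := Nat.mul_le_mul (by omega) (by omega)
      _ = N ^ 2 := by ring
  · have h1 : 2 * (k + 1) ≤ N ^ (k + 1) := by
      calc 2 * (k + 1) ≤ 2 * 2 ^ k := Nat.mul_le_mul_left _ Nat.lt_two_pow_self
        _ = 2 ^ (k + 1) := by ring
        _ ≤ N ^ (k + 1) := Nat.pow_le_pow_left (by omega) _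
    calc m * (2 * (k + 1) * G.n) ≤ N * (N ^ (k + 1) * N) :=
          Nat.mul_le_mul (by omega) (Nat.mul_le_mul h1 (by omega))
      _ = N ^ (3 + k) := by ring

/-- `X` is the time of one run of Dijkstra's algorithm up to a constant. It also absorbs all linear
terms, because `n ≤ 2 * m`. -/
theorem radiusTime_le {m K : ℕ} (harcs : G.arcs = 2 * m) (hm : 0 < m) (hn : G.n ≤ 2 * m) :
    G.radiusTime m K ≤ 60 * (K + 1) * ((updateTime G.n + 100) * m) := by
  set X := (updateTime G.n + 100) * m with hX
  have hu : 100 ≤ updateTime G.n := by unfold updateTime; omega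
  have h1 : 200 * m ≤ X := Nat.mul_le_mul_right _ (by omega)
  have h2 : G.dijkstraTime ≤ 7 * X := by
    calc G.dijkstraTime ≤ (updateTime G.n + 100) * (7 * m) :=
          Nat.mul_le_mul_left _ (by omega)
      _ = 7 * X := by rw [hX]; ring
  have h3 : G.nearTime ≤ 16 * X := by unfold nearTime; omega
  have h4 : G.exploreTime + 12 ≤ 19 * X := by unfold exploreTime; omega
  have h5 : G.sampleTime + 8 ≤ 18 * X := by unfold sampleTime; omega
  have h6 : G.pickTime ≤ 10 * X := by unfold pickTime; omega
  have h7 : G.searchTime K ≤ 19 * ((K + 1) * X) + 2 * X := by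
    have := Nat.mul_le_mul_left (K + 1) h4
    unfold searchTime
    rw [show (K + 1) * (19 * X) = 19 * ((K + 1) * X) by ring] at this
    omega
  have h8 := Nat.mul_le_mul_left K h5
  have h9 : (K + 1) * X = K * X + X := by ring
  rw [show K * (18 * X) = 18 * (K * X) by ring] at h8
  rw [show 60 * (K + 1) * X = 60 * ((K + 1) * X) by ring]
  unfold radiusTime
  omega

/-- The factor `3 / 2` comes from `log 2 > 2 / 3`. -/
theorem natCast_log_le (n : ℕ) {L : ℝ} (hL : Real.log n ≤ L) {l : ℕ}
    (hl : 2 ^ l ≤ n) : (l : ℝ) ≤ 3 / 2 * L := by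
  have h1 : (l : ℝ) * Real.log 2 ≤ L := by
    rw [← Real.log_pow]
    refine le_trans (Real.log_le_log (by positivity) ?_) hL
    exact_mod_cast hl
  have h2 := Real.log_two_gt_d9
  have h3 : (0 : ℝ) ≤ l := Nat.cast_nonneg _
  nlinarith

/-- The constants: the rounded root is at most `2√m`, the binary length of `n` at most `5/2 * L`,
and `updateTime + 100` at most `500 * L`; then `60 * 500 = 30000`. Here `L ≥ 1` because `m + 2 ≥ 3 >
e`. One logarithm is due to `K`, the other to the tree. -/
theorem radiusTime_le_real {c m K : ℕ} (harcs : G.arcs = 2 * m) (hm : 0 < m) (hn : G.n ≤ m + 1)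
    (hK : Count c m G.n K) : (G.radiusTime m K : ℝ) ≤
      (30000 * (5 * c + 1) : ℕ) * (m : ℝ) ^ (3 / 2 : ℝ) * Real.log (m + 2) ^ 2 := by
  obtain ⟨ρ, l, rfl, -, h1, -, h2⟩ := hK
  set L := Real.log (m + 2) with hL
  set s := Real.sqrt m with hs
  have hm1 : (1 : ℝ) ≤ m := by exact_mod_cast hm
  have hs1 : 1 ≤ s := Real.one_le_sqrt.2 hm1
  have hss : s * s = m := Real.mul_self_sqrt (by linarith)
  have hL1 : 1 ≤ L := by
    rw [hL, Real.le_log_iff_exp_le (by positivity)]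
    linarith [Real.exp_one_lt_d9]
  have hnR : (G.n : ℝ) ≤ m + 2 := by
    have : (G.n : ℝ) ≤ ((m + 1 : ℕ) : ℝ) := by exact_mod_cast hn
    push_cast at this
    linarith
  have hn0 : (0 : ℝ) < G.n := by exact_mod_cast G.n_pos
  have hnL : Real.log G.n ≤ L := Real.log_le_log hn0 hnR
  have hρ : (ρ : ℝ) ≤ 2 * s := by
    rcases h1 with h1 | h1
    · subst h1; push_cast; linarith
    · rcases Nat.eq_zero_or_pos ρ with h0 | h0
      · subst h0; push_cast; linarith
      · obtain ⟨q, rfl⟩ : ∃ q, ρ = q + 1 := ⟨ρ - 1, by omega⟩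
        rw [Nat.add_sub_cancel] at h1
        have h3 : (q : ℝ) * q < s * s := by rw [hss]; exact_mod_cast h1
        have h4 : (q : ℝ) < s := by nlinarith [(Nat.cast_nonneg q : (0 : ℝ) ≤ q)]
        push_cast; linarith
  have hl : (l : ℝ) ≤ 5 / 2 * L := by
    rcases h2 with h2 | h2
    · subst h2; push_cast; linarith
    · have h3 := natCast_log_le G.n hnL h2
      have h4 : (l : ℝ) ≤ ((l - 1 : ℕ) : ℝ) + 1 := by exact_mod_cast (by omega : l ≤ l - 1 + 1)
      linarith
  have hu : ((updateTime G.n + 100 : ℕ) : ℝ) ≤ 500 * L := by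
    have h3 : Nat.log 2 (2 * G.n) = Nat.log 2 G.n + 1 := by
      rw [mul_comm, Nat.log_mul_base (by omega) G.n_pos.ne']
    have h4 := natCast_log_le G.n hnL (Nat.pow_log_le_self 2 G.n_pos.ne')
    rw [updateTime, h3]
    push_cast
    linarith
  have hK1 : ((ρ * (c * l) + 1 : ℕ) : ℝ) ≤ (5 * c + 1) * (s * L) := by
    have h3 : (ρ : ℝ) * l ≤ (2 * s) * (5 / 2 * L) :=
      mul_le_mul hρ hl (Nat.cast_nonneg _) (by linarith)
    have h4 := mul_le_mul_of_nonneg_left h3 (Nat.cast_nonneg c : (0 : ℝ) ≤ c)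
    have h5 : 1 ≤ s * L := one_le_mul_of_one_le_of_one_le hs1 hL1
    push_cast
    linarith
  have hp : (m : ℝ) ^ (3 / 2 : ℝ) = m * s := by
    rw [show (3 / 2 : ℝ) = 1 + 1 / 2 by norm_num, Real.rpow_add (by linarith), Real.rpow_one,
      hs, Real.sqrt_eq_rpow]
  calc (G.radiusTime m (ρ * (c * l)) : ℝ)
      ≤ ((60 * (ρ * (c * l) + 1) * ((updateTime G.n + 100) * m) : ℕ) : ℝ) := by
        exact_mod_cast radiusTime_le harcs hm (by omega)
    _ = 60 * ((ρ * (c * l) + 1 : ℕ) : ℝ) * (((updateTime G.n + 100 : ℕ) : ℝ) * m) := by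
        push_cast; ring
    _ ≤ 60 * ((5 * c + 1) * (s * L)) * ((500 * L) * m) := by
        gcongr
    _ = _ := by rw [hp]; push_cast; ring

end Net

/-- The program approximates the radius with high probability. -/
theorem computes_radius (k : ℕ) (I : BichromaticInstance) (w : ℕ)
    (hw : (6 + k) * inputBits I.encode ≤ w) :
    Computes (radiusProg (2 * (k + 1))) w I.encode
      ((30000 * (5 * (2 * (k + 1)) + 1) : ℕ) * (I.m : ℝ) ^ (3 / 2 : ℝ) * Real.log (I.m + 2) ^ 2)
      (1 - 1 / (I.n : ℝ) ^ k) (I.IsApprox (5 / 3)) := by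
  obtain ⟨s, hs⟩ := I.S_nonempty
  obtain ⟨t, ht⟩ := I.T_nonempty
  have hnm := I.n_le_m_add_one
  have hm := I.m_pos
  obtain ⟨b1, b2, b3, b4, b5⟩ := I.encodes.lt_word hm hw
  obtain ⟨K, hK, hexec⟩ := Net.exec_radius I.encodes hm b1
    ⟨t, t.isLt, (I.net_side t).2.2 ht⟩ ⟨s, s.isLt, (I.net_side s).1.2 hs⟩ b2 b3 b4 b5
  refine ⟨fun ω => ?_, ?_⟩
  · obtain ⟨τ, σ, x1, x2, -⟩ := hexec ω
    refine ⟨τ, σ, x1, le_trans ?_ (Net.radiusTime_le_real (G := I.net) rfl hm hnm hK)⟩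
    exact_mod_cast x2
  · refine (I.net.hit_probability rfl hm ?_ hK
      fun t v => I.net.dist t v * (1 + I.net.side v)).trans (MeasureTheory.measureReal_mono ?_)
    · omega
    · intro ω hω
      obtain ⟨τ, σ, x1, -, x3⟩ := hexec ω
      refine ⟨τ, σ, x1, I.isApprox_of_outcome x3 (fun i _ => ?_) fun t ht _ r hr => hω t ht r hr⟩
      exact I.net.tl_lt _ (Nat.mod_lt _ (by show 0 < 2 * I.m; omega))

end WordRAM

/-! ## The graph of an instance of Hitting Set -/

section
variable {N : ℕ}

/-- The graph on the numbers below `N` whose edges are listed in `E`. -/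
def listGraph (N : ℕ) (E : List (ℕ × ℕ)) : SimpleGraph (Fin N) where
  Adj a b := a ≠ b ∧ (((a : ℕ), (b : ℕ)) ∈ E ∨ ((b : ℕ), (a : ℕ)) ∈ E)
  symm := ⟨fun _ _ h => ⟨h.1.symm, h.2.symm⟩⟩
  loopless := ⟨fun _ h => h.1 rfl⟩

/-- A list of pairs of numbers below `N`, as a list of pairs of elements of `Fin N`. -/
def finPairs (E : List (ℕ × ℕ)) (h : ∀ e ∈ E, e.1 < e.2 ∧ e.2 < N) : List (Fin N × Fin N) :=
  E.pmap (fun e h => (⟨e.1, h.1.trans h.2⟩, ⟨e.2, h.2⟩)) h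

theorem map_finPairs {α : Type*} (f : ℕ × ℕ → α) (E : List (ℕ × ℕ))
    (h : ∀ e ∈ E, e.1 < e.2 ∧ e.2 < N) :
    (finPairs E h).map (fun e => f ((e.1 : ℕ), (e.2 : ℕ))) = E.map f := by
  rw [finPairs, List.map_pmap]
  exact List.pmap_eq_map _

theorem length_finPairs (E : List (ℕ × ℕ)) (h : ∀ e ∈ E, e.1 < e.2 ∧ e.2 < N) :
    (finPairs E h).length = E.length := List.length_pmap

theorem mem_finPairs (E : List (ℕ × ℕ)) (h : ∀ e ∈ E, e.1 < e.2 ∧ e.2 < N) (a b : Fin N) :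
    (a, b) ∈ finPairs E h ↔ ((a : ℕ), (b : ℕ)) ∈ E := by
  rw [finPairs, List.mem_pmap]
  constructor
  · rintro ⟨e, he, h1⟩
    rw [Prod.mk.injEq] at h1
    rw [← h1.1, ← h1.2]
    exact he
  · intro h1
    exact ⟨_, h1, rfl⟩

/-- All pairs are increasing, so distinct pairs cannot become equal as unordered edges. -/
theorem nodup_finPairs (E : List (ℕ × ℕ)) (h : ∀ e ∈ E, e.1 < e.2 ∧ e.2 < N) (hE : E.Nodup) :
    ((finPairs E h).map fun e => s(e.1, e.2)).Nodup := by
  have h1 : (finPairs E h).Nodup := by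
    refine List.Nodup.of_map (fun e => ((e.1 : ℕ), (e.2 : ℕ))) ?_
    rw [map_finPairs (fun e => e), List.map_id']
    exact hE
  refine List.Nodup.map_on ?_ h1
  rintro ⟨a, b⟩ h2 ⟨a', b'⟩ h3 h4
  have h5 := h _ ((mem_finPairs E h a b).1 h2)
  have h6 := h _ ((mem_finPairs E h a' b').1 h3)
  rcases Sym2.eq_iff.1 h4 with ⟨rfl, rfl⟩ | ⟨rfl, rfl⟩
  · rfl
  · dsimp only at h5 h6; omega

theorem mem_edgeSet_listGraph (E : List (ℕ × ℕ)) (h : ∀ e ∈ E, e.1 < e.2 ∧ e.2 < N)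
    (e : Sym2 (Fin N)) :
    e ∈ (finPairs E h).map (fun e => s(e.1, e.2)) ↔ e ∈ (listGraph N E).edgeSet := by
  induction e using Sym2.ind with
  | _ a b =>
    rw [SimpleGraph.mem_edgeSet, List.mem_map]
    constructor
    · rintro ⟨⟨a', b'⟩, h1, h2⟩
      rw [mem_finPairs] at h1
      have h3 := h _ h1
      have hne : a' ≠ b' := fun e => by subst e; exact lt_irrefl _ h3.1
      rcases Sym2.eq_iff.1 h2 with ⟨rfl, rfl⟩ | ⟨rfl, rfl⟩
      · exact ⟨hne, Or.inl h1⟩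
      · exact ⟨hne.symm, Or.inr h1⟩
    · rintro ⟨-, h1 | h1⟩
      · exact ⟨(a, b), (mem_finPairs E h a b).2 h1, rfl⟩
      · exact ⟨(b, a), (mem_finPairs E h b a).2 h1, Sym2.eq_swap⟩

theorem listGraph_adj {E : List (ℕ × ℕ)} (h : ∀ e ∈ E, e.1 < e.2 ∧ e.2 < N) {a b : ℕ}
    (he : (a, b) ∈ E) (ha : a < N) (hb : b < N) :
    (listGraph N E).Adj ⟨a, ha⟩ ⟨b, hb⟩ := by
  refine ⟨fun e => ?_, Or.inl he⟩
  have h1 := (h _ he).1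
  rw [Fin.mk.injEq] at e
  dsimp only at h1
  omega

end

/-- The edges that leave the vertices of the `i`-th vectors. -/
def hsRow (n d : ℕ) (u v : ℕ → ℕ → Bool) (i : ℕ) : List (ℕ × ℕ) :=
  -- Call the last three vertices x, y, z; they form a path. Each `u i` is joined to x, each `v i`
  -- to z and to its pendant copy, and every coordinate to y.
  [(i, 3 * n + d), (n + i, 3 * n + d + 2), (n + i, 2 * n + i)] ++ (List.range d).flatMap fun c =>
    (if u i c = true then [(i, 3 * n + c)] else []) ++
      if v i c = true then [(n + i, 3 * n + c)] else []

/-- The edges of the graph of an instance of Hitting Set. Its vertices are the vectors of both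
sets, a copy of the second set, the coordinates, and three more. -/
def hsEdges (n d : ℕ) (u v : ℕ → ℕ → Bool) : List (ℕ × ℕ) :=
  ((List.range n).flatMap (hsRow n d u v) ++
    (List.range d).map fun c => (3 * n + c, 3 * n + d + 1)) ++
    [(3 * n + d, 3 * n + d + 1), (3 * n + d + 1, 3 * n + d + 2)]

section
variable {n d : ℕ} {u v : ℕ → ℕ → Bool}

theorem mem_hsRow {i : ℕ} {e : ℕ × ℕ} : e ∈ hsRow n d u v i ↔
    e = (i, 3 * n + d) ∨ e = (n + i, 3 * n + d + 2) ∨ e = (n + i, 2 * n + i) ∨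
    ∃ c < d, (u i c = true ∧ e = (i, 3 * n + c)) ∨ (v i c = true ∧ e = (n + i, 3 * n + c)) := by
  simp only [hsRow, List.mem_append, List.mem_cons, List.not_mem_nil, or_false, List.mem_flatMap,
    List.mem_range, List.mem_ite_nil_right, or_assoc]

theorem mem_hsEdges {e : ℕ × ℕ} : e ∈ hsEdges n d u v ↔
    (∃ i < n, e ∈ hsRow n d u v i) ∨ (∃ c < d, e = (3 * n + c, 3 * n + d + 1)) ∨
    e = (3 * n + d, 3 * n + d + 1) ∨ e = (3 * n + d + 1, 3 * n + d + 2) := by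
  simp only [hsEdges, List.mem_append, List.mem_cons, List.not_mem_nil, or_false, List.mem_flatMap,
    List.mem_range, List.mem_map, or_assoc, eq_comm (a := e)]

theorem hsEdges_cases {p : ℕ × ℕ → Prop} (h1 : ∀ i < n, p (i, 3 * n + d))
    (h2 : ∀ i < n, p (n + i, 3 * n + d + 2)) (h3 : ∀ i < n, p (n + i, 2 * n + i))
    (h4 : ∀ i < n, ∀ c < d, u i c = true → p (i, 3 * n + c))
    (h5 : ∀ i < n, ∀ c < d, v i c = true → p (n + i, 3 * n + c))
    (h6 : ∀ c < d, p (3 * n + c, 3 * n + d + 1)) (h7 : p (3 * n + d, 3 * n + d + 1))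
    (h8 : p (3 * n + d + 1, 3 * n + d + 2)) : ∀ e ∈ hsEdges n d u v, p e := by
  intro e he
  rcases mem_hsEdges.1 he with ⟨i, hi, h⟩ | ⟨c, hc, rfl⟩ | rfl | rfl
  · rcases mem_hsRow.1 h with rfl | rfl | rfl | ⟨c, hc, ⟨hu, rfl⟩ | ⟨hv, rfl⟩⟩
    exacts [h1 i hi, h2 i hi, h3 i hi, h4 i hi c hc hu, h5 i hi c hc hv]
  exacts [h6 c hc, h7, h8]

theorem hsEdges_lt : ∀ e ∈ hsEdges n d u v, e.1 < e.2 ∧ e.2 < 3 * n + d + 3 := by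
  apply hsEdges_cases <;> intros <;> dsimp only <;> omega

theorem nodup_hsRow {i : ℕ} (hi : i < n) : (hsRow n d u v i).Nodup := by
  rw [hsRow, List.nodup_append']
  refine ⟨?_, ?_, ?_⟩
  · simp; omega
  · rw [List.nodup_flatMap]
    refine ⟨fun c _ => ?_, ?_⟩
    · split_ifs <;> simp; omega
    · refine List.nodup_range.imp_of_mem ?_
      intro c c' _ _ hcc e he he'
      apply hcc
      simp only [List.mem_append, List.mem_ite_nil_right, List.mem_singleton] at he he'
      rcases he with ⟨-, rfl⟩ | ⟨-, rfl⟩ <;> rcases he' with ⟨-, h⟩ | ⟨-, h⟩ <;>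
        rw [Prod.mk.injEq] at h <;> omega
  · intro e he he'
    simp only [List.mem_cons, List.not_mem_nil, or_false, List.mem_flatMap, List.mem_append,
      List.mem_range, List.mem_ite_nil_right] at he he'
    obtain ⟨c, hc, ⟨-, rfl⟩ | ⟨-, rfl⟩⟩ := he' <;> simp only [Prod.mk.injEq] at he <;> omega

theorem nodup_hsEdges : (hsEdges n d u v).Nodup := by
  rw [hsEdges, List.nodup_append', List.nodup_append', List.nodup_flatMap]
  refine ⟨⟨⟨fun i hi => nodup_hsRow (List.mem_range.1 hi), ?_⟩, ?_, ?_⟩, ?_, ?_⟩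
  · refine List.nodup_range.imp_of_mem ?_
    intro i i' hi hi' hne e he he'
    rw [List.mem_range] at hi hi'
    apply hne
    rw [mem_hsRow] at he he'
    have h1 : e.1 = i ∨ e.1 = n + i := by
      rcases he with rfl | rfl | rfl | ⟨c, hc, ⟨hu, rfl⟩ | ⟨hv, rfl⟩⟩ <;> simp
    have h2 : e.1 = i' ∨ e.1 = n + i' := by
      rcases he' with rfl | rfl | rfl | ⟨c, hc, ⟨hu, rfl⟩ | ⟨hv, rfl⟩⟩ <;> simp
    omega
  · refine List.nodup_range.map ?_
    intro c c' h
    simpa using h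
  · intro e he he'
    obtain ⟨i, hi, he⟩ := List.mem_flatMap.1 he
    rw [List.mem_range] at hi
    rw [mem_hsRow] at he
    obtain ⟨c, hc, rfl⟩ := List.mem_map.1 he'
    simp only [Prod.mk.injEq] at he
    omega
  · simp
  · intro e he he'
    simp only [List.mem_append, List.mem_flatMap, List.mem_range, mem_hsRow, List.mem_map,
      List.mem_cons, List.not_mem_nil, or_false] at he he'
    rcases he with ⟨i, hi, rfl | rfl | rfl | ⟨c, hc, ⟨hu, rfl⟩ | ⟨hv, rfl⟩⟩⟩ | ⟨c, hc, rfl⟩ <;>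
      simp only [Prod.mk.injEq] at he' <;> omega

theorem length_hsEdges_le : (hsEdges n d u v).length ≤ n * (3 + 2 * d) + d + 2 := by
  have h1 : ∀ i, (hsRow n d u v i).length ≤ 3 + 2 * d := by
    intro i
    rw [hsRow, List.length_append, List.length_flatMap]
    have : ((List.range d).map fun c => ((if u i c = true then [(i, 3 * n + c)] else []) ++
      if v i c = true then [(n + i, 3 * n + c)] else []).length).sum ≤
        ((List.range d).map fun c => ((if u i c = true then [(i, 3 * n + c)] else []) ++
      if v i c = true then [(n + i, 3 * n + c)] else []).length).length • 2 := by
      refine List.sum_le_card_nsmul _ _ fun x hx => ?_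
      obtain ⟨c, -, rfl⟩ := List.mem_map.1 hx
      split_ifs <;> simp
    rw [List.length_map, List.length_range, smul_eq_mul] at this
    simp only [List.length_cons, List.length_nil]
    omega
  have h2 : ((List.range n).flatMap (hsRow n d u v)).length ≤ n * (3 + 2 * d) := by
    rw [List.length_flatMap]
    refine (List.sum_le_card_nsmul _ (3 + 2 * d) fun x hx => ?_).trans ?_
    · obtain ⟨i, -, rfl⟩ := List.mem_map.1 hx
      exact h1 i
    · simp
  rw [hsEdges, List.length_append, List.length_append, List.length_map, List.length_range]
  simp only [List.length_cons, List.length_nil]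
  omega

end

section
variable {n d : ℕ} {u v : ℕ → ℕ → Bool}

theorem listGraph_hsEdges_connected :
    (listGraph (3 * n + d + 3) (hsEdges n d u v)).Connected := by
  set G := listGraph (3 * n + d + 3) (hsEdges n d u v) with hG
  have step : ∀ a b (ha : a < 3 * n + d + 3) (hb : b < 3 * n + d + 3), (a, b) ∈ hsEdges n d u v →
      G.Reachable ⟨a, ha⟩ ⟨b, hb⟩ := fun a b ha hb h => (listGraph_adj hsEdges_lt h ha hb).reachable
  have hxy := step (3 * n + d) (3 * n + d + 1) (by omega) (by omega) (mem_hsEdges.2 (by simp))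
  have hyz := step (3 * n + d + 1) (3 * n + d + 2) (by omega) (by omega) (mem_hsEdges.2 (by simp))
  have hrow : ∀ i < n, ∀ e, e ∈ hsRow n d u v i → e ∈ hsEdges n d u v :=
    fun i hi e he => mem_hsEdges.2 (Or.inl ⟨i, hi, he⟩)
  have key : ∀ a : Fin (3 * n + d + 3), G.Reachable a ⟨3 * n + d + 1, by omega⟩ := by
    rintro ⟨a, ha⟩
    by_cases h1 : a < n
    · exact (step a (3 * n + d) ha (by omega) (hrow a h1 _ (mem_hsRow.2 (by simp)))).trans hxy
    by_cases h2 : a < 2 * n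
    · obtain ⟨i, rfl⟩ : ∃ i, a = n + i := ⟨a - n, by omega⟩
      exact (step (n + i) (3 * n + d + 2) ha (by omega)
        (hrow i (by omega) _ (mem_hsRow.2 (by simp)))).trans hyz.symm
    by_cases h3 : a < 3 * n
    · obtain ⟨i, rfl⟩ : ∃ i, a = 2 * n + i := ⟨a - 2 * n, by omega⟩
      exact (step (n + i) (2 * n + i) (by omega) ha
        (hrow i (by omega) _ (mem_hsRow.2 (by simp)))).symm.trans
        ((step (n + i) (3 * n + d + 2) (by omega) (by omega)
        (hrow i (by omega) _ (mem_hsRow.2 (by simp)))).trans hyz.symm)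
    by_cases h4 : a < 3 * n + d
    · obtain ⟨c, rfl⟩ : ∃ c, a = 3 * n + c := ⟨a - 3 * n, by omega⟩
      exact step _ _ ha (by omega) (mem_hsEdges.2 (Or.inr (Or.inl ⟨c, by omega, rfl⟩)))
    obtain rfl | rfl | rfl : a = 3 * n + d ∨ a = 3 * n + d + 1 ∨ a = 3 * n + d + 2 := by omega
    exacts [hxy, SimpleGraph.Reachable.rfl, hyz.symm]
  have : Nonempty (Fin (3 * n + d + 3)) := ⟨⟨0, by omega⟩⟩
  exact ⟨fun a b => (key a).trans (key b).symm⟩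

/-- The unweighted instance of Bichromatic Radius for an instance of Hitting Set. -/
def hsGraph (n d : ℕ) (hn : 0 < n) (u v : ℕ → ℕ → Bool) : BichromaticInstance where
  n := 3 * n + d + 3
  G := listGraph (3 * n + d + 3) (hsEdges n d u v)
  wt := fun _ => 1
  S := Finset.univ.filter fun a => (a : ℕ) < n
  edges := finPairs (hsEdges n d u v) hsEdges_lt
  connected := listGraph_hsEdges_connected
  S_nonempty := ⟨⟨0, by omega⟩, by simpa using hn⟩
  T_nonempty := ⟨⟨n, by omega⟩, by simp⟩
  edges_nodup := nodup_finPairs _ _ nodup_hsEdges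
  mem_edges := mem_edgeSet_listGraph _ _

theorem hsGraph_unweighted (hn : 0 < n) : (hsGraph n d hn u v).Unweighted := fun _ _ => rfl

theorem hsGraph_m (hn : 0 < n) : (hsGraph n d hn u v).m = (hsEdges n d u v).length :=
  length_finPairs _ _

theorem hsGraph_encode (hn : 0 < n) : (hsGraph n d hn u v).encode =
    (3 * n + d + 3) :: (hsEdges n d u v).length ::
      ((List.range (3 * n + d + 3)).map (fun a => if a < n then 1 else 0) ++
        (hsEdges n d u v).flatMap fun e => [e.1, e.2, 1]) := by
  have h1 : (List.ofFn fun a : Fin (hsGraph n d hn u v).n =>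
      if a ∈ (hsGraph n d hn u v).S then 1 else 0) =
      (List.range (3 * n + d + 3)).map (fun a => if a < n then 1 else 0) := by
    refine List.ext_getElem (by rw [List.length_ofFn, List.length_map, List.length_range]; rfl)
      fun i h1 h2 => ?_
    rw [List.getElem_ofFn, List.getElem_map, List.getElem_range]
    exact if_congr (Finset.mem_filter.trans (and_iff_right (Finset.mem_univ _))) rfl rfl
  rw [BichromaticInstance.encode, hsGraph_m, h1]
  congr 3
  rw [List.flatMap_def, List.flatMap_def]
  congr 1
  exact map_finPairs (fun e => [e.1, e.2, 1]) _ _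

/-- Some vector `u i` is non-orthogonal to every vector `v j`. -/
def Hits (n d : ℕ) (u v : ℕ → ℕ → Bool) : Prop :=
  ∃ i < n, ∀ j < n, ∃ c < d, u i c = true ∧ v j c = true

/-- From a hitting `u i`, each `v j` is two steps away through a common coordinate and its copy
three. The path to x and y takes two steps, and coordinates and z are adjacent to y. The other
vectors of the first set lie in `S` and do not count. -/
theorem radius_hsGraph_le (hn : 0 < n) (h : Hits n d u v) : (hsGraph n d hn u v).radius ≤ 3 := by
  obtain ⟨i, hi, hj⟩ := h
  set I := hsGraph n d hn u v with hI
  have hS : (⟨i, by show i < 3 * n + d + 3; omega⟩ : Fin I.n) ∈ I.S :=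
    Finset.mem_filter.2 ⟨Finset.mem_univ _, hi⟩
  refine (I.radius_le hS).trans (I.ecc_le ?_)
  have step : ∀ k a b (ha : a < I.n) (hb : b < I.n),
      ((a, b) ∈ hsEdges n d u v ∨ (b, a) ∈ hsEdges n d u v) →
      weightedDist I.G I.wt ⟨i, by show i < 3 * n + d + 3; omega⟩ ⟨a, ha⟩ ≤ k →
      weightedDist I.G I.wt ⟨i, by show i < 3 * n + d + 3; omega⟩ ⟨b, hb⟩ ≤ k + 1 := by
    intro k a b ha hb hab hk
    have hadj : I.G.Adj ⟨a, ha⟩ ⟨b, hb⟩ := by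
      rcases hab with h | h
      · exact listGraph_adj hsEdges_lt h ha hb
      · exact (listGraph_adj hsEdges_lt h hb ha).symm
    exact (weightedDist_triangle I.connected _ ⟨a, ha⟩ _).trans
      (Nat.add_le_add hk (weightedDist_adj hadj))
  have hrow : ∀ i < n, ∀ e, e ∈ hsRow n d u v i → e ∈ hsEdges n d u v :=
    fun i hi e he => mem_hsEdges.2 (Or.inl ⟨i, hi, he⟩)
  have hlt : ∀ {a}, a < 3 * n + d + 3 → a < I.n := fun h => h
  have hx := step 0 i (3 * n + d) (hlt (by omega)) (hlt (by omega))
    (Or.inl (hrow i hi _ (mem_hsRow.2 (by simp)))) (weightedDist_self _).le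
  have hy := step 1 (3 * n + d) (3 * n + d + 1) (hlt (by omega)) (hlt (by omega))
    (Or.inl (mem_hsEdges.2 (by simp))) hx
  rintro ⟨a, ha⟩ hat
  have h1 : ¬ a < n := fun h =>
    (Finset.mem_compl.1 hat) (Finset.mem_filter.2 ⟨Finset.mem_univ _, h⟩)
  have ha' : a < 3 * n + d + 3 := ha
  have hW : ∀ j, j < n → ∀ hb : n + j < I.n,
      weightedDist I.G I.wt ⟨i, by show i < 3 * n + d + 3; omega⟩ ⟨n + j, hb⟩ ≤ 2 := by
    intro j hjn hb
    obtain ⟨c, hc, huc, hvc⟩ := hj j hjn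
    refine step 1 (3 * n + c) (n + j) (hlt (by omega)) hb (Or.inr (hrow j hjn _
      (mem_hsRow.2 (Or.inr (Or.inr (Or.inr ⟨c, hc, Or.inr ⟨hvc, rfl⟩⟩)))))) ?_
    exact step 0 i (3 * n + c) (hlt (by omega)) (hlt (by omega)) (Or.inl (hrow i hi _
      (mem_hsRow.2 (Or.inr (Or.inr (Or.inr ⟨c, hc, Or.inl ⟨huc, rfl⟩⟩))))))
      (weightedDist_self _).le
  by_cases h2 : a < 2 * n
  · obtain ⟨j, rfl⟩ : ∃ j, a = n + j := ⟨a - n, by omega⟩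
    exact (hW j (by omega) ha).trans (by omega)
  by_cases h3 : a < 3 * n
  · obtain ⟨j, rfl⟩ : ∃ j, a = 2 * n + j := ⟨a - 2 * n, by omega⟩
    exact step 2 (n + j) (2 * n + j) (hlt (by omega)) ha
      (Or.inl (hrow j (by omega) _ (mem_hsRow.2 (by simp)))) (hW j (by omega) _)
  by_cases h4 : a < 3 * n + d
  · obtain ⟨c, rfl⟩ : ∃ c, a = 3 * n + c := ⟨a - 3 * n, by omega⟩
    exact step 2 (3 * n + d + 1) (3 * n + c) (hlt (by omega)) ha
      (Or.inr (mem_hsEdges.2 (Or.inr (Or.inl ⟨c, by omega, rfl⟩)))) hy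
  obtain rfl | rfl | rfl : a = 3 * n + d ∨ a = 3 * n + d + 1 ∨ a = 3 * n + d + 2 := by omega
  · exact hx.trans (by omega)
  · exact hy.trans (by omega)
  · exact step 2 (3 * n + d + 1) (3 * n + d + 2) (hlt (by omega)) ha
      (Or.inl (mem_hsEdges.2 (by simp))) hy

/-- A lower bound for the distances from the vector `u i` if it is orthogonal to `v j`. -/
def hsPotential (n d : ℕ) (u : ℕ → ℕ → Bool) (i j p : ℕ) : ℕ :=
  if p < n then (if p = i then 0 else 2)
  else if p < 2 * n then (if p = n + j then 4 else 2)
  else if p < 3 * n then (if p = 2 * n + j then 5 else 3)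
  else if p < 3 * n + d then (if u i (p - 3 * n) = true then 1 else 3)
  else p - (3 * n + d) + 1

/-- `hsPotential` changes by at most one along every edge, so its value `5` at the copy of `v j`
bounds the distance from `u i`. Orthogonality enters at the edges from `v j` to its coordinates
only: these are not coordinates of `u i` and so have value `3`, not `1`. -/
theorem le_radius_hsGraph (hn : 0 < n) (h : ¬ Hits n d u v) : 5 ≤ (hsGraph n d hn u v).radius := by
  set I := hsGraph n d hn u v with hI
  obtain ⟨⟨i, hi'⟩, hi, hr⟩ := I.exists_ecc_eq_radius
  have hin : i < n := (Finset.mem_filter.1 hi).2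
  obtain ⟨j, hj, hij⟩ : ∃ j < n, ∀ c < d, u i c = true → v j c ≠ true := by
    by_contra hc
    push Not at hc
    exact h ⟨i, hin, hc⟩
  rw [← hr]
  have hjlt : 2 * n + j < I.n := by show 2 * n + j < 3 * n + d + 3; omega
  have hT : (⟨2 * n + j, hjlt⟩ : Fin I.n) ∈ I.Sᶜ := by
    refine Finset.mem_compl.2 fun h => ?_
    have : 2 * n + j < n := (Finset.mem_filter.1 h).2
    omega
  refine le_trans ?_ (I.weightedDist_le_ecc hT)
  have hL : ∀ e ∈ hsEdges n d u v, hsPotential n d u i j e.2 ≤ hsPotential n d u i j e.1 + 1 ∧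
      hsPotential n d u i j e.1 ≤ hsPotential n d u i j e.2 + 1 := by
    have eU : ∀ k < n, hsPotential n d u i j k = if k = i then 0 else 2 := by
      intro k hk; simp [hsPotential, hk]
    have eW : ∀ k < n, hsPotential n d u i j (n + k) = if k = j then 4 else 2 := by
      intro k hk
      simp [hsPotential, show n + k < 2 * n by omega]
    have eW2 : ∀ k < n, hsPotential n d u i j (2 * n + k) = if k = j then 5 else 3 := by
      intro k hk
      simp [hsPotential, show ¬ 2 * n + k < n by omega, show 2 * n + k < 3 * n by omega]
    have eC : ∀ c < d, hsPotential n d u i j (3 * n + c) = if u i c = true then 1 else 3 := by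
      intro c hc
      simp [hsPotential, show ¬ 3 * n + c < n by omega, show ¬ 3 * n + c < 2 * n by omega, hc]
    have eX : ∀ q, hsPotential n d u i j (3 * n + d + q) = q + 1 := by
      intro q
      simp [hsPotential, show ¬ 3 * n + d + q < n by omega, show ¬ 3 * n + d + q < 2 * n by omega,
        show ¬ 3 * n + d + q < 3 * n by omega]
    have eX0 := eX 0
    rw [add_zero] at eX0
    apply hsEdges_cases
    · intro k hk; simp only [eU k hk, eX0]; split_ifs <;> omega
    · intro k hk; simp only [eW k hk, eX]; split_ifs <;> omega
    · intro k hk; simp only [eW k hk, eW2 k hk]; split_ifs <;> omega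
    · intro k hk c hc hu
      simp only [eU k hk, eC c hc]
      by_cases e : k = i
      · subst e; simp [hu]
      · simp only [e, if_false]; split_ifs <;> omega
    · intro k hk c hc hv
      simp only [eW k hk, eC c hc]
      by_cases e : k = j
      · subst e
        rw [if_neg fun hu => hij c hc hu hv]
        simp
      · simp only [e, if_false]; split_ifs <;> omega
    · intro c hc; simp only [eC c hc, eX]; split_ifs <;> omega
    · simp only [eX0, eX]; omega
    · simp only [eX]; omega
  have hpi : hsPotential n d u i j i = 0 := by simp [hsPotential, hin]
  have hpj : hsPotential n d u i j (2 * n + j) = 5 := by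
    simp [hsPotential, show ¬ 2 * n + j < n by omega, show 2 * n + j < 3 * n by omega]
  rw [← hpj]
  refine le_weightedDist I.connected (D := fun a => hsPotential n d u i j a)
    (u := ⟨i, hi'⟩) (v := ⟨2 * n + j, hjlt⟩) ?_ hpi
  rintro a b ⟨-, hab | hab⟩
  · exact (hL _ hab).1
  · exact (hL _ hab).2

theorem isApprox_hsGraph_iff (hn : 0 < n) {ε : ℝ} (hε : 0 < ε) {r : ℕ}
    (hr : (hsGraph n d hn u v).IsApprox (5 / 3 - ε) r) : r < 5 ↔ Hits n d u v := by
  constructor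
  · intro h
    by_contra hc
    have := le_radius_hsGraph hn hc
    have := hr.1
    omega
  · intro h
    have h1 : ((hsGraph n d hn u v).radius : ℝ) ≤ 3 := by exact_mod_cast radius_hsGraph_le hn h
    have h0 : (0 : ℝ) ≤ (hsGraph n d hn u v).radius := Nat.cast_nonneg _
    have h2 := hr.2
    have h3 : (r : ℝ) < 5 := by
      rcases h0.eq_or_lt with h4 | h4
      · rw [← h4] at h2; linarith
      · nlinarith
    exact_mod_cast h3

end

namespace WordRAM

/-! ## The reduction program -/

/-- Append an edge of weight `1`, from `a` to `b`, to the list of edges. The variable `3` holds the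
address behind the list, and the variable `4` the length of the list. -/
def emitEdge (a b : Expr) : Stm :=
  .set 12 a ;; .set 13 b ;; .wr 0 (.var 3) (.var 12) ;; .wr 0 (.var 3 + 1) (.var 13) ;;
  .wr 0 (.var 3 + 2) 1 ;; .set 3 (.var 3 + 3) ;; .set 4 (.var 4 + 1)

/-- Write the number of vertices and the indicator vector. -/
def headProg : Prog :=
  Stm.comp (.set 1 (.rd 0 0) ;; .set 2 (.rd 0 1) ;; .set 9 (2 + 2 * (.var 1 * .var 2)) ;;
    .set 7 (3 * .var 1 + .var 2) ;; .set 8 (.var 7 + 3) ;; .wr 0 (.var 9) (.var 8) ;;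
    .set 3 (.var 9 + 2)) ;>
  forLoop 5 8 (Stm.comp (.wr 0 (.var 3) (.lt (.var 5) (.var 1)) ;; .set 3 (.var 3 + 1)))

/-- Write the edges between the `i`-th vectors and the coordinates, with `i` in the variable `5`. -/
def coordProg : Prog :=
  forLoop 6 2
    (whenProg (.rd 0 (2 + (.var 5 * .var 2 + .var 6)))
      (emitEdge (.var 5) (3 * .var 1 + .var 6)).comp ;>
    whenProg (.rd 0 (2 + (.var 1 * .var 2 + (.var 5 * .var 2 + .var 6))))
      (emitEdge (.var 1 + .var 5) (3 * .var 1 + .var 6)).comp)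

/-- Write the edges. -/
def edgesProg : Prog :=
  forLoop 5 1
    ((emitEdge (.var 5) (.var 7)).comp ;> (emitEdge (.var 1 + .var 5) (.var 7 + 2)).comp ;>
      (emitEdge (.var 1 + .var 5) (2 * .var 1 + .var 5)).comp ;> coordProg) ;>
  forLoop 5 2 (emitEdge (3 * .var 1 + .var 5) (.var 7 + 1)).comp ;>
  (emitEdge (.var 7) (.var 7 + 1)).comp ;> (emitEdge (.var 7 + 1) (.var 7 + 2)).comp

/-- Replace the input by what has been written behind it. -/
def moveProg : Prog :=
  Stm.comp (.set 10 (.var 3 - .var 9)) ;>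
  -- Copying upwards is safe: each source lies ahead of its target by the length of the input, so it
  -- is read before it is overwritten.
  forLoop 5 10 (Stm.comp (.wr 0 (.var 5) (.rd 0 (.var 9 + .var 5)))) ;>
  -- The cells behind the moved list have to be zero again, as in an initial state.
  forLoop 5 9 (Stm.comp (.wr 0 (.var 10 + .var 5) 0)) ;>
  -- The number of edges is known only now; `hsHead` has left a gap for it.
  Stm.comp (.wr 0 1 (.var 4))

/-- Replace an instance of Hitting Set by its graph. -/
def reduceProg : Prog := headProg ;> edgesProg ;> moveProg

section
variable {w : ℕ} {Γ : Layout w} {ω : Tape w} {n d : ℕ} {u v : ℕ → ℕ → Bool}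

/-- The memory is described as a list padded with zeros, so that writing just behind the list
appends to it. -/
theorem update_getD_append (l : List ℕ) (e : ℕ) (f : ℕ → ℕ) (hf : ∀ a, f a = l.getD a 0) (a : ℕ) :
    Function.update f l.length e a = (l ++ [e]).getD a 0 := by
  rw [Function.update_apply, hf]
  split_ifs with h
  · subst h
    rw [List.getD_append_right _ _ _ _ (le_refl _)]
    simp
  · rcases lt_or_ge a l.length with h1 | h1
    · rw [List.getD_append _ _ _ _ h1]
    · rw [List.getD_append_right _ _ _ _ h1, List.getD_eq_default _ _ h1,
        List.getD_eq_default _ _ (by simp; omega)]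

/-- The number of vertices, a gap, and the indicator vector of the first `k` vertices. -/
def hsHead (n d k : ℕ) : List ℕ :=
  (3 * n + d + 3) :: 0 :: (List.range k).map (fun a => if a < n then 1 else 0)

theorem length_hsHead (k : ℕ) : (hsHead n d k).length = 2 + k := by
  simp [hsHead]; omega

/-- The words that encode a list of edges of weight `1`. -/
def edgeWords (E : List (ℕ × ℕ)) : List ℕ := E.flatMap fun e => [e.1, e.2, 1]

theorem length_edgeWords (E : List (ℕ × ℕ)) : (edgeWords E).length = 3 * E.length := by
  induction E with
  | nil => rfl
  | cons e E ih =>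
    rw [edgeWords] at ih ⊢
    rw [List.flatMap_cons, List.length_append, ih]
    simp only [List.length_cons, List.length_nil]
    omega

/-- The input `x` is an encoding of the vectors. -/
structure HSInput (n d : ℕ) (u v : ℕ → ℕ → Bool) (x : List ℕ) : Prop where
  length : x.length = 2 + 2 * (n * d)
  fst : x.getD 0 0 = n
  snd : x.getD 1 0 = d
  left : ∀ i < n, ∀ c < d, x.getD (2 + (i * d + c)) 0 = (u i c).toNat
  right : ∀ i < n, ∀ c < d, x.getD (2 + (n * d + (i * d + c))) 0 = (v i c).toNat

/-- The edges in the list `E` have been written. -/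
structure Written (n d : ℕ) (x : List ℕ) (E : List (ℕ × ℕ)) (s : Store) : Prop where
  fst : s.var 1 = n
  snd : s.var 2 = d
  pos : s.var 3 = x.length + (2 + (3 * n + d + 3)) + 3 * E.length
  count : s.var 4 = E.length
  apex : s.var 7 = 3 * n + d
  len : s.var 9 = x.length
  mem : ∀ a, s.arr 0 a = (x ++ hsHead n d (3 * n + d + 3) ++ edgeWords E).getD a 0
  used : s.used = 0

theorem Written.setVar {x : List ℕ} {E : List (ℕ × ℕ)} {s : Store} (h : Written n d x E s) (y k : ℕ)
    (hy : y = 5 ∨ y = 6) : Written n d x E (s.setVar y k) := by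
  have hne : ∀ z, z ≠ 5 → z ≠ 6 → (s.setVar y k).var z = s.var z := by
    intro z h1 h2
    rw [Store.setVar_var, if_neg (by omega)]
  exact ⟨(hne 1 (by omega) (by omega)).trans h.fst, (hne 2 (by omega) (by omega)).trans h.snd,
    (hne 3 (by omega) (by omega)).trans h.pos, (hne 4 (by omega) (by omega)).trans h.count,
    (hne 7 (by omega) (by omega)).trans h.apex, (hne 9 (by omega) (by omega)).trans h.len,
    h.mem, h.used⟩

theorem wp_emitEdge {x : List ℕ} {E : List (ℕ × ℕ)} {s : Store} {a b : Expr} {α β T : ℕ}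
    {Q : Store → Prop} (hΓ : Γ.base = 2 ^ w) (h : Written n d x E s)
    (hlen : x.length + (2 + (3 * n + d + 3)) + 3 * E.length + 3 < 2 ^ w)
    (ha : a.Safe Γ s) (haα : a.eval s = α) (hb : b.Safe Γ (s.setVar 12 α))
    (hbβ : b.eval (s.setVar 12 α) = β) (hT : (emitEdge a b).cost ≤ T)
    (hQ : ∀ s', Written n d x (E ++ [(α, β)]) s' → s'.var 5 = s.var 5 → s'.var 6 = s.var 6 → Q s') :
    wp Γ ω (emitEdge a b).comp T Q s := by
  have hv := Γ.valid_zero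
  have hw := Γ.one_le
  have h3 := h.pos
  have h4 := h.count
  refine wp_stm _ ?_ hT ?_
  · simp [emitEdge, ha, haα, hb, hv, hΓ, h3, h4]
    omega
  · set l := x ++ hsHead n d (3 * n + d + 3) ++ edgeWords E with hl
    have hll : l.length = s.var 3 := by
      rw [hl, List.length_append, List.length_append, length_hsHead, length_edgeWords, h3]
    have e : (emitEdge a b).run s = (((((((s.setVar 12 α).setVar 13 β).setArr 0 (s.var 3)
        α).setArr 0 (s.var 3 + 1) β).setArr 0 (s.var 3 + 2) 1).setVar 3 (s.var 3 + 3)).setVar 4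
        (s.var 4 + 1)) := by
      simp [emitEdge, haα, hbβ]
    rw [e]
    refine hQ _ ⟨by simpa using h.fst, by simpa using h.snd, ?_, ?_, by simpa using h.apex,
      by simpa using h.len, ?_, h.used⟩ (by simp) (by simp)
    · simp only [Store.setVar_var, List.length_append, List.length_singleton]
      simp [h3]; omega
    · simp [h4]
    · intro i
      have e1 : x ++ hsHead n d (3 * n + d + 3) ++ edgeWords (E ++ [(α, β)]) =
          ((l ++ [α]) ++ [β]) ++ [1] := by
        simp [hl, edgeWords]
      rw [e1]
      simp only [Store.setVar_arr, Store.setArr_arr, if_true]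
      have f1 := update_getD_append l α (s.arr 0) h.mem
      have f2 := update_getD_append _ β _ f1
      have f3 := update_getD_append _ 1 _ f2
      rw [← f3]
      simp [hll]

end
end WordRAM

namespace WordRAM

section
variable {w : ℕ} {Γ : Layout w} {ω : Tape w} {n d : ℕ} {u v : ℕ → ℕ → Bool} {x : List ℕ}

theorem wp_head {s : Store} (hx : HSInput n d u v x) (hΓ : Γ.base = 2 ^ w)
    (hlen : x.length + (2 + (3 * n + d + 3)) + 3 < 2 ^ w) (h0 : ∀ a, s.arr 0 a = x.getD a 0)
    (h4 : s.var 4 = 0) (hu : s.used = 0) :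
    wp Γ ω headProg (40 * (3 * n + d + 3) + 106) (Written n d x []) s := by
  have hv := Γ.valid_zero
  have hw := Γ.one_le
  have hl := hx.length
  have e1 : (Stm.set 1 (.rd 0 0) ;; .set 2 (.rd 0 1) ;; .set 9 (2 + 2 * (.var 1 * .var 2)) ;;
    .set 7 (3 * .var 1 + .var 2) ;; .set 8 (.var 7 + 3) ;; .wr 0 (.var 9) (.var 8) ;;
    .set 3 (.var 9 + 2)).run s = ((((((s.setVar 1 n).setVar 2 d).setVar 9 x.length).setVar 7
      (3 * n + d)).setVar 8 (3 * n + d + 3)).setArr 0 x.length (3 * n + d + 3)).setVar 3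
      (x.length + 2) := by
    simp [-List.getD_eq_getElem?_getD, h0, hx.fst, hx.snd, hl]
  refine wp_seq (T1 := 100) (T2 := 40 * (3 * n + d + 3) + 6) (by omega)
    (wp_stm _ ?_ (by decide) ?_)
  · simp [-List.getD_eq_getElem?_getD, h0, hx.fst, hx.snd, hv, hΓ]
    omega
  rw [e1]
  refine wp_for (N := 3 * n + d + 3) (T := 32) (fun k s' => s'.var 1 = n ∧ s'.var 2 = d ∧
      s'.var 3 = x.length + (2 + k) ∧ s'.var 4 = 0 ∧ s'.var 7 = 3 * n + d ∧
      s'.var 9 = x.length ∧ (∀ a, s'.arr 0 a = (x ++ hsHead n d k).getD a 0) ∧ s'.used = 0)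
    (by decide) (by decide) (by decide) (by omega) (by simp) ?_ ?_ (by omega) ?_
  · refine ⟨by simp, by simp, by simp, by simpa using h4, by simp, by simp, fun a => ?_, hu⟩
    simp only [Store.setVar_arr, Store.setArr_arr, if_true]
    rw [update_getD_append x _ _ h0]
    by_cases ha : a = x.length + 1
    · subst ha
      rw [List.getD_append_right _ _ _ _ (by omega), List.getD_append_right _ _ _ _ (by omega)]
      simp [hsHead]
    · rcases lt_or_ge a (x ++ [3 * n + d + 3]).length with h | h
      · rw [show x ++ hsHead n d 0 = (x ++ [3 * n + d + 3]) ++ [0] by simp [hsHead],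
          List.getD_append _ _ _ _ h]
      · simp only [List.length_append, List.length_singleton] at h
        rw [List.getD_eq_default _ _ (by simpa using h),
          List.getD_eq_default _ _ (by simp [length_hsHead]; omega)]
  · rintro k hk s' c1 c2 ⟨d1, d2, d3, d4, d5, d6, d7, d8⟩
    refine wp_stm _ ?_ (by decide) ?_
    · simp [hv, hΓ, d3]
      omega
    · have e2 : (Stm.wr 0 (.var 3) (.lt (.var 5) (.var 1)) ;; .set 3 (.var 3 + 1)).run s' =
          (s'.setArr 0 (x.length + (2 + k)) (if k < n then 1 else 0)).setVar 3
            (x.length + (2 + (k + 1))) := by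
        simp [c1, d1, d3, add_assoc]
      rw [e2]
      refine ⟨by simpa using c1, by simpa using c2, by simpa using d1, by simpa using d2, by simp,
        by simpa using d4, by simpa using d5, by simpa using d6, fun a => ?_, d8⟩
      have hll : (x ++ hsHead n d k).length = x.length + (2 + k) := by
        rw [List.length_append, length_hsHead]
      simp only [Store.setVar_arr, Store.setArr_arr, if_true]
      rw [← hll, update_getD_append _ _ _ d7, hsHead, hsHead, List.range_succ]
      simp
  · rintro s' c1 c2 ⟨d1, d2, d3, d4, d5, d6, d7, d8⟩
    exact ⟨d1, d2, by simpa using d3, d4, d5, d6, by simpa [edgeWords] using d7, d8⟩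

/-- The edges between the `i`-th vectors and the first `k` coordinates. -/
def coordEdges (n : ℕ) (u v : ℕ → ℕ → Bool) (i k : ℕ) : List (ℕ × ℕ) :=
  (List.range k).flatMap fun c => (if u i c = true then [(i, 3 * n + c)] else []) ++
      if v i c = true then [(n + i, 3 * n + c)] else []

theorem wp_coord {s : Store} {E : List (ℕ × ℕ)} {i : ℕ} (hx : HSInput n d u v x)
    (hΓ : Γ.base = 2 ^ w) (h : Written n d x E s) (hi : s.var 5 = i) (hin : i < n)
    (hlen : x.length + (2 + (3 * n + d + 3)) + 3 * (E.length + 2 * d) + 3 < 2 ^ w) :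
    wp Γ ω coordProg (300 * d + 6) (fun s' => s'.var 5 = i ∧
      Written n d x (E ++ coordEdges n u v i d) s') s := by
  have hv := Γ.valid_zero
  have hw := Γ.one_le
  have hl := hx.length
  have hread : ∀ (F : List (ℕ × ℕ)) (s' : Store), Written n d x F s' → ∀ a < x.length,
      s'.arr 0 a = x.getD a 0 := by
    intro F s' hF a ha
    rw [hF.mem, List.append_assoc, List.getD_append _ _ _ _ ha]
  refine wp_for (N := d) (T := 292) (fun k s' => s'.var 5 = i ∧
      Written n d x (E ++ coordEdges n u v i k) s' ∧
      (coordEdges n u v i k).length ≤ 2 * k)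
    (by decide) (by decide) (by decide) (by omega) h.snd ?_ ?_ (by omega) ?_
  · refine ⟨by simpa using hi, ?_, by simp [coordEdges]⟩
    simpa [coordEdges] using h.setVar 6 0 (Or.inr rfl)
  · rintro k hk s' c1 c2 ⟨d1, d2, d3⟩
    have hidx : i * d + k < n * d := by
      calc i * d + k < i * d + d := by omega
        _ = (i + 1) * d := by ring
        _ ≤ n * d := Nat.mul_le_mul_right _ hin
    have hid : i * d ≤ n * d := Nat.mul_le_mul_right _ hin.le
    set F := E ++ coordEdges n u v i k with hF
    have hFl : F.length ≤ E.length + 2 * k := by rw [hF, List.length_append]; omega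
    have r1 : s'.arr 0 (2 + (i * d + k)) = (u i k).toNat := by
      rw [hread _ _ d2 _ (by omega), hx.left i hin k hk]
    set F' := F ++ (if u i k = true then [(i, 3 * n + k)] else []) with hF'
    have hFl' : F'.length ≤ F.length + 1 := by
      rw [hF', List.length_append]; split_ifs <;> simp
    have hstep : coordEdges n u v i (k + 1) = coordEdges n u v i k ++
        ((if u i k = true then [(i, 3 * n + k)] else []) ++
          if v i k = true then [(n + i, 3 * n + k)] else []) := by
      simp [coordEdges, List.range_succ]
    have hfin : E ++ coordEdges n u v i (k + 1) =
        F' ++ (if v i k = true then [(n + i, 3 * n + k)] else []) := by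
      rw [hstep, hF', hF]; simp only [List.append_assoc]
    have hfl : (coordEdges n u v i (k + 1)).length ≤ 2 * (k + 1) := by
      rw [hstep, List.length_append, List.length_append]
      split_ifs <;> simp <;> omega
    refine wp_seq (T1 := 140) (T2 := 150) (by omega) ?_
    have first : wp Γ ω (whenProg (.rd 0 (2 + (.var 5 * .var 2 + .var 6)))
        (emitEdge (.var 5) (3 * .var 1 + .var 6)).comp) 140
        (fun s' => s'.var 5 = i ∧ s'.var 6 = k ∧ Written n d x F' s') s' := by
      refine wp_mono (wp_when (T := 100) ?_ ?_ ?_) (by decide) (fun _ h => h)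
      · simp [hv, hΓ, d1, c1, c2]; omega
      · intro hne
        simp only [Expr.eval_rd, Expr.eval_add, Expr.eval_mul, Expr.eval_num, Expr.eval_var, d1, c1,
          c2, r1] at hne
        have hui : u i k = true := by
          cases hc : u i k
          · simp [hc] at hne
          · rfl
        refine wp_emitEdge hΓ d2 (α := i) (β := 3 * n + k) (by omega) (by simp) (by simp [d1])
          (by simp [d2.fst, c1]; omega) (by simp [d2.fst, c1]) (by decide) ?_
        intro s'' f1 f2 f3
        refine ⟨f2.trans d1, f3.trans c1, ?_⟩
        rw [hF', if_pos hui]; exact f1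
      · intro hne
        simp only [Expr.eval_rd, Expr.eval_add, Expr.eval_mul, Expr.eval_num, Expr.eval_var, d1, c1,
          c2, r1] at hne
        have hui : ¬ u i k = true := fun hc => by simp [hc] at hne
        refine ⟨d1, c1, ?_⟩
        rw [hF', if_neg hui, List.append_nil]; exact d2
    refine wp_mono first (le_refl _) ?_
    rintro s2 ⟨g1, g2, g3⟩
    have r2 : s2.arr 0 (2 + (n * d + (i * d + k))) = (v i k).toNat := by
      rw [hread _ _ g3 _ (by omega), hx.right i hin k hk]
    refine wp_mono (wp_when (T := 100) ?_ ?_ ?_) (by decide) (fun _ h => h)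
    · simp [hv, hΓ, g1, g2, g3.fst, g3.snd]; omega
    · intro hne
      simp only [Expr.eval_rd, Expr.eval_add, Expr.eval_mul, Expr.eval_num, Expr.eval_var, g1, g2,
        g3.fst, g3.snd, r2] at hne
      have hvi : v i k = true := by
        cases hc : v i k
        · simp [hc] at hne
        · rfl
      refine wp_emitEdge hΓ g3 (α := n + i) (β := 3 * n + k) (by omega)
        (by simp [g3.fst, g1]; omega) (by simp [g3.fst, g1])
        (by simp [g3.fst, g2]; omega) (by simp [g3.fst, g2]) (by decide) ?_
      intro s'' f1 f2 f3
      refine ⟨f3.trans g2, f1.snd, ?_, ?_, hfl⟩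
      · simpa using f2.trans g1
      · rw [hfin, if_pos hvi]; exact f1.setVar 6 _ (Or.inr rfl)
    · intro hne
      simp only [Expr.eval_rd, Expr.eval_add, Expr.eval_mul, Expr.eval_num, Expr.eval_var, g1, g2,
        g3.fst, g3.snd, r2] at hne
      have hvi : ¬ v i k = true := fun hc => by simp [hc] at hne
      refine ⟨g2, g3.snd, by simpa using g1, ?_, hfl⟩
      rw [hfin, if_neg hvi, List.append_nil]; exact g3.setVar 6 _ (Or.inr rfl)
  · rintro s' c1 c2 ⟨d1, d2, d3⟩
    exact ⟨d1, d2⟩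

end
end WordRAM

namespace WordRAM

section
variable {w : ℕ} {Γ : Layout w} {ω : Tape w} {n d : ℕ} {u v : ℕ → ℕ → Bool} {x : List ℕ}

theorem hsRow_eq (i : ℕ) : hsRow n d u v i =
    [(i, 3 * n + d), (n + i, 3 * n + d + 2), (n + i, 2 * n + i)] ++ coordEdges n u v i d := rfl

theorem length_coordEdges_le (i k : ℕ) : (coordEdges n u v i k).length ≤ 2 * k := by
  induction k with
  | zero => simp [coordEdges]
  | succ k ih =>
    have hstep : coordEdges n u v i (k + 1) = coordEdges n u v i k ++
        ((if u i k = true then [(i, 3 * n + k)] else []) ++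
          if v i k = true then [(n + i, 3 * n + k)] else []) := by
      simp [coordEdges, List.range_succ]
    rw [hstep, List.length_append, List.length_append]
    split_ifs <;> simp <;> omega

theorem wp_edges {s : Store} (hx : HSInput n d u v x) (hΓ : Γ.base = 2 ^ w)
    (h : Written n d x [] s) (hlen : x.length + (2 + (3 * n + d + 3)) +
      3 * (n * (3 + 2 * d) + d + 2) + 3 < 2 ^ w) :
    wp Γ ω edgesProg (n * (300 * d + 320) + 108 * d + 212)
      (Written n d x (hsEdges n d u v)) s := by
  have hw := Γ.one_le
  have hl := hx.length
  refine wp_seq (T1 := n * (300 * d + 320) + 6) (T2 := 108 * d + 206) (by omega) ?_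
  refine wp_for (N := n) (T := 300 * d + 310) (fun k s' =>
      Written n d x ((List.range k).flatMap (hsRow n d u v)) s' ∧
      ((List.range k).flatMap (hsRow n d u v)).length ≤ k * (3 + 2 * d))
    (by decide) (by decide) (by decide) (by omega) h.fst ?_ ?_ (by nlinarith) ?_
  · exact ⟨by simpa using h.setVar 5 0 (Or.inl rfl), by simp⟩
  · rintro i hi s' c1 c2 ⟨d1, d2⟩
    set E := (List.range i).flatMap (hsRow n d u v) with hE
    have hin : i * (3 + 2 * d) + (3 + 2 * d) ≤ n * (3 + 2 * d) := by
      calc i * (3 + 2 * d) + (3 + 2 * d) = (i + 1) * (3 + 2 * d) := by ring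
        _ ≤ _ := Nat.mul_le_mul_right _ hi
    refine wp_seq (T1 := 100) (T2 := 300 * d + 210) (by omega) ?_
    refine wp_emitEdge hΓ d1 (α := i) (β := 3 * n + d) (by omega) (by simp) (by simp [c1])
      (by simp) (by simp [d1.apex]) (by decide) ?_
    intro s2 e1 e2 _
    have hE1 : (E ++ [(i, 3 * n + d)]).length = E.length + 1 := by simp
    refine wp_seq (T1 := 100) (T2 := 300 * d + 110) (by omega) ?_
    refine wp_emitEdge hΓ e1 (α := n + i) (β := 3 * n + d + 2) (by omega)
      (by simp [e1.fst, e2, c1]; omega) (by simp [e1.fst, e2, c1])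
      (by simp [e1.apex]; omega) (by simp [e1.apex]) (by decide) ?_
    intro s3 f1 f2 _
    have hE2 : (E ++ [(i, 3 * n + d)] ++ [(n + i, 3 * n + d + 2)]).length = E.length + 2 := by simp
    refine wp_seq (T1 := 100) (T2 := 300 * d + 6) (by omega) ?_
    refine wp_emitEdge hΓ f1 (α := n + i) (β := 2 * n + i) (by omega)
      (by simp [f1.fst, f2, e2, c1]; omega) (by simp [f1.fst, f2, e2, c1])
      (by simp [f1.fst, f2, e2, c1]; omega) (by simp [f1.fst, f2, e2, c1]) (by decide) ?_
    intro s4 g1 g2 _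
    have hE3 : (E ++ [(i, 3 * n + d)] ++ [(n + i, 3 * n + d + 2)] ++
      [(n + i, 2 * n + i)]).length = E.length + 3 := by simp
    refine wp_mono (wp_coord hx hΓ g1 (i := i) (by rw [g2, f2, e2, c1]) hi (by omega)) (le_refl _) ?_
    rintro s5 ⟨k1, k2⟩
    have hfin : (List.range (i + 1)).flatMap (hsRow n d u v) =
        E ++ [(i, 3 * n + d)] ++ [(n + i, 3 * n + d + 2)] ++ [(n + i, 2 * n + i)] ++
          coordEdges n u v i d := by
      rw [List.range_succ, List.flatMap_append, ← hE, List.flatMap_singleton, hsRow_eq]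
      simp
    rw [hfin]
    refine ⟨k1, k2.fst, k2.setVar 5 _ (Or.inl rfl), ?_⟩
    have := length_coordEdges_le (n := n) (u := u) (v := v) i d
    rw [List.length_append, hE3]
    calc _ ≤ i * (3 + 2 * d) + (3 + 2 * d) := by omega
      _ = _ := by ring
  rintro s1 - - ⟨a1, a2⟩
  set E := (List.range n).flatMap (hsRow n d u v) with hE
  refine wp_seq (T1 := 108 * d + 6) (T2 := 200) (by omega) ?_
  refine wp_for (N := d) (T := 100) (fun k s' =>
      Written n d x (E ++ (List.range k).map fun c => (3 * n + c, 3 * n + d + 1)) s')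
    (by decide) (by decide) (by decide) (by omega) a1.snd ?_ ?_ (by omega) ?_
  · simpa using a1.setVar 5 0 (Or.inl rfl)
  · rintro k hk s' c1 c2 d1
    have hl1 : (E ++ (List.range k).map fun c => (3 * n + c, 3 * n + d + 1)).length =
        E.length + k := by simp
    refine wp_emitEdge hΓ d1 (α := 3 * n + k) (β := 3 * n + d + 1) (by omega)
      (by simp [d1.fst, c1]; omega) (by simp [d1.fst, c1])
      (by simp [d1.apex]; omega) (by simp [d1.apex]) (by decide) ?_
    intro s2 e1 e2 _
    refine ⟨e2.trans c1, e1.snd, ?_⟩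
    have := e1.setVar 5 (k + 1) (Or.inl rfl)
    rw [List.range_succ, List.map_append, ← List.append_assoc]
    exact this
  rintro s2 - - b1
  set F := E ++ (List.range d).map fun c => (3 * n + c, 3 * n + d + 1) with hF
  have hl1 : F.length = E.length + d := by simp [hF]
  refine wp_seq (T1 := 100) (T2 := 100) (by omega) ?_
  refine wp_emitEdge hΓ b1 (α := 3 * n + d) (β := 3 * n + d + 1) (by omega)
    (by simp) (by simp [b1.apex]) (by simp [b1.apex]; omega) (by simp [b1.apex]) (by decide) ?_
  intro s3 e1 _ _
  have hl2 : (F ++ [(3 * n + d, 3 * n + d + 1)]).length = F.length + 1 := by simp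
  refine wp_emitEdge hΓ e1 (α := 3 * n + d + 1) (β := 3 * n + d + 2) (by omega)
    (by simp [e1.apex]; omega) (by simp [e1.apex]) (by simp [e1.apex]; omega) (by simp [e1.apex])
    (by decide) ?_
  intro s4 f1 _ _
  rw [List.append_assoc] at f1
  exact f1

theorem wp_move {s : Store} {E : List (ℕ × ℕ)} (hΓ : Γ.base = 2 ^ w)
    (h : Written n d x E s) (hx0 : 0 < x.length)
    (hlen : x.length + (2 + (3 * n + d + 3)) + 3 * E.length + 3 < 2 ^ w) :
    wp Γ ω moveProg (40 * (2 + (3 * n + d + 3) + 3 * E.length + x.length) + 50) (fun s' =>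
      (∀ a, s'.arr 0 a = ((3 * n + d + 3) :: E.length ::
        ((List.range (3 * n + d + 3)).map (fun a => if a < n then 1 else 0) ++
          edgeWords E)).getD a 0) ∧ s'.used = 0) s := by
  have hv := Γ.valid_zero
  have hw := Γ.one_le
  set o := hsHead n d (3 * n + d + 3) ++ edgeWords E with ho
  have hol : o.length = 2 + (3 * n + d + 3) + 3 * E.length := by
    rw [ho, List.length_append, length_hsHead, length_edgeWords]
  have hmem : ∀ a, s.arr 0 a = (x ++ o).getD a 0 := by
    intro a; rw [h.mem, ho, List.append_assoc]
  have e1 : (Stm.set 10 (.var 3 - .var 9)).run s = s.setVar 10 o.length := by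
    simp [h.pos, h.len, hol]
    congr 1; omega
  refine wp_seq (T1 := 10) (T2 := 40 * (2 + (3 * n + d + 3) + 3 * E.length + x.length) + 40)
    (by omega) (wp_stm _ ?_ (by decide) ?_)
  · simp [h.pos, h.len]; omega
  rw [e1]
  refine wp_seq (T1 := 40 * o.length + 6) (T2 := 40 * x.length + 30) (by omega) ?_
  refine wp_for (N := o.length) (T := 30) (fun k s' => s'.var 4 = E.length ∧ s'.var 9 = x.length ∧
      (∀ a, s'.arr 0 a = if a < k then o.getD a 0 else (x ++ o).getD a 0) ∧ s'.used = 0)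
    (by decide) (by decide) (by decide) (by omega) (by simp) ?_ ?_ (by omega) ?_
  · exact ⟨by simpa using h.count, by simpa using h.len, fun a => by simpa using hmem a, h.used⟩
  · rintro k hk s' c1 c2 ⟨d1, d2, d3, d4⟩
    refine wp_stm _ ?_ (by decide) ?_
    · simp [hv, hΓ, c1, d2]; omega
    · have e2 : (Stm.wr 0 (.var 5) (.rd 0 (.var 9 + .var 5))).run s' =
          s'.setArr 0 k (o.getD k 0) := by
        simp only [Stm.run, Expr.eval_rd, Expr.eval_add, Expr.eval_var, c1, d2, d3]
        rw [if_neg (by omega), List.getD_append_right _ _ _ _ (by omega), Nat.add_sub_cancel_left]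
      rw [e2]
      refine ⟨by simpa using c1, by simpa using c2, by simpa using d1, by simpa using d2,
        fun a => ?_, d4⟩
      simp only [Store.setVar_arr, Store.setArr_arr, if_true, Function.update_apply, d3]
      by_cases e : a = k
      · subst e; simp
      · rw [if_neg e]
        exact if_congr (by omega) rfl rfl
  rintro s1 - c10 ⟨d1, d2, d3, d4⟩
  refine wp_seq (T1 := 40 * x.length + 6) (T2 := 24) (by omega) ?_
  refine wp_for (N := x.length) (T := 30) (fun k s' => s'.var 4 = E.length ∧
      s'.var 10 = o.length ∧
      (∀ a, s'.arr 0 a = if a < o.length + k then o.getD a 0 else (x ++ o).getD a 0) ∧ s'.used = 0)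
    (by decide) (by decide) (by decide) (by omega) d2 ?_ ?_ (by omega) ?_
  · exact ⟨by simpa using d1, by simpa using c10, fun a => by simpa using d3 a, d4⟩
  · rintro k hk s' c1 c2 ⟨f1, f2, f3, f4⟩
    refine wp_stm _ ?_ (by decide) ?_
    · simp [hv, hΓ, c1, f2]; omega
    · have e2 : (Stm.wr 0 (.var 10 + .var 5) 0).run s' =
          s'.setArr 0 (o.length + k) 0 := by
        simp [c1, f2]
      rw [e2]
      refine ⟨by simpa using c1, by simpa using c2, by simpa using f1, by simpa using f2,
        fun a => ?_, f4⟩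
      simp only [Store.setVar_arr, Store.setArr_arr, if_true, Function.update_apply, f3]
      by_cases e : a = o.length + k
      · subst e
        rw [if_pos rfl, if_pos (by omega), List.getD_eq_default _ _ (by omega)]
      · rw [if_neg e]
        exact if_congr (by omega) rfl rfl
  rintro s2 - - ⟨f1, f2, f3, f4⟩
  have hfin : ∀ a, s2.arr 0 a = o.getD a 0 := by
    intro a
    rw [f3]
    split_ifs with ha
    · rfl
    · rw [List.getD_eq_default _ _ (by simp; omega), List.getD_eq_default _ _ (by omega)]
  refine wp_stm _ ?_ (by decide) ?_
  · simp [hv, hΓ]; omega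
  · have e2 : (Stm.wr 0 1 (.var 4)).run s2 = s2.setArr 0 1 E.length := by
      simp [f1]
    rw [e2]
    refine ⟨fun a => ?_, f4⟩
    simp only [Store.setArr_arr, if_true, Function.update_apply, hfin, ho, hsHead]
    rcases a with _ | _ | a
    · simp
    · simp
    · simp

theorem wp_reduce {s : Store} (hx : HSInput n d u v x) (hΓ : Γ.base = 2 ^ w)
    (hlen : x.length + (2 + (3 * n + d + 3)) +
      3 * (n * (3 + 2 * d) + d + 2) + 3 < 2 ^ w) (h0 : ∀ a, s.arr 0 a = x.getD a 0)
    (h4 : s.var 4 = 0) (hu : s.used = 0) (hn : 0 < n) :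
    wp Γ ω reduceProg (2000 * ((n + 1) * (d + 1))) (fun s' =>
      (∀ a, s'.arr 0 a = (hsGraph n d hn u v).encode.getD a 0) ∧ s'.used = 0) s := by
  have hl := hx.length
  have hE := length_hsEdges_le (n := n) (d := d) (u := u) (v := v)
  have e1 : n * (3 + 2 * d) = 3 * n + 2 * (n * d) := by ring
  have e2 : n * (300 * d + 320) = 300 * (n * d) + 320 * n := by ring
  have e3 : (n + 1) * (d + 1) = n * d + n + d + 1 := by ring
  refine wp_seq (T1 := 40 * (3 * n + d + 3) + 106)
    (T2 := (n * (300 * d + 320) + 108 * d + 212) +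
      (40 * (2 + (3 * n + d + 3) + 3 * (hsEdges n d u v).length + x.length) + 50)) (by omega) ?_
  refine wp_mono (wp_head hx hΓ (by omega) h0 h4 hu) (le_refl _) ?_
  intro s1 h1
  refine wp_seq (le_refl _) ?_
  refine wp_mono (wp_edges hx hΓ h1 hlen) (le_refl _) ?_
  intro s2 h2
  refine wp_mono (wp_move hΓ h2 (by omega) (by omega)) (le_refl _) ?_
  intro s3 h3
  rw [hsGraph_encode]
  exact h3

end
end WordRAM

/-! ### From the reduction to an algorithm for Hitting Set -/

namespace WordRAM

/-- A number such that the program writes only registers with smaller numbers. -/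
def Prog.regBound : Prog → ℕ
  | .const dst _ => dst + 1
  | .op _ dst _ _ => dst + 1
  | .load dst _ => dst + 1
  | .store _ _ => 0
  | .rand dst => dst + 1
  | .seq p q => max p.regBound q.regBound
  | .branch _ p q => max p.regBound q.regBound
  | .loop _ p => p.regBound

/-- A program reaches finitely many registers, so clearing those below `regBound` restores all
registers to zero. -/
theorem Exec.reg_eq {w : ℕ} {ω : Tape w} {P : Prog} {s s' : State w} {t : ℕ}
    (h : Exec ω P s t s') : ∀ r, P.regBound ≤ r → s'.reg r = s.reg r := by
  induction h with
  | const dst k s => exact fun r hr => by rw [State.setReg_reg, if_neg (Nat.ne_of_gt hr)]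
  | op o dst a b s => exact fun r hr => by rw [State.setReg_reg, if_neg (Nat.ne_of_gt hr)]
  | load dst addr s => exact fun r hr => by rw [State.setReg_reg, if_neg (Nat.ne_of_gt hr)]
  | store addr src s => exact fun r hr => rfl
  | rand dst s =>
    exact fun r hr => by
      show (s.setReg dst _).reg r = _
      rw [State.setReg_reg, if_neg (Nat.ne_of_gt hr)]
  | seq p q s s' s'' t t' _ _ ih1 ih2 =>
    exact fun r hr => (ih2 r (le_of_max_le_right hr)).trans (ih1 r (le_of_max_le_left hr))
  | branch_true r p q s s' t _ _ ih => exact fun r hr => ih r (le_of_max_le_left hr)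
  | branch_false r p q s s' t _ _ ih => exact fun r hr => ih r (le_of_max_le_right hr)
  | loop_false r p s _ => exact fun r hr => rfl
  | loop_true r p s s' s'' t t' _ _ _ ih1 ih2 => exact fun r hr => (ih2 r hr).trans (ih1 r hr)

/-- Write `0` into the first `k` registers. -/
def clearRegs : ℕ → Prog
  | 0 => .const 0 0
  | k + 1 => clearRegs k ;> .const k 0

theorem exec_clearRegs {w : ℕ} (ω : Tape w) (k : ℕ) (s : State w) :
    ∃ s', Exec ω (clearRegs k) s (k + 1) s' ∧ s'.mem = s.mem ∧ s'.used = s.used ∧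
      (∀ r < k, s'.reg r = 0) ∧ ∀ r, s.reg r = 0 → s'.reg r = 0 := by
  induction k with
  | zero =>
    refine ⟨_, Exec.const _ _ _, rfl, rfl, fun r hr => absurd hr (by omega), fun r hr => ?_⟩
    rw [State.setReg_reg]
    split_ifs
    · rfl
    · exact hr
  | succ k ih =>
    obtain ⟨s1, x1, m1, u1, a1, b1⟩ := ih
    refine ⟨_, Exec.seq _ _ _ _ _ _ _ x1 (Exec.const _ _ _), m1, u1, fun r hr => ?_, fun r hr => ?_⟩
    · rw [State.setReg_reg]
      split_ifs with h
      · rfl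
      · exact a1 r (by omega)
    · rw [State.setReg_reg]
      split_ifs
      · rfl
      · exact b1 r hr

/-- Decide Hitting Set by means of a program that approximates the bichromatic radius. -/
def hsProg (P : Prog) : Prog :=
  (reduceProg ;> clearRegs reduceProg.regBound) ;> P ;> .const 1 5 ;> .op .lt 0 0 1

section
variable {w : ℕ} {n d : ℕ} {u v : ℕ → ℕ → Bool} {x : List ℕ}

/-- A bound for the time of the reduction. -/
def reduceTime (n d : ℕ) : ℕ := 2000 * ((n + 1) * (d + 1)) + (reduceProg.regBound + 1)

/-- The final state is equal to the initial one for the graph, in all registers, all memory cells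
and the position on the tape. So whatever is run next, with the same tape, is a genuine run on the
graph, and its success probability carries over. -/
theorem exec_reduce (ω : Tape w) (hx : HSInput n d u v x) (hxw : ∀ i, x.getD i 0 < 2 ^ w)
    (hlen : x.length + (2 + (3 * n + d + 3)) + 3 * (n * (3 + 2 * d) + d + 2) + 3 < 2 ^ w)
    (hn : 0 < n) : ∃ t ≤ reduceTime n d, Exec ω (reduceProg ;> clearRegs reduceProg.regBound)
      (State.init w x) t (State.init w (hsGraph n d hn u v).encode) := by
  have hw : 1 ≤ w := by
    rcases Nat.eq_zero_or_pos w with rfl | h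
    · simp at hlen
    · exact h
  obtain ⟨t, σ, s, x1, R, ht, hs, hu⟩ := wp_reduce (Γ := flatLayout hw) (ω := ω)
    (s := inputStore x) hx rfl hlen (fun _ => rfl) rfl rfl hn _ (rel_init hw x hxw)
  obtain ⟨σ', x2, m2, u2, a2, b2⟩ := exec_clearRegs ω reduceProg.regBound σ
  have hfin : σ' = State.init w (hsGraph n d hn u v).encode := by
    refine State.ext ?_ ?_ ?_
    · funext r
      rcases lt_or_ge r reduceProg.regBound with h | h
      · exact a2 r h
      · exact b2 r (x1.reg_eq r h)
    · funext a
      have h1 := R.mem 0 a.toNat (by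
        rw [Layout.valid_zero]; exact a.isLt)
      rw [hs] at h1
      have h2 : BitVec.ofNat w ((flatLayout hw).addr 0 a.toNat) = a := by
        simp [Layout.addr]
      rw [h2] at h1
      rw [m2]
      apply BitVec.eq_of_toNat_eq
      show _ = (BitVec.ofNat w _).toNat
      rw [← h1]
      simp
    · rw [u2, R.used, hu]; rfl
  rw [← hfin]
  exact ⟨_, by unfold reduceTime; omega, Exec.seq _ _ _ _ _ _ _ x1 x2⟩

theorem computes_hsProg {P : Prog} {T p ε : ℝ} (hε : 0 < ε) (hx : HSInput n d u v x)
    (hxw : ∀ i, x.getD i 0 < 2 ^ w)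
    (hlen : x.length + (2 + (3 * n + d + 3)) + 3 * (n * (3 + 2 * d) + d + 2) + 3 < 2 ^ w)
    (hn : 0 < n) (h : Computes P w (hsGraph n d hn u v).encode T p
      ((hsGraph n d hn u v).IsApprox (5 / 3 - ε))) :
    Computes (hsProg P) w x (T + (reduceTime n d + 2 : ℕ)) p
      (fun out => out ≠ 0 ↔ Hits n d u v) := by
  obtain ⟨h1, h2⟩ := h
  have step : ∀ (ω : Tape w) (t : ℕ) (s : State w),
      Exec ω P (State.init w (hsGraph n d hn u v).encode) t s → ∃ t' s',
        Exec ω (hsProg P) (State.init w x) t' s' ∧ t' ≤ t + (reduceTime n d + 2) ∧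
        ((s'.reg 0).toNat ≠ 0 ↔ (s.reg 0).toNat < 5) := by
    intro ω t s hs
    obtain ⟨t0, ht0, x0⟩ := exec_reduce ω hx hxw hlen hn
    refine ⟨_, _, Exec.seq _ _ _ _ _ _ _ x0 (Exec.seq _ _ _ _ _ _ _ hs
      (Exec.seq _ _ _ _ _ _ _ (Exec.const _ _ _) (Exec.op _ _ _ _ _))), by omega, ?_⟩
    have h5 : (BitVec.ofNat w 5).toNat = 5 := by
      rw [BitVec.toNat_ofNat, Nat.mod_eq_of_lt (by omega)]
    have h6 : (BitVec.ofNat w 1).toNat = 1 := by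
      rw [BitVec.toNat_ofNat, Nat.mod_eq_of_lt (by omega)]
    simp only [State.setReg_reg, if_true, Op.eval, zero_ne_one, if_false, h5]
    split_ifs with hlt
    · simpa [h6] using hlt
    · simpa using hlt
  refine ⟨fun ω => ?_, h2.trans (MeasureTheory.measureReal_mono ?_)⟩
  · obtain ⟨t, s, hs, ht⟩ := h1 ω
    obtain ⟨t', s', hs', ht', -⟩ := step ω t s hs
    refine ⟨t', s', hs', ?_⟩
    have : (t' : ℝ) ≤ t + (reduceTime n d + 2 : ℕ) := by exact_mod_cast ht'
    linarith
  · rintro ω ⟨t, s, hs, hr⟩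
    obtain ⟨t', s', hs', -, ho⟩ := step ω t s hs
    exact ⟨t', s', hs', ho.trans (isApprox_hsGraph_iff hn hε hr)⟩

end
end WordRAM

namespace HSInstance
variable {n d : ℕ} (I : HSInstance n d)

/-- The coordinates of a family of vectors. -/
def bits (U : Fin n → Fin d → Bool) (i c : ℕ) : Bool :=
  if h : i < n ∧ c < d then U ⟨i, h.1⟩ ⟨c, h.2⟩ else false

theorem hits_iff : Hits n d (bits I.U) (bits I.V) ↔ I.HasHittingSet := by
  constructor
  · rintro ⟨i, hi, h⟩
    refine ⟨⟨i, hi⟩, fun j => ?_⟩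
    obtain ⟨c, hc, h1, h2⟩ := h j j.isLt
    exact ⟨⟨c, hc⟩, by simpa [bits, hi, hc] using h1, by simpa [bits, hc] using h2⟩
  · rintro ⟨i, h⟩
    refine ⟨i, i.isLt, fun j hj => ?_⟩
    obtain ⟨c, h1, h2⟩ := h ⟨j, hj⟩
    exact ⟨c, c.isLt, by simpa [bits] using h1, by simpa [bits, hj] using h2⟩

theorem length_flatten_bits (U : Fin n → Fin d → Bool) :
    (List.ofFn fun i => List.ofFn fun c => (U i c).toNat).flatten.length = n * d := by
  rw [List.length_flatten, List.map_ofFn]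
  simp [Function.comp_def]

theorem getD_flatten_bits (U : Fin n → Fin d → Bool) {i c : ℕ} (hi : i < n) (hc : c < d) :
    (List.ofFn fun i => List.ofFn fun c => (U i c).toNat).flatten.getD (i * d + c) 0 =
      (bits U i c).toNat := by
  have e : (List.ofFn fun i => List.ofFn fun c => (U i c).toNat).flatten =
      (List.finRange n).flatMap fun i => List.ofFn fun c => (U i c).toNat := by
    rw [List.flatMap_def, List.ofFn_eq_map]
  rw [e, mul_comm, List.getD_flatMap _ d (by simp) _ _ _ (by simpa using hi) hc]
  simp [bits, hi, hc]

theorem hsInput : WordRAM.HSInput n d (bits I.U) (bits I.V) I.encode := by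
  have hU := length_flatten_bits I.U
  have hV := length_flatten_bits I.V
  have hidx : ∀ i < n, ∀ c < d, i * d + c < n * d := by
    intro i hi c hc
    calc i * d + c < i * d + d := by omega
      _ = (i + 1) * d := by ring
      _ ≤ n * d := Nat.mul_le_mul_right _ hi
  refine ⟨?_, rfl, rfl, fun i hi c hc => ?_, fun i hi c hc => ?_⟩
  · rw [encode, List.length_cons, List.length_cons, List.length_append, hU, hV]
    ring
  · rw [encode, show 2 + (i * d + c) = (i * d + c) + 1 + 1 by ring, List.getD_cons_succ,
      List.getD_cons_succ, List.getD_append _ _ _ _ (by rw [hU]; exact hidx i hi c hc),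
      getD_flatten_bits _ hi hc]
  · rw [encode, show 2 + (n * d + (i * d + c)) = (n * d + (i * d + c)) + 1 + 1 by ring,
      List.getD_cons_succ, List.getD_cons_succ,
      List.getD_append_right _ _ _ _ (by rw [hU]; omega), hU, Nat.add_sub_cancel_left,
      getD_flatten_bits _ hi hc]

end HSInstance

theorem List.foldr_max_le {l : List ℕ} {B : ℕ} (h : ∀ a ∈ l, a ≤ B) : l.foldr max 0 ≤ B := by
  induction l with
  | nil => exact Nat.zero_le _
  | cons a l ih =>
    exact max_le (h a (List.mem_cons_self ..)) (ih fun b hb => h b (List.mem_cons_of_mem _ hb))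

section
open WordRAM
variable {n d : ℕ} {u v : ℕ → ℕ → Bool} {x : List ℕ}

/-- The reduction increases the size of the input by a polynomial only. -/
theorem WordRAM.HSInput.word_bounds (hx : HSInput n d u v x) (hn : 0 < n) :
    x.length + (2 + (3 * n + d + 3)) + 3 * (n * (3 + 2 * d) + d + 2) + 3 < 2 ^ (5 * inputBits x) ∧
    inputBits (hsGraph n d hn u v).encode ≤ 4 * inputBits x := by
  obtain ⟨M, hM⟩ : ∃ M, M = x.length + x.foldr max 0 + 2 := ⟨_, rfl⟩
  have hMb : M ≤ 2 ^ inputBits x := hM ▸ le_two_pow_inputBits x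
  have hpow : ∀ k, M ^ k ≤ 2 ^ (k * inputBits x) := fun k => by
    rw [mul_comm, pow_mul]; exact Nat.pow_le_pow_left hMb k
  have h1 : n ≤ x.foldr max 0 := by
    have := List.getD_le_foldr_max x 0
    rwa [hx.fst] at this
  have h2 : d ≤ x.foldr max 0 := by
    have := List.getD_le_foldr_max x 1
    rwa [hx.snd] at this
  have hl := hx.length
  have e1 : n * (3 + 2 * d) = 3 * n + 2 * (n * d) := by ring
  have hE := length_hsEdges_le (n := n) (d := d) (u := u) (v := v)
  have hM5 : 5 ≤ M := by omega
  -- The graph has size linear in the input size `M`; as `M ≥ 5`, the constant is absorbed by `M ^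
  -- 3`.
  have hsmall : ∀ {a}, a ≤ 40 * M → a ≤ M ^ 4 := by
    intro a ha
    calc a ≤ 40 * M := ha
      _ ≤ (5 * 5 * 5) * M := Nat.mul_le_mul_right _ (by omega)
      _ ≤ (M * M * M) * M := Nat.mul_le_mul_right _
          (Nat.mul_le_mul (Nat.mul_le_mul hM5 hM5) hM5)
      _ = M ^ 4 := by ring
  constructor
  · refine lt_of_le_of_lt (hsmall (by omega)) (lt_of_lt_of_le ?_ (hpow 5))
    exact Nat.pow_lt_pow_right (by omega) (by omega)
  · refine Nat.clog_le_of_le_pow (le_trans (hsmall ?_) (hpow 4))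
    have h3 : (hsGraph n d hn u v).encode.foldr max 0 ≤
        3 * n + d + 3 + (hsEdges n d u v).length := by
      rw [hsGraph_encode]
      refine List.foldr_max_le fun a ha => ?_
      simp only [List.mem_cons, List.mem_append, List.mem_map, List.mem_flatMap,
        List.not_mem_nil, or_false] at ha
      rcases ha with rfl | rfl | ⟨b, -, rfl⟩ | ⟨e, he, h⟩
      · omega
      · omega
      · split_ifs <;> omega
      · have := hsEdges_lt e he
        omega
    have h4 : (hsGraph n d hn u v).encode.length =
        2 + (3 * n + d + 3) + 3 * (hsEdges n d u v).length := by
      have := length_edgeWords (hsEdges n d u v)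
      rw [edgeWords] at this
      rw [hsGraph_encode, List.length_cons, List.length_cons, List.length_append, this,
        List.length_map, List.length_range]
      omega
    omega

/-- A uniform constant is needed because the time bound for Hitting Set concerns every `n ≥ 1`. The
finitely many small `n` are covered by the sum of their dimensions. -/
theorem exists_dim_bound {d : ℕ → ℕ} {η : ℝ} (hη : 0 < η)
    (hd : (fun n : ℕ => (d n : ℝ)) =O[Filter.atTop] (fun n : ℕ => (n : ℝ) ^ η)) :
    ∃ D : ℕ, ∀ n : ℕ, 1 ≤ n → (d n : ℝ) + 1 ≤ D * (n : ℝ) ^ η := by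
  obtain ⟨c, hc⟩ := hd.bound
  obtain ⟨n₀, hn₀⟩ := Filter.eventually_atTop.1 hc
  refine ⟨⌈|c|⌉₊ + 1 + ∑ i ∈ Finset.range n₀, d i, fun n hn => ?_⟩
  have h1 : (1 : ℝ) ≤ (n : ℝ) ^ η := Real.one_le_rpow (by exact_mod_cast hn) hη.le
  have h2 : |c| ≤ (⌈|c|⌉₊ : ℝ) := Nat.le_ceil _
  have h3 : (0 : ℝ) ≤ ((∑ i ∈ Finset.range n₀, d i : ℕ) : ℝ) := Nat.cast_nonneg _
  have h4 : (d n : ℝ) ≤ ⌈|c|⌉₊ * (n : ℝ) ^ η + (∑ i ∈ Finset.range n₀, d i : ℕ) * (n : ℝ) ^ η := by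
    rcases le_or_gt n₀ n with h | h
    · have h5 := hn₀ n h
      rw [Real.norm_of_nonneg (Nat.cast_nonneg _), Real.norm_of_nonneg (by positivity)] at h5
      have h6 : c * (n : ℝ) ^ η ≤ ⌈|c|⌉₊ * (n : ℝ) ^ η :=
        mul_le_mul_of_nonneg_right ((le_abs_self c).trans h2) (by positivity)
      have h7 := mul_nonneg h3 (show 0 ≤ (n : ℝ) ^ η by positivity)
      linarith
    · have h5 : d n ≤ ∑ i ∈ Finset.range n₀, d i :=
        Finset.single_le_sum (f := d) (fun _ _ => Nat.zero_le _) (Finset.mem_range.2 h)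
      have h6 : (d n : ℝ) ≤ ((∑ i ∈ Finset.range n₀, d i : ℕ) : ℝ) := by exact_mod_cast h5
      have h7 : (0 : ℝ) ≤ ⌈|c|⌉₊ * (n : ℝ) ^ η := by positivity
      nlinarith
  rw [Nat.cast_add, Nat.cast_add, Nat.cast_one, add_mul, add_mul, one_mul]
  linarith

/-- The graph has at most `5 * n * (d + 1)` edges, that is, `O(n ^ (1 + δ/4))`, and `(1 + δ/4) * (2
- δ) ≤ 2 - δ/2`. The reduction itself is linear in `n * d`, and `δ ≤ 1` gives `1 + δ/4 ≤ 2 - δ/2`.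
-/
theorem reduction_time_le {D C n d m R : ℕ} {δ : ℝ} (hδ : 0 < δ) (hδ1 : δ ≤ 1) (hn : 1 ≤ n)
    (hm1 : 1 ≤ m) (hm : m ≤ n * (3 + 2 * d) + d + 2)
    (hd : (d : ℝ) + 1 ≤ D * (n : ℝ) ^ (δ / 4)) :
    C * (m : ℝ) ^ (2 - δ) + ((2000 * ((n + 1) * (d + 1)) + R : ℕ) : ℝ) ≤
      (C * (5 * D) ^ 2 + 4000 * D + R : ℕ) * (n : ℝ) ^ (2 - δ / 2) := by
  have hnR : (1 : ℝ) ≤ n := by exact_mod_cast hn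
  have hn0 : (0 : ℝ) < n := by linarith
  have hdR : (0 : ℝ) ≤ d := Nat.cast_nonneg _
  have hmR : (1 : ℝ) ≤ m := by exact_mod_cast hm1
  have hD : 1 ≤ D := by
    by_contra hc
    have : D = 0 := by omega
    rw [this, Nat.cast_zero, zero_mul] at hd
    linarith
  have hDR : (1 : ℝ) ≤ D := by exact_mod_cast hD
  have hnd : (n : ℝ) * (d + 1) ≤ D * (n : ℝ) ^ (1 + δ / 4) := by
    rw [Real.rpow_add hn0, Real.rpow_one]
    nlinarith
  have hm2 : (m : ℝ) ≤ 5 * D * (n : ℝ) ^ (1 + δ / 4) := by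
    have h1 : m ≤ 5 * (n * (d + 1)) := by
      have h2 : d ≤ n * d := Nat.le_mul_of_pos_left _ hn
      have e1 : n * (3 + 2 * d) = 3 * n + 2 * (n * d) := by ring
      have e2 : n * (d + 1) = n * d + n := by ring
      omega
    have h3 : (m : ℝ) ≤ 5 * (n * (d + 1)) := by exact_mod_cast h1
    linarith
  have hpow1 : (n : ℝ) ^ (1 + δ / 4) ≤ (n : ℝ) ^ (2 - δ / 2) :=
    Real.rpow_le_rpow_of_exponent_le hnR (by linarith)
  have hpow0 : 1 ≤ (n : ℝ) ^ (2 - δ / 2) := Real.one_le_rpow hnR (by linarith)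
  have hmain : (m : ℝ) ^ (2 - δ) ≤ (5 * D) ^ 2 * (n : ℝ) ^ (2 - δ / 2) := by
    calc (m : ℝ) ^ (2 - δ) ≤ (5 * D * (n : ℝ) ^ (1 + δ / 4)) ^ (2 - δ) :=
          Real.rpow_le_rpow (by linarith) hm2 (by linarith)
      _ = (5 * D : ℝ) ^ (2 - δ) * (n : ℝ) ^ ((1 + δ / 4) * (2 - δ)) := by
          rw [Real.mul_rpow (by positivity) (by positivity), ← Real.rpow_mul hn0.le]
      _ ≤ (5 * D) ^ 2 * (n : ℝ) ^ (2 - δ / 2) := by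
          refine mul_le_mul ?_ (Real.rpow_le_rpow_of_exponent_le hnR (by nlinarith))
            (by positivity) (by positivity)
          rw [← Real.rpow_natCast]
          exact Real.rpow_le_rpow_of_exponent_le (by linarith) (by push_cast; linarith)
  have h5 : ((2000 * ((n + 1) * (d + 1)) + R : ℕ) : ℝ) ≤
      (4000 * D + R) * (n : ℝ) ^ (2 - δ / 2) := by
    have h6 : (n + 1) * (d + 1) ≤ 2 * (n * (d + 1)) := by
      calc (n + 1) * (d + 1) ≤ (2 * n) * (d + 1) := Nat.mul_le_mul_right _ (by omega)
        _ = _ := by ring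
    have h7 : (((n + 1) * (d + 1) : ℕ) : ℝ) ≤ 2 * (n * (d + 1)) := by exact_mod_cast h6
    have h8 : (R : ℝ) * 1 ≤ R * (n : ℝ) ^ (2 - δ / 2) :=
      mul_le_mul_of_nonneg_left hpow0 (Nat.cast_nonneg _)
    have h9 : (D : ℝ) * (n : ℝ) ^ (1 + δ / 4) ≤ D * (n : ℝ) ^ (2 - δ / 2) :=
      mul_le_mul_of_nonneg_left hpow1 (Nat.cast_nonneg _)
    rw [Nat.cast_add, Nat.cast_mul]
    push_cast at h7 ⊢
    linarith
  have h10 := mul_le_mul_of_nonneg_left hmain (Nat.cast_nonneg C : (0 : ℝ) ≤ C)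
  push_cast at h5 ⊢
  linarith

/-- An approximation algorithm for the bichromatic radius yields an algorithm for Hitting Set. -/
theorem hsSolvable_of_radius {dim : ℕ → ℕ} {ε δ : ℝ} (hε : 0 < ε) (hδ : 0 < δ) (hδ1 : δ ≤ 1)
    (hdim : (fun n : ℕ => (dim n : ℝ)) =O[Filter.atTop] (fun n : ℕ => (n : ℝ) ^ (δ / 4)))
    {P : Prog} {c C : ℕ} (h : ∀ I : BichromaticInstance, I.Unweighted → ∀ w : ℕ,
      c * inputBits I.encode ≤ w → Computes P w I.encode (C * (I.m : ℝ) ^ (2 - δ)) (2 / 3)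
        (I.IsApprox (5 / 3 - ε))) : HSSolvableInTime dim (2 - δ / 2) := by
  obtain ⟨D, hD⟩ := exists_dim_bound (by linarith) hdim
  obtain ⟨R, hR⟩ : ∃ R, ∀ n d, reduceTime n d + 2 = 2000 * ((n + 1) * (d + 1)) + R :=
    ⟨reduceProg.regBound + 3, fun n d => by unfold reduceTime; omega⟩
  -- The part `4 * c` provides the words that `P` needs on the graph, and `5` those for the
  -- addresses used by the reduction.
  refine ⟨hsProg P, 4 * c + 5, C * (5 * D) ^ 2 + 4000 * D + R, fun n hn I w hw => ?_⟩
  have hx := I.hsInput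
  obtain ⟨b1, b2⟩ := hx.word_bounds hn
  have hw5 : 5 * inputBits I.encode ≤ w := by
    refine le_trans (Nat.mul_le_mul_right _ (by omega)) hw
  have hw4 : c * inputBits (hsGraph n (dim n) hn (HSInstance.bits I.U)
      (HSInstance.bits I.V)).encode ≤ w := by
    calc _ ≤ c * (4 * inputBits I.encode) := Nat.mul_le_mul_left _ b2
      _ = (4 * c) * inputBits I.encode := by ring
      _ ≤ (4 * c + 5) * inputBits I.encode := Nat.mul_le_mul_right _ (by omega)
      _ ≤ w := hw
  have hxw : ∀ i, I.encode.getD i 0 < 2 ^ w := by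
    intro i
    have h1 := List.getD_le_foldr_max I.encode i
    have h2 := le_two_pow_inputBits I.encode
    have h3 : 2 ^ inputBits I.encode ≤ 2 ^ w := Nat.pow_le_pow_right (by omega) (by omega)
    omega
  obtain ⟨h1, h2⟩ := computes_hsProg hε hx hxw
    (lt_of_lt_of_le b1 (Nat.pow_le_pow_right (by omega) hw5)) hn
    (h _ (hsGraph_unweighted hn) w hw4)
  refine ⟨fun ω => ?_, ?_⟩
  · obtain ⟨t, s, hs, ht⟩ := h1 ω
    refine ⟨t, s, hs, ht.trans ?_⟩
    rw [hsGraph_m, hR]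
    exact reduction_time_le hδ hδ1 hn (by simp [hsEdges]; omega) length_hsEdges_le (hD n hn)
  · simpa only [I.hits_iff] using h2

end
theorem mainTheorem2 :
    (∀ k : ℕ, ∃ (P : WordRAM.Prog) (c C q : ℕ), ∀ (I : BichromaticInstance) (w : ℕ),
      c * WordRAM.inputBits I.encode ≤ w →
      WordRAM.Computes P w I.encode
        (C * (I.m : ℝ) ^ (3 / 2 : ℝ) * Real.log (I.m + 2) ^ q)
        (1 - 1 / (I.n : ℝ) ^ k)
        (I.IsApprox (5 / 3))) ∧
    (HittingSetHypothesis →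
      ∀ ε : ℝ, 0 < ε → ∀ δ : ℝ, 0 < δ →
        ¬ ∃ (P : WordRAM.Prog) (c C : ℕ), ∀ I : BichromaticInstance, I.Unweighted →
          ∀ w : ℕ, c * WordRAM.inputBits I.encode ≤ w →
          WordRAM.Computes P w I.encode
            (C * (I.m : ℝ) ^ (2 - δ))
            (2 / 3)
            (I.IsApprox (5 / 3 - ε))) := by
  refine ⟨fun k => ⟨_, _, _, 2, WordRAM.computes_radius k⟩, ?_⟩
  rintro ⟨dim, -, hdim, hhard⟩ ε hε δ hδ ⟨P, c, C, h⟩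
  -- A large `δ` can be lowered to `1`: as `m ≥ 1`, this only relaxes the assumed time bound.
  have hδ' : 0 < min δ 1 := lt_min hδ one_pos
  refine hhard (min δ 1 / 2) (half_pos hδ') (hsSolvable_of_radius hε hδ' (min_le_right _ _)
    (hdim _ (by linarith)) (P := P) (c := c) (C := C)
    fun I hI w hw => ?_)
  obtain ⟨h1, h2⟩ := h I hI w hw
  refine ⟨fun ω => ?_, h2⟩
  obtain ⟨t, s, hs, ht⟩ := h1 ω
  refine ⟨t, s, hs, ht.trans (mul_le_mul_of_nonneg_left ?_ (Nat.cast_nonneg C))⟩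
  refine Real.rpow_le_rpow_of_exponent_le ?_ (by linarith [min_le_left δ 1])
  exact_mod_cast I.m_pos
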